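/- Conventions. Let $k$ be a commutative ring. A left bialgebroid $U=(U,A,s,t,\Delta,\epsilon)$ over a $k$-algebra $A$ carries the $A$-actions $a\triangleright u\triangleleft b=s(a)t(b)u$, $a\blacktriangleright u\blacktriangleleft b=u\,t(a)s(b)$ and a coproduct $\Delta(u)=u_{(1)}\otimes u_{(2)}\in U_\triangleleft\otimes_A{}_\triangleright U$ (with unital counit, $\epsilon(1)=1$). Right bialgebroids are defined symmetrically, with coproduct in $H_\blacktriangleleft\otimes_B{}_\blacktriangleright H$. Morphisms are pairs (algebra map on the total rings, algebra map on the base rings) compatible with all structure maps. The opposite–coopposite $(H^r)^{op}_{coop}$ of a right bialgebroid over $B$ is a left bialgebroid over $B^{op}$. * $U$ is a *left Hopf algebroid* if $\alpha_\ell:{}_\blacktriangleright U\otimes_{A^{op}}U_\triangleleft\to U_\triangleleft\otimes_A{}_\triangleright U$, $u\otimes v\mapsto u_{(1)}\otimes u_{(2)}v$, is bijective; then $u_+\otimes u_-:=\alpha_\ell^{-1}(u\otimes 1)$. * $U^*$ is the $k$-module of $\phi\in\mathrm{Hom}_k(U,A)$ with $\phi(t(a)u)=\phi(u)a$. If $U_\triangleleft$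 is finitely generated projective over $A$, it is a right bialgebroid over $A$ with $(\phi\phi')(u)=\phi'(s(\phi(u_{(1)}))u_{(2)})$, unit $\epsilon$, source $a\mapsto\epsilon(\,\cdot\,s(a))$, target $a\mapsto a\,\epsilon(\cdot)$, counit $\phi\mapsto\phi(1)$, and coproduct determined by $\phi(uv)=\phi^{(1)}(u\,t(\phi^{(2)}(v)))$. * $U_*$ is the $k$-module of $\psi\in\mathrm{Hom}_k(U,A)$ with $\psi(s(a)u)=a\psi(u)$. If ${}_\triangleright U$ is finitely generated projective over $A$, it is a right bialgebroid over $A$ with $(\psi\psi')(u)=\psi'(t(\psi(u_{(2)}))u_{(1)})$, unit $\epsilon$, source $a\mapsto\epsilon(\cdot)a$, target $a\mapsto\epsilon(\,\cdot\,t(a))$, counit $\psi\mapsto\psi(1)$, and coproduct determined by $\psi(uv)=\psi^{(2)}(u\,s(\psi^{(1)}(v)))$. * For a left Hopf algebroid $U$, $S^*:U^*\to U_*$ is $S^*(\phi)(u)=\epsilon\big(u_+\,t(\phi(u_-))\big)$. * A *full Hopf algebroid* is a $k$-algebra $H$ with a left bialgebroid structure $H^\ell=(H,A,s^\ell,t^\ell,\Delta_\ell,\epsilon)$,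 a right bialgebroid structure $H^r=(H,B,s^r,t^r,\Delta_r,\partial)$ and a $k$-linear map $S:H\to H$ such that $s^\ell\epsilon t^r=t^r$, $t^\ell\epsilon s^r=s^r$, $s^r\partial t^\ell=t^\ell$, $t^r\partial s^\ell=s^\ell$; $(\Delta_\ell\otimes\mathrm{id})\Delta_r=(\mathrm{id}\otimes\Delta_r)\Delta_\ell$, $(\Delta_r\otimes\mathrm{id})\Delta_\ell=(\mathrm{id}\otimes\Delta_\ell)\Delta_r$; $S(t^\ell(a)\,h\,t^r(b))=s^r(b)S(h)s^\ell(a)$; $S(h_{(1)})h_{(2)}=s^r\partial(h)$ and $h^{(1)}S(h^{(2)})=s^\ell\epsilon(h)$, where $\Delta_\ell(h)=h_{(1)}\otimes h_{(2)}$ and $\Delta_r(h)=h^{(1)}\otimes h^{(2)}$. Then $\nu:=\partial s^\ell:A\to B^{op}$ is an isomorphism of $k$-algebras. **Theorem.** Let $H$ be a full Hopf algebroid such that ${}_\triangleright H$ and $H_\triangleleft$ (for the left bialgebroid $H^\ell$) are finitely generated projective over $A$. Then $(S,\nu):H^\ell\to(H^r)^{op}_{coop}$ is a morphism of left bialgebroids,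 and $H^\ell$ and $(H^r)^{op}_{coop}$ are left Hopf algebroids. Let $${}^tS:\big((H^r)^{op}_{coop}\big)^*\to(H^\ell)^*,\qquad {}^tS:\big((H^r)^{op}_{coop}\big)_*\to(H^\ell)_*$$ be the transposes $\phi\mapsto\nu^{-1}\circ\phi\circ S$, and let $S^*_\ell:(H^\ell)^*\to(H^\ell)_*$ and $S^*_r:\big((H^r)^{op}_{coop}\big)^*\to\big((H^r)^{op}_{coop}\big)_*$ be the maps $S^*$ of these two left Hopf algebroids. Then $${}^tS\circ S^*_r=S^*_\ell\circ{}^tS .$$ If moreover $S$ is bijective, then the two modules ${}_\triangleright(\cdot)$ and $(\cdot)_\triangleleft$ of $(H^r)^{op}_{coop}$ are finitely generated projective over $B^{op}$ as well, and all four maps in this commutative square are morphisms of right bialgebroids: the two maps ${}^tS$ over $\nu^{-1}:B^{op}\to A$, the map $S^*_r$ over $\mathrm{id}_{B^{op}}$ and the map $S^*_\ell$ over $\mathrm{id}_A$. -/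

import Mathlib

open scoped TensorProduct
open MulOpposite


section BalancedTensor

variable {k : Type*} [CommRing k] {M N P : Type*} [AddCommGroup M] [AddCommGroup N]
  [AddCommGroup P] [Module k M] [Module k N] [Module k P] {A B : Type*}

/-- The relations `m a ⊗ n - m ⊗ a n`, for a right action `r` of `A` on `M` and a left action
`l` of `A` on `N`. -/
def balRel (r : A → Module.End k M) (l : A → Module.End k N) : Submodule k (M ⊗[k] N) :=
  Submodule.span k {x | ∃ a m n, x = r a m ⊗ₜ[k] n - m ⊗ₜ[k] l a n}

/-- The balanced tensor product `M ⊗_A N` of a right and a left `A`-module. -/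
abbrev BalTensor (r : A → Module.End k M) (l : A → Module.End k N) : Type _ :=
  (M ⊗[k] N) ⧸ balRel r l

/-- The class in `M ⊗_A N` of an element of `M ⊗_k N`. -/
abbrev balMk (r : A → Module.End k M) (l : A → Module.End k N) :
    (M ⊗[k] N) →ₗ[k] BalTensor r l :=
  (balRel r l).mkQ

/-- The relations of `M ⊗_A N ⊗_B P`. -/
def balRel₃ (r : A → Module.End k M) (l : A → Module.End k N)
    (r' : B → Module.End k N) (l' : B → Module.End k P) : Submodule k (M ⊗[k] (N ⊗[k] P)) :=
  Submodule.span k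
    ({x | ∃ a m n p, x = r a m ⊗ₜ[k] (n ⊗ₜ[k] p) - m ⊗ₜ[k] (l a n ⊗ₜ[k] p)} ∪
     {x | ∃ b m n p, x = m ⊗ₜ[k] (r' b n ⊗ₜ[k] p) - m ⊗ₜ[k] (n ⊗ₜ[k] l' b p)})

/-- The balanced tensor product `M ⊗_A N ⊗_B P`. -/
abbrev BalTensor₃ (r : A → Module.End k M) (l : A → Module.End k N)
    (r' : B → Module.End k N) (l' : B → Module.End k P) : Type _ :=
  (M ⊗[k] (N ⊗[k] P)) ⧸ balRel₃ r l r' l'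

lemma balMk_rel (r : A → Module.End k M) (l : A → Module.End k N) (a : A) (m : M) (n : N) :
    balMk r l (r a m ⊗ₜ[k] n) = balMk r l (m ⊗ₜ[k] l a n) :=
  (Submodule.Quotient.eq _).2 (Submodule.subset_span ⟨a, m, n, rfl⟩)

/-- A `k`-bilinear map that is balanced over `A` factors through `M ⊗_A N`. -/
def balLift (r : A → Module.End k M) (l : A → Module.End k N) (f : M →ₗ[k] N →ₗ[k] P)
    (hf : ∀ a m n, f (r a m) n = f m (l a n)) : BalTensor r l →ₗ[k] P :=
  (balRel r l).liftQ (TensorProduct.lift f) (by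
    rw [balRel, Submodule.span_le]
    rintro _ ⟨a, m, n, rfl⟩
    simp [hf])

@[simp] lemma balLift_mk (r : A → Module.End k M) (l : A → Module.End k N)
    (f : M →ₗ[k] N →ₗ[k] P) (hf : ∀ a m n, f (r a m) n = f m (l a n)) (x : M ⊗[k] N) :
    balLift r l f hf (Submodule.Quotient.mk x) = TensorProduct.lift f x := rfl

/-- The canonical map `(M ⊗_A N) ⊗_k P → M ⊗_A N ⊗_B P`. -/
def balAssocL (r : A → Module.End k M) (l : A → Module.End k N)
    (r' : B → Module.End k N) (l' : B → Module.End k P) :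
    (BalTensor r l ⊗[k] P) →ₗ[k] BalTensor₃ r l r' l' :=
  TensorProduct.lift ((balRel r l).liftQ
    (TensorProduct.curry ((balRel₃ r l r' l').mkQ ∘ₗ
      (TensorProduct.assoc k M N P).toLinearMap)) (by
    rw [balRel, Submodule.span_le]
    rintro _ ⟨a, m, n, rfl⟩
    rw [SetLike.mem_coe, LinearMap.mem_ker]
    ext p
    rw [map_sub, LinearMap.sub_apply, LinearMap.zero_apply, sub_eq_zero]
    exact (Submodule.Quotient.eq _).2 (Submodule.subset_span (Or.inl ⟨a, m, n, p, rfl⟩))))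

/-- The canonical map `M ⊗_k (N ⊗_B P) → M ⊗_A N ⊗_B P`. -/
def balAssocR (r : A → Module.End k M) (l : A → Module.End k N)
    (r' : B → Module.End k N) (l' : B → Module.End k P) :
    (M ⊗[k] BalTensor r' l') →ₗ[k] BalTensor₃ r l r' l' :=
  TensorProduct.lift (LinearMap.flip ((balRel r' l').liftQ
    (LinearMap.flip (TensorProduct.curry (balRel₃ r l r' l').mkQ)) (by
    rw [balRel, Submodule.span_le]
    rintro _ ⟨b, n, p, rfl⟩
    rw [SetLike.mem_coe, LinearMap.mem_ker]
    ext m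
    rw [map_sub, LinearMap.sub_apply, LinearMap.zero_apply, sub_eq_zero]
    exact (Submodule.Quotient.eq _).2 (Submodule.subset_span (Or.inr ⟨b, m, n, p, rfl⟩)))))

end BalancedTensor

/-- Left multiplication by the elements `f a`. -/
abbrev mulL (k : Type*) {A H : Type*} [CommRing k] [Ring H] [Algebra k H] (f : A → H) :
    A → Module.End k H :=
  fun a => LinearMap.mulLeft k (f a)

/-- Right multiplication by the elements `f a`. -/
abbrev mulR (k : Type*) {A H : Type*} [CommRing k] [Ring H] [Algebra k H] (f : A → H) :
    A → Module.End k H :=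
  fun a => LinearMap.mulRight k (f a)

/-- A left bialgebroid `(U, A, s, t, Δ, ε)`.  Here `a ▷ u ◁ b = s(a) t(b) u` and
`a ▶ u ◀ b = u t(a) s(b)`; the coproduct takes values in `U_◁ ⊗_A ▷U`.
The statements about `Δ` are written for representatives `x : U ⊗[k] U` of elements of
`U_◁ ⊗_A ▷U`; the choice of the representatives does not matter. -/
structure LeftBialgebroid (k A U : Type*) [CommRing k] [Ring A] [Algebra k A] [Ring U]
    [Algebra k U] where
  /-- source -/
  s : A →ₐ[k] U
  /-- target -/
  t : Aᵐᵒᵖ →ₐ[k] U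
  /-- coproduct -/
  Δ : U →ₗ[k] BalTensor (mulL k fun a => t (op a)) (mulL k s)
  /-- counit -/
  ε : U →ₗ[k] A
  s_mul_t : ∀ a b, s a * t b = t b * s a
  comul_bimod : ∀ a b u x, balMk _ _ x = Δ u →
    Δ (s a * t (op b) * u) = balMk _ _ ((s a ⊗ₜ[k] t (op b)) * x)
  counit_bimod : ∀ a b u, ε (s a * t (op b) * u) = a * ε u * b
  coassoc : ∀ u x y, balMk _ _ x = Δ u → balMk _ _ y = Δ u →
    balAssocL _ _ (mulL k fun a => t (op a)) (mulL k s) (LinearMap.rTensor U Δ x) =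
      balAssocR (mulL k fun a => t (op a)) (mulL k s) _ _ (LinearMap.lTensor U Δ y)
  /-- `s(ε(u₁)) u₂ = u` -/
  counit_left : ∀ u x, balMk _ _ x = Δ u →
    LinearMap.mul' k U (TensorProduct.map (s.toLinearMap ∘ₗ ε) LinearMap.id x) = u
  /-- `t(ε(u₂)) u₁ = u` -/
  counit_right : ∀ u x, balMk _ _ x = Δ u →
    LinearMap.mul' k U (TensorProduct.map
      (t.toLinearMap ∘ₗ (opLinearEquiv k).toLinearMap ∘ₗ ε) LinearMap.id
      (TensorProduct.comm k U U x)) = u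
  /-- `Δ` takes values in the Takeuchi-Sweedler product. -/
  takeuchi : ∀ a u x, balMk _ _ x = Δ u →
    balMk (mulL k fun a => t (op a)) (mulL k s) (x * (t (op a) ⊗ₜ[k] 1)) =
      balMk _ _ (x * (1 ⊗ₜ[k] s a))
  comul_one : Δ 1 = balMk _ _ (1 ⊗ₜ[k] 1)
  comul_mul : ∀ u v x y, balMk _ _ x = Δ u → balMk _ _ y = Δ v →
    Δ (u * v) = balMk _ _ (x * y)
  counit_one : ε 1 = 1
  counit_mul_s : ∀ u v, ε (u * v) = ε (u * s (ε v))
  counit_mul_t : ∀ u v, ε (u * v) = ε (u * t (op (ε v)))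

/-- A right bialgebroid `(H, B, s, t, Δ, ∂)`, defined as a left one but with respect to the
actions `b ▶ h ◀ b' = h t(b) s(b')`; the coproduct takes values in `H_◀ ⊗_B ▶H`. -/
structure RightBialgebroid (k B H : Type*) [CommRing k] [Ring B] [Algebra k B] [Ring H]
    [Algebra k H] where
  /-- source -/
  s : B →ₐ[k] H
  /-- target -/
  t : Bᵐᵒᵖ →ₐ[k] H
  /-- coproduct -/
  Δ : H →ₗ[k] BalTensor (mulR k s) (mulR k fun b => t (op b))
  /-- counit -/
  counit : H →ₗ[k] B
  s_mul_t : ∀ a b, s a * t b = t b * s a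
  comul_bimod : ∀ a b h x, balMk _ _ x = Δ h →
    Δ (h * t (op a) * s b) = balMk _ _ (x * (t (op a) ⊗ₜ[k] s b))
  counit_bimod : ∀ a b h, counit (h * t (op a) * s b) = a * counit h * b
  coassoc : ∀ h x y, balMk _ _ x = Δ h → balMk _ _ y = Δ h →
    balAssocL _ _ (mulR k s) (mulR k fun b => t (op b)) (LinearMap.rTensor H Δ x) =
      balAssocR (mulR k s) (mulR k fun b => t (op b)) _ _ (LinearMap.lTensor H Δ y)
  /-- `h₂ t(∂(h₁)) = h` -/
  counit_left : ∀ h x, balMk _ _ x = Δ h →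
    LinearMap.mul' k H (TensorProduct.map LinearMap.id
      (t.toLinearMap ∘ₗ (opLinearEquiv k).toLinearMap ∘ₗ counit)
      (TensorProduct.comm k H H x)) = h
  /-- `h₁ s(∂(h₂)) = h` -/
  counit_right : ∀ h x, balMk _ _ x = Δ h →
    LinearMap.mul' k H (TensorProduct.map LinearMap.id (s.toLinearMap ∘ₗ counit) x) = h
  /-- `Δ` takes values in the Takeuchi-Sweedler product. -/
  takeuchi : ∀ a h x, balMk _ _ x = Δ h →
    balMk (mulR k s) (mulR k fun b => t (op b)) ((s a ⊗ₜ[k] 1) * x) =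
      balMk _ _ ((1 ⊗ₜ[k] t (op a)) * x)
  comul_one : Δ 1 = balMk _ _ (1 ⊗ₜ[k] 1)
  comul_mul : ∀ g h x y, balMk _ _ x = Δ g → balMk _ _ y = Δ h →
    Δ (g * h) = balMk _ _ (x * y)
  counit_one : counit 1 = 1
  counit_mul_s : ∀ g h, counit (g * h) = counit (s (counit g) * h)
  counit_mul_t : ∀ g h, counit (g * h) = counit (t (op (counit g)) * h)

/-- Morphisms `(F, f)` of left bialgebroids. -/
structure LeftBialgebroid.IsHom {k A U A' U' : Type*} [CommRing k] [Ring A] [Algebra k A]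
    [Ring U] [Algebra k U] [Ring A'] [Algebra k A'] [Ring U'] [Algebra k U']
    (𝓤 : LeftBialgebroid k A U) (𝓥 : LeftBialgebroid k A' U')
    (F : U →ₗ[k] U') (f : A →ₐ[k] A') : Prop where
  map_one : F 1 = 1
  map_mul : ∀ u v, F (u * v) = F u * F v
  map_s : ∀ a, F (𝓤.s a) = 𝓥.s (f a)
  map_t : ∀ a, F (𝓤.t (op a)) = 𝓥.t (op (f a))
  map_counit : ∀ u, 𝓥.ε (F u) = f (𝓤.ε u)
  map_comul : ∀ u x, balMk _ _ x = 𝓤.Δ u →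
    𝓥.Δ (F u) = balMk _ _ (TensorProduct.map F F x)

/-- Morphisms `(F, f)` of right bialgebroids. -/
structure RightBialgebroid.IsHom {k B H B' H' : Type*} [CommRing k] [Ring B] [Algebra k B]
    [Ring H] [Algebra k H] [Ring B'] [Algebra k B'] [Ring H'] [Algebra k H']
    (𝓗 : RightBialgebroid k B H) (𝓚 : RightBialgebroid k B' H')
    (F : H →ₗ[k] H') (f : B →ₐ[k] B') : Prop where
  map_one : F 1 = 1
  map_mul : ∀ u v, F (u * v) = F u * F v
  map_s : ∀ a, F (𝓗.s a) = 𝓚.s (f a)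
  map_t : ∀ a, F (𝓗.t (op a)) = 𝓚.t (op (f a))
  map_counit : ∀ h, 𝓚.counit (F h) = f (𝓗.counit h)
  map_comul : ∀ h x, balMk _ _ x = 𝓗.Δ h →
    𝓚.Δ (F h) = balMk _ _ (TensorProduct.map F F x)

section OpCoop

variable {k B H : Type*} [CommRing k] [Ring B] [Algebra k B] [Ring H] [Algebra k H]

/-- `g ⊗ h ↦ h ⊗ g`, as a map `H ⊗ H → Hᵐᵒᵖ ⊗ Hᵐᵒᵖ`. -/
def opSwap (k H : Type*) [CommRing k] [Ring H] [Algebra k H] :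
    (H ⊗[k] H) ≃ₗ[k] (Hᵐᵒᵖ ⊗[k] Hᵐᵒᵖ) :=
  (TensorProduct.comm k H H).trans
    (TensorProduct.congr (opLinearEquiv k) (opLinearEquiv k))

@[simp] lemma opSwap_tmul (g h : H) : opSwap k H (g ⊗ₜ[k] h) = op h ⊗ₜ[k] op g := rfl

lemma opSwap_mul (x y : H ⊗[k] H) : opSwap k H (x * y) = opSwap k H y * opSwap k H x := by
  induction x using TensorProduct.induction_on with
  | zero => simp
  | add x x' hx hx' => simp only [add_mul, mul_add, map_add, hx, hx']
  | tmul a b =>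
    induction y using TensorProduct.induction_on with
    | zero => simp
    | add x x' hx hx' => simp only [add_mul, mul_add, map_add, hx, hx']
    | tmul c d => simp

/-- `g ⊗ h ⊗ l ↦ l ⊗ h ⊗ g`. -/
def opSwap₃ (k H : Type*) [CommRing k] [Ring H] [Algebra k H] :
    (H ⊗[k] (H ⊗[k] H)) →ₗ[k] (Hᵐᵒᵖ ⊗[k] (Hᵐᵒᵖ ⊗[k] Hᵐᵒᵖ)) :=
  (TensorProduct.assoc k Hᵐᵒᵖ Hᵐᵒᵖ Hᵐᵒᵖ).toLinearMap ∘ₗ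
    (TensorProduct.comm k Hᵐᵒᵖ (Hᵐᵒᵖ ⊗[k] Hᵐᵒᵖ)).toLinearMap ∘ₗ
    TensorProduct.map (opLinearEquiv k).toLinearMap (opSwap k H).toLinearMap

@[simp] lemma opSwap₃_tmul (g h l : H) :
    opSwap₃ k H (g ⊗ₜ[k] (h ⊗ₜ[k] l)) = op l ⊗ₜ[k] (op h ⊗ₜ[k] op g) := rfl

namespace RightBialgebroid

variable (𝓗 : RightBialgebroid k B H)

/-- The source map of the opposite coopposite. -/
abbrev opS : Bᵐᵒᵖ →ₐ[k] Hᵐᵒᵖ := AlgHom.op 𝓗.s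

/-- The target map of the opposite coopposite. -/
abbrev opT : Bᵐᵒᵖᵐᵒᵖ →ₐ[k] Hᵐᵒᵖ := AlgHom.op 𝓗.t

lemma opSwap_rel (x : H ⊗[k] H)
    (hx : x ∈ balRel (mulR k 𝓗.s) (mulR k fun b => 𝓗.t (op b))) :
    opSwap k H x ∈ balRel (mulL k fun b => 𝓗.opT (op b)) (mulL k 𝓗.opS) := by
  induction hx using Submodule.span_induction with
  | zero => simp
  | add x y _ _ hx hy => rw [map_add]; exact add_mem hx hy
  | smul c x _ hx => rw [map_smul]; exact Submodule.smul_mem _ _ hx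
  | mem x hx =>
    obtain ⟨b, m, n, rfl⟩ := hx
    rw [map_sub, ← neg_mem_iff, neg_sub]
    exact Submodule.subset_span ⟨op b, op n, op m, rfl⟩

lemma opSwap_symm_rel (x : Hᵐᵒᵖ ⊗[k] Hᵐᵒᵖ)
    (hx : x ∈ balRel (mulL k fun b => 𝓗.opT (op b)) (mulL k 𝓗.opS)) :
    (opSwap k H).symm x ∈ balRel (mulR k 𝓗.s) (mulR k fun b => 𝓗.t (op b)) := by
  induction hx using Submodule.span_induction with
  | zero => simp
  | add x y _ _ hx hy => rw [map_add]; exact add_mem hx hy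
  | smul c x _ hx => rw [map_smul]; exact Submodule.smul_mem _ _ hx
  | mem x hx =>
    obtain ⟨b, m, n, rfl⟩ := hx
    rw [map_sub, ← neg_mem_iff, neg_sub]
    exact Submodule.subset_span ⟨unop b, unop n, unop m, rfl⟩

/-- The flip `H_◀ ⊗_B ▶H → Hᵐᵒᵖ ⊗_{Bᵐᵒᵖ} Hᵐᵒᵖ`. -/
def opFlip : BalTensor (mulR k 𝓗.s) (mulR k fun b => 𝓗.t (op b)) →ₗ[k]
    BalTensor (mulL k fun b => 𝓗.opT (op b)) (mulL k 𝓗.opS) :=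
  Submodule.mapQ _ _ (opSwap k H).toLinearMap 𝓗.opSwap_rel

/-- `Δ^coop`, on `Hᵐᵒᵖ`. -/
def opΔ : Hᵐᵒᵖ →ₗ[k] BalTensor (mulL k fun b => 𝓗.opT (op b)) (mulL k 𝓗.opS) :=
  𝓗.opFlip ∘ₗ 𝓗.Δ ∘ₗ (opLinearEquiv k).symm.toLinearMap

lemma opFlip_mk (x : H ⊗[k] H) : 𝓗.opFlip (balMk _ _ x) = balMk _ _ (opSwap k H x) := rfl

lemma opΔ_rep {u : Hᵐᵒᵖ} {x : Hᵐᵒᵖ ⊗[k] Hᵐᵒᵖ} (h : balMk _ _ x = 𝓗.opΔ u) :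
    ∃ y, x = opSwap k H y ∧ balMk _ _ y = 𝓗.Δ (unop u) := by
  obtain ⟨z, hz⟩ := Submodule.mkQ_surjective _ (𝓗.Δ (unop u))
  refine ⟨(opSwap k H).symm x, by simp, ?_⟩
  rw [← hz]
  have h2 : balMk (mulL k fun b => 𝓗.opT (op b)) (mulL k 𝓗.opS) x =
      balMk _ _ (opSwap k H z) := by
    rw [h, ← opFlip_mk, balMk, hz]; rfl
  refine (Submodule.Quotient.eq _).2 ?_
  have := 𝓗.opSwap_symm_rel _ ((Submodule.Quotient.eq _).1 h2)
  simpa using this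

lemma opΔ_of_rep {u : Hᵐᵒᵖ} {y : H ⊗[k] H} (h : balMk _ _ y = 𝓗.Δ (unop u)) :
    𝓗.opΔ u = balMk _ _ (opSwap k H y) := by
  rw [← opFlip_mk, h]; rfl

lemma opSwap_mk_eq {x y : H ⊗[k] H}
    (h : balMk (mulR k 𝓗.s) (mulR k fun b => 𝓗.t (op b)) x = balMk _ _ y) :
    balMk (mulL k fun b => 𝓗.opT (op b)) (mulL k 𝓗.opS) (opSwap k H x) =
      balMk _ _ (opSwap k H y) := by
  rw [← opFlip_mk, h, opFlip_mk]

/-- The flip on triple tensor products. -/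
def opFlip₃ : BalTensor₃ (mulR k 𝓗.s) (mulR k fun b => 𝓗.t (op b))
      (mulR k 𝓗.s) (mulR k fun b => 𝓗.t (op b)) →ₗ[k]
    BalTensor₃ (mulL k fun b => 𝓗.opT (op b)) (mulL k 𝓗.opS)
      (mulL k fun b => 𝓗.opT (op b)) (mulL k 𝓗.opS) :=
  Submodule.mapQ _ _ (opSwap₃ k H) (by
    rw [balRel₃, Submodule.span_le]
    rintro _ (⟨b, m, n, p, rfl⟩ | ⟨b, m, n, p, rfl⟩)
    · rw [SetLike.mem_coe, Submodule.mem_comap, map_sub, ← neg_mem_iff, neg_sub]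
      exact Submodule.subset_span (Or.inr ⟨op b, op p, op n, op m, rfl⟩)
    · rw [SetLike.mem_coe, Submodule.mem_comap, map_sub, ← neg_mem_iff, neg_sub]
      exact Submodule.subset_span (Or.inl ⟨op b, op p, op n, op m, rfl⟩))

lemma opAssocL (y : H ⊗[k] H) :
    balAssocL _ _ (mulL k fun b => 𝓗.opT (op b)) (mulL k 𝓗.opS)
      (LinearMap.rTensor Hᵐᵒᵖ 𝓗.opΔ (opSwap k H y)) =
    𝓗.opFlip₃ (balAssocR (mulR k 𝓗.s) (mulR k fun b => 𝓗.t (op b)) _ _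
      (LinearMap.lTensor H 𝓗.Δ y)) := by
  induction y using TensorProduct.induction_on with
  | zero => simp
  | add x x' hx hx' => simp only [map_add, hx, hx']
  | tmul m n =>
    obtain ⟨z, hz⟩ := Submodule.mkQ_surjective _ (𝓗.Δ n)
    rw [opSwap_tmul, LinearMap.rTensor_tmul, LinearMap.lTensor_tmul, ← hz,
      𝓗.opΔ_of_rep (u := op n) hz]
    clear hz
    induction z using TensorProduct.induction_on with
    | zero => simp
    | add x x' hx hx' =>
      simp only [map_add, TensorProduct.add_tmul, TensorProduct.tmul_add, hx, hx']
    | tmul p q => rfl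

lemma opAssocR (y : H ⊗[k] H) :
    balAssocR (mulL k fun b => 𝓗.opT (op b)) (mulL k 𝓗.opS) _ _
      (LinearMap.lTensor Hᵐᵒᵖ 𝓗.opΔ (opSwap k H y)) =
    𝓗.opFlip₃ (balAssocL _ _ (mulR k 𝓗.s) (mulR k fun b => 𝓗.t (op b))
      (LinearMap.rTensor H 𝓗.Δ y)) := by
  induction y using TensorProduct.induction_on with
  | zero => simp
  | add x x' hx hx' => simp only [map_add, hx, hx']
  | tmul m n =>
    obtain ⟨z, hz⟩ := Submodule.mkQ_surjective _ (𝓗.Δ m)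
    rw [opSwap_tmul, LinearMap.rTensor_tmul, LinearMap.lTensor_tmul, ← hz,
      𝓗.opΔ_of_rep (u := op m) hz]
    clear hz
    induction z using TensorProduct.induction_on with
    | zero => simp
    | add x x' hx hx' =>
      simp only [map_add, TensorProduct.add_tmul, TensorProduct.tmul_add, hx, hx']
    | tmul p q => rfl

/-- The left bialgebroid `H^op_coop` over `B^op`, with structure maps `s, t, Δ^coop, ∂`. -/
def opCoop : LeftBialgebroid k Bᵐᵒᵖ Hᵐᵒᵖ where
  s := 𝓗.opS
  t := 𝓗.opT
  Δ := 𝓗.opΔ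
  ε := (opLinearEquiv k).toLinearMap ∘ₗ 𝓗.counit ∘ₗ (opLinearEquiv k).symm.toLinearMap
  s_mul_t a b := unop_injective (𝓗.s_mul_t (unop a) (unop b)).symm
  comul_bimod a b u x hx := by
    obtain ⟨y, rfl, hy⟩ := 𝓗.opΔ_rep hx
    have h : unop (𝓗.opS a * 𝓗.opT (op b) * u) =
        unop u * 𝓗.t (op (unop b)) * 𝓗.s (unop a) := by
      change unop u * (𝓗.t b * 𝓗.s (unop a)) = _
      rw [mul_assoc]; rfl
    rw [𝓗.opΔ_of_rep (u := 𝓗.opS a * 𝓗.opT (op b) * u)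
      (y := y * (𝓗.t (op (unop b)) ⊗ₜ[k] 𝓗.s (unop a)))
      (by rw [h, 𝓗.comul_bimod _ _ _ _ hy]), opSwap_mul]
    rfl
  counit_bimod a b u := by
    have h : unop (𝓗.opS a * 𝓗.opT (op b) * u) =
        unop u * 𝓗.t (op (unop b)) * 𝓗.s (unop a) := by
      change unop u * (𝓗.t b * 𝓗.s (unop a)) = _
      rw [mul_assoc]; rfl
    apply unop_injective
    change 𝓗.counit (unop (𝓗.opS a * 𝓗.opT (op b) * u)) =
      unop b * (𝓗.counit (unop u) * unop a)
    rw [h, 𝓗.counit_bimod, mul_assoc]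
  coassoc u x y hx hy := by
    obtain ⟨x, rfl, hx'⟩ := 𝓗.opΔ_rep hx
    obtain ⟨y, rfl, hy'⟩ := 𝓗.opΔ_rep hy
    rw [opAssocL, opAssocR, 𝓗.coassoc _ _ _ hy' hx']
  counit_left u x hx := by
    obtain ⟨y, rfl, hy⟩ := 𝓗.opΔ_rep hx
    apply unop_injective
    rw [← 𝓗.counit_right _ _ hy]
    clear hy hx
    induction y using TensorProduct.induction_on with
    | zero => simp
    | add x x' hx hx' => simp only [map_add, unop_add, hx, hx']
    | tmul p q => rfl
  counit_right u x hx := by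
    obtain ⟨y, rfl, hy⟩ := 𝓗.opΔ_rep hx
    apply unop_injective
    rw [← 𝓗.counit_left _ _ hy]
    clear hy hx
    induction y using TensorProduct.induction_on with
    | zero => simp
    | add x x' hx hx' => simp only [map_add, unop_add, hx, hx']
    | tmul p q => rfl
  takeuchi a u x hx := by
    obtain ⟨y, rfl, hy⟩ := 𝓗.opΔ_rep hx
    have h := 𝓗.opSwap_mk_eq (𝓗.takeuchi (unop a) _ _ hy)
    rw [opSwap_mul, opSwap_mul] at h
    exact h.symm
  comul_one := 𝓗.opΔ_of_rep (u := 1) 𝓗.comul_one.symm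
  comul_mul u v x y hx hy := by
    obtain ⟨x, rfl, hx'⟩ := 𝓗.opΔ_rep hx
    obtain ⟨y, rfl, hy'⟩ := 𝓗.opΔ_rep hy
    rw [← opSwap_mul]
    exact 𝓗.opΔ_of_rep (u := u * v) (𝓗.comul_mul _ _ _ _ hy' hx').symm
  counit_one := congrArg op 𝓗.counit_one
  counit_mul_s u v := congrArg op (𝓗.counit_mul_s (unop v) (unop u))
  counit_mul_t u v := congrArg op (𝓗.counit_mul_t (unop v) (unop u))

end RightBialgebroid

end OpCoop

namespace LeftBialgebroid

variable {k A U : Type*} [CommRing k] [Ring A] [Algebra k A] [Ring U] [Algebra k U]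
  (𝓤 : LeftBialgebroid k A U)

/-- `U_◁ ⊗_A ▷U`. -/
abbrev Sq : Type _ := BalTensor (mulL k fun a => 𝓤.t (op a)) (mulL k 𝓤.s)

lemma exists_rep (u : U) : ∃ x, balMk _ _ x = 𝓤.Δ u := Submodule.mkQ_surjective _ _

lemma comul_s_mul (a : A) {u : U} {x : U ⊗[k] U} (hx : balMk _ _ x = 𝓤.Δ u) :
    𝓤.Δ (𝓤.s a * u) = balMk _ _ ((𝓤.s a ⊗ₜ[k] 1) * x) := by
  simpa using 𝓤.comul_bimod a 1 u x hx

lemma comul_t_mul (a : A) {u : U} {x : U ⊗[k] U} (hx : balMk _ _ x = 𝓤.Δ u) :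
    𝓤.Δ (𝓤.t (op a) * u) = balMk _ _ ((1 ⊗ₜ[k] 𝓤.t (op a)) * x) := by
  simpa using 𝓤.comul_bimod 1 a u x hx

lemma comul_mul_t (a : A) {u : U} {x : U ⊗[k] U} (hx : balMk _ _ x = 𝓤.Δ u) :
    𝓤.Δ (u * 𝓤.t (op a)) = balMk _ _ (x * (1 ⊗ₜ[k] 𝓤.t (op a))) := by
  refine 𝓤.comul_mul _ _ _ _ hx ?_
  have := 𝓤.comul_t_mul a 𝓤.comul_one.symm
  simpa using this.symm

lemma comul_mul_s (a : A) {u : U} {x : U ⊗[k] U} (hx : balMk _ _ x = 𝓤.Δ u) :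
    𝓤.Δ (u * 𝓤.s a) = balMk _ _ (x * (𝓤.s a ⊗ₜ[k] 1)) := by
  refine 𝓤.comul_mul _ _ _ _ hx ?_
  have := 𝓤.comul_s_mul a 𝓤.comul_one.symm
  simpa using this.symm

lemma counit_s_mul (a : A) (u : U) : 𝓤.ε (𝓤.s a * u) = a * 𝓤.ε u := by
  simpa using 𝓤.counit_bimod a 1 u

lemma counit_t_mul (a : A) (u : U) : 𝓤.ε (𝓤.t (op a) * u) = 𝓤.ε u * a := by
  simpa using 𝓤.counit_bimod 1 a u

lemma counit_s (a : A) : 𝓤.ε (𝓤.s a) = a := by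
  simpa [𝓤.counit_one] using 𝓤.counit_s_mul a 1

lemma counit_t (a : A) : 𝓤.ε (𝓤.t (op a)) = a := by
  simpa [𝓤.counit_one] using 𝓤.counit_t_mul a 1

lemma counit_mul_t_eq (u : U) (a : A) : 𝓤.ε (u * 𝓤.t (op a)) = 𝓤.ε (u * 𝓤.s a) := by
  rw [𝓤.counit_mul_s u (𝓤.t (op a)), counit_t]

section RightDual

/-- The right dual `U^* = Hom_{A^op}(U_◁, A)`. -/
def rDualSub : Submodule k (U →ₗ[k] A) where
  carrier := {φ | ∀ a u, φ (𝓤.t (op a) * u) = φ u * a}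
  add_mem' h h' a u := by simp [h a u, h' a u, add_mul]
  zero_mem' a u := by simp
  smul_mem' c φ h a u := by simp [h a u]

/-- The right dual `U^* = Hom_{A^op}(U_◁, A)`, as a type. -/
def RDual : Type _ := 𝓤.rDualSub

instance : AddCommGroup 𝓤.RDual := inferInstanceAs (AddCommGroup 𝓤.rDualSub)
instance : Module k 𝓤.RDual := inferInstanceAs (Module k 𝓤.rDualSub)

variable {𝓤} in
/-- The underlying linear map of an element of `U^*`. -/
def RDual.val (φ : 𝓤.RDual) : U →ₗ[k] A := Subtype.val φ

variable {𝓤} in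
@[ext] lemma RDual.ext {φ ψ : 𝓤.RDual} (h : ∀ u, φ.val u = ψ.val u) : φ = ψ :=
  Subtype.ext (LinearMap.ext h)

variable {𝓤} in
lemma RDual.val_t (φ : 𝓤.RDual) (a : A) (u : U) : φ.val (𝓤.t (op a) * u) = φ.val u * a :=
  φ.2 a u

variable {𝓤} in
@[simp] lemma RDual.val_add (φ ψ : 𝓤.RDual) : (φ + ψ).val = φ.val + ψ.val := rfl

variable {𝓤} in
@[simp] lemma RDual.val_smul (c : k) (φ : 𝓤.RDual) : (c • φ).val = c • φ.val := rfl

variable {𝓤} in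
@[simp] lemma RDual.val_zero : (0 : 𝓤.RDual).val = 0 := rfl

/-- The map `U_◁ ⊗_A ▷U → U`, `u ⊗ v ↦ s(φ(u)) v`. -/
def rContr (φ : 𝓤.RDual) : 𝓤.Sq →ₗ[k] U :=
  balLift _ _ (LinearMap.mk₂ k (fun u v => 𝓤.s (φ.val u) * v)
    (by intros; simp [add_mul]) (by intros; simp)
    (by intros; simp [mul_add]) (by intros; simp))
    (by intro a u v; simp [φ.val_t, mul_assoc])

lemma rContr_tmul (φ : 𝓤.RDual) (u v : U) :
    𝓤.rContr φ (balMk _ _ (u ⊗ₜ[k] v)) = 𝓤.s (φ.val u) * v := rfl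

/-- The map `U_◁ ⊗_A ▷U → A`, `u ⊗ v ↦ φ'(s(φ(u)) v)`. -/
def rConv (φ : 𝓤.RDual) (φ' : U →ₗ[k] A) : 𝓤.Sq →ₗ[k] A := φ' ∘ₗ 𝓤.rContr φ

lemma rConv_tmul (φ : 𝓤.RDual) (φ' : U →ₗ[k] A) (u v : U) :
    𝓤.rConv φ φ' (balMk _ _ (u ⊗ₜ[k] v)) = φ' (𝓤.s (φ.val u) * v) := rfl

/-- The product of `U^*`: `(φ φ')(u) = φ'(s(φ(u₁)) u₂)`. -/
instance : Mul 𝓤.RDual where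
  mul φ φ' := ⟨𝓤.rConv φ φ'.val ∘ₗ 𝓤.Δ, fun a u => by
    obtain ⟨x, hx⟩ := 𝓤.exists_rep u
    rw [LinearMap.comp_apply, LinearMap.comp_apply, 𝓤.comul_t_mul a hx, ← hx]
    clear hx
    induction x using TensorProduct.induction_on with
    | zero => simp
    | add x x' hx hx' => simp only [map_add, mul_add, add_mul, hx, hx']
    | tmul p q =>
      rw [Algebra.TensorProduct.tmul_mul_tmul, rConv_tmul, rConv_tmul, ← mul_assoc, one_mul,
        𝓤.s_mul_t, mul_assoc, φ'.val_t]⟩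

lemma rMul_val (φ φ' : 𝓤.RDual) (u : U) : (φ * φ').val u = 𝓤.rConv φ φ'.val (𝓤.Δ u) := rfl

/-- The unit of `U^*` is the counit of `U`. -/
instance : One 𝓤.RDual where
  one := ⟨𝓤.ε, fun a u => 𝓤.counit_t_mul a u⟩

@[simp] lemma rOne_val : (1 : 𝓤.RDual).val = 𝓤.ε := rfl

/-- The map `u ⊗ v ⊗ w ↦ χ(s(ψ(s(φ(u)) v)) w)`. -/
def rConv₃ (φ ψ : 𝓤.RDual) (χ : U →ₗ[k] A) :
    BalTensor₃ (mulL k fun a => 𝓤.t (op a)) (mulL k 𝓤.s)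
      (mulL k fun a => 𝓤.t (op a)) (mulL k 𝓤.s) →ₗ[k] A :=
  (balRel₃ _ _ _ _).liftQ (TensorProduct.lift (LinearMap.mk₂ k
    (fun u (y : U ⊗[k] U) => 𝓤.rConv ψ χ (balMk _ _ ((𝓤.s (φ.val u) ⊗ₜ[k] 1) * y)))
    (by intros; simp [add_mul, TensorProduct.add_tmul])
    (by intros; simp [← TensorProduct.smul_tmul'])
    (by intros; simp [mul_add]) (by intros; simp))) (by
    rw [balRel₃, Submodule.span_le]
    rintro _ (⟨b, m, n, p, rfl⟩ | ⟨b, m, n, p, rfl⟩)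
    · simp [φ.val_t, mul_assoc]
    · rw [SetLike.mem_coe, LinearMap.mem_ker, map_sub, sub_eq_zero]
      change 𝓤.rConv ψ χ (balMk _ _ ((𝓤.s (φ.val m) ⊗ₜ[k] 1) * ((𝓤.t (op b) * n) ⊗ₜ[k] p))) =
        𝓤.rConv ψ χ (balMk _ _ ((𝓤.s (φ.val m) ⊗ₜ[k] 1) * (n ⊗ₜ[k] (𝓤.s b * p))))
      rw [Algebra.TensorProduct.tmul_mul_tmul, Algebra.TensorProduct.tmul_mul_tmul, rConv_tmul,
        rConv_tmul, one_mul, one_mul, ← mul_assoc (𝓤.s _) (𝓤.t _), 𝓤.s_mul_t, mul_assoc, ψ.val_t,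
        map_mul 𝓤.s, mul_assoc (𝓤.s _) (𝓤.s _)])

lemma rConv₃_mk (φ ψ : 𝓤.RDual) (χ : U →ₗ[k] A) (u v w : U) :
    𝓤.rConv₃ φ ψ χ ((balRel₃ _ _ _ _).mkQ (u ⊗ₜ[k] (v ⊗ₜ[k] w))) =
      χ (𝓤.s (ψ.val (𝓤.s (φ.val u) * v)) * w) := by
  change 𝓤.rConv ψ χ (balMk _ _ ((𝓤.s (φ.val u) ⊗ₜ[k] 1) * (v ⊗ₜ[k] w))) = _
  rw [Algebra.TensorProduct.tmul_mul_tmul, rConv_tmul, one_mul]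

lemma rMul_assoc (φ ψ χ : 𝓤.RDual) : φ * ψ * χ = φ * (ψ * χ) := by
  ext u
  obtain ⟨x, hx⟩ := 𝓤.exists_rep u
  have h := congrArg (𝓤.rConv₃ φ ψ χ.val) (𝓤.coassoc u x x hx hx)
  rw [rMul_val, rMul_val, ← hx]
  convert h using 1
  · clear h hx
    induction x using TensorProduct.induction_on with
    | zero => simp
    | add x x' hx hx' => simp only [map_add, hx, hx']
    | tmul p q =>
      obtain ⟨y, hy⟩ := 𝓤.exists_rep p
      rw [rConv_tmul, rMul_val, LinearMap.rTensor_tmul, ← hy]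
      clear hy
      induction y using TensorProduct.induction_on with
      | zero => simp
      | add x x' hx hx' => simp only [map_add, TensorProduct.add_tmul, add_mul, hx, hx']
      | tmul m n => exact (𝓤.rConv₃_mk φ ψ χ.val m n q).symm
  · clear h hx
    induction x using TensorProduct.induction_on with
    | zero => simp
    | add x x' hx hx' => simp only [map_add, hx, hx']
    | tmul p q =>
      obtain ⟨y, hy⟩ := 𝓤.exists_rep q
      rw [rConv_tmul, rMul_val, LinearMap.lTensor_tmul, 𝓤.comul_s_mul _ hy, ← hy]
      rfl

instance : Ring 𝓤.RDual :=
  { (inferInstance : AddCommGroup 𝓤.RDual), (inferInstance : Mul 𝓤.RDual),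
    (inferInstance : One 𝓤.RDual) with
    mul_assoc := 𝓤.rMul_assoc
    one_mul := fun φ => by
      ext u
      obtain ⟨x, hx⟩ := 𝓤.exists_rep u
      conv_rhs => rw [← 𝓤.counit_left u x hx]
      rw [rMul_val, ← hx]
      clear hx
      induction x using TensorProduct.induction_on with
      | zero => simp
      | add x x' hx hx' => simp only [map_add, hx, hx']
      | tmul p q => rfl
    mul_one := fun φ => by
      ext u
      obtain ⟨x, hx⟩ := 𝓤.exists_rep u
      conv_rhs => rw [← 𝓤.counit_right u x hx]
      rw [rMul_val, ← hx]
      clear hx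
      induction x using TensorProduct.induction_on with
      | zero => simp
      | add x x' hx hx' => simp only [map_add, hx, hx']
      | tmul p q =>
        rw [rConv_tmul, rOne_val, 𝓤.counit_s_mul]
        exact (φ.val_t _ _).symm
    left_distrib := fun φ ψ χ => by
      ext u
      obtain ⟨x, hx⟩ := 𝓤.exists_rep u
      rw [RDual.val_add, LinearMap.add_apply, rMul_val, rMul_val, rMul_val, ← hx]
      clear hx
      induction x using TensorProduct.induction_on with
      | zero => simp
      | add x x' hx hx' => simp only [map_add, hx, hx']; abel
      | tmul p q => simp only [rConv_tmul, RDual.val_add, LinearMap.add_apply]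
    right_distrib := fun φ ψ χ => by
      ext u
      obtain ⟨x, hx⟩ := 𝓤.exists_rep u
      rw [RDual.val_add, LinearMap.add_apply, rMul_val, rMul_val, rMul_val, ← hx]
      clear hx
      induction x using TensorProduct.induction_on with
      | zero => simp
      | add x x' hx hx' => simp only [map_add, hx, hx']; abel
      | tmul p q =>
        simp only [rConv_tmul, RDual.val_add, LinearMap.add_apply, map_add, add_mul]
    zero_mul := fun φ => by
      ext u
      obtain ⟨x, hx⟩ := 𝓤.exists_rep u
      rw [rMul_val, ← hx]
      clear hx
      induction x using TensorProduct.induction_on with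
      | zero => simp
      | add x x' hx hx' => simp only [map_add, hx, hx']; simp
      | tmul p q => simp [rConv_tmul, -Submodule.mkQ_apply]
    mul_zero := fun φ => by
      ext u
      obtain ⟨x, hx⟩ := 𝓤.exists_rep u
      rw [rMul_val, ← hx]
      clear hx
      induction x using TensorProduct.induction_on with
      | zero => simp
      | add x x' hx hx' => simp only [map_add, hx, hx']; simp
      | tmul p q => simp [rConv] }

instance : Algebra k 𝓤.RDual := Algebra.ofModule
  (fun c φ ψ => by
    ext u
    obtain ⟨x, hx⟩ := 𝓤.exists_rep u
    rw [RDual.val_smul, LinearMap.smul_apply, rMul_val, rMul_val, ← hx]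
    clear hx
    induction x using TensorProduct.induction_on with
    | zero => simp
    | add x x' hx hx' => simp only [map_add, hx, hx', smul_add]
    | tmul p q => simp only [rConv_tmul, RDual.val_smul, LinearMap.smul_apply, map_smul,
        smul_mul_assoc])
  (fun c φ ψ => by
    ext u
    obtain ⟨x, hx⟩ := 𝓤.exists_rep u
    rw [RDual.val_smul, LinearMap.smul_apply, rMul_val, rMul_val, ← hx]
    clear hx
    induction x using TensorProduct.induction_on with
    | zero => simp
    | add x x' hx hx' => simp only [map_add, hx, hx', smul_add]
    | tmul p q => simp only [rConv_tmul, RDual.val_smul, LinearMap.smul_apply])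

end RightDual

end LeftBialgebroid

/-- `U` is finitely generated projective as a left `R`-module via `r · u = f(r) u`. -/
def IsFGProjective {R U : Type*} [Ring R] [Ring U] (f : R →+* U) : Prop :=
  letI : Module R U := Module.compHom U f
  Module.Finite R U ∧ Module.Projective R U

lemma IsFGProjective.exists_dualBasis {k R U : Type*} [CommRing k] [Ring R] [Ring U]
    [Algebra k R] [Algebra k U] (f : R →ₐ[k] U) (h : IsFGProjective (f : R →+* U)) :
    ∃ (n : ℕ) (e : Fin n → U) (e' : Fin n → U →ₗ[k] R),
      (∀ i r u, e' i (f r * u) = r * e' i u) ∧ ∀ u, ∑ i, f (e' i u) * e i = u := by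
  let _ : Module R U := Module.compHom U (f : R →+* U)
  obtain ⟨h1, h2⟩ : Module.Finite R U ∧ Module.Projective R U := h
  obtain ⟨n, p, hp⟩ := Module.Finite.exists_fin' R U
  obtain ⟨g, hg⟩ := Module.projective_lifting_property p LinearMap.id hp
  have hsm : ∀ (r : R) (u : U), r • u = f r * u := fun _ _ => rfl
  refine ⟨n, fun i => p (Pi.single i 1), fun i =>
    { toFun := fun u => g u i, map_add' := by simp, map_smul' := fun c u => ?_ }, ?_, ?_⟩
  · have h3 : c • u = (algebraMap k R c) • u := by
      rw [hsm, AlgHom.commutes, Algebra.smul_def]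
    simp only [h3, map_smul, Pi.smul_apply, smul_eq_mul, RingHom.id_apply, Algebra.smul_def]
  · intro i r u
    change g (r • u) i = r * g u i
    simp
  · intro u
    have := LinearMap.congr_fun hg u
    conv_rhs => rw [← LinearMap.id_apply (R := R) u, ← this, LinearMap.comp_apply,
      ← Finset.univ_sum_single (g u), map_sum]
    refine Finset.sum_congr rfl fun i _ => ?_
    change g u i • p (Pi.single i 1) = _
    rw [← map_smul, ← Pi.single_smul, smul_eq_mul, mul_one]

namespace LeftBialgebroid

variable {k A U : Type*} [CommRing k] [Ring A] [Algebra k A] [Ring U] [Algebra k U]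
  (𝓤 : LeftBialgebroid k A U)

/-- `▷U` is finitely generated projective over `A`. -/
def LeftFGProjective : Prop := IsFGProjective (𝓤.s : A →+* U)

/-- `U_◁` is finitely generated projective as a right `A`-module. -/
def RightFGProjective : Prop := IsFGProjective (𝓤.t : Aᵐᵒᵖ →+* U)

section RightDual

lemma rMul_val_rep (φ φ' : 𝓤.RDual) {u : U} {x : U ⊗[k] U} (hx : balMk _ _ x = 𝓤.Δ u) :
    (φ * φ').val u = 𝓤.rConv φ φ'.val (balMk _ _ x) := by
  rw [rMul_val, hx]

/-- The source of `U^*`: `s(a)(u) = ε(u s(a))`. -/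
def rS : A →ₐ[k] 𝓤.RDual :=
  AlgHom.ofLinearMap
    { toFun := fun a => ⟨𝓤.ε ∘ₗ LinearMap.mulRight k (𝓤.s a), fun b u => by
        simp [mul_assoc, counit_t_mul]⟩
      map_add' := fun a b => RDual.ext fun u => by
        change 𝓤.ε (u * 𝓤.s (a + b)) = 𝓤.ε (u * 𝓤.s a) + 𝓤.ε (u * 𝓤.s b)
        rw [map_add, mul_add, map_add]
      map_smul' := fun c a => RDual.ext fun u => by
        change 𝓤.ε (u * 𝓤.s (c • a)) = c • 𝓤.ε (u * 𝓤.s a)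
        rw [map_smul, mul_smul_comm, map_smul] }
    (RDual.ext fun u => by
      change 𝓤.ε (u * 𝓤.s 1) = 𝓤.ε u
      rw [map_one, mul_one])
    (fun a b => by
      ext u
      obtain ⟨x, hx⟩ := 𝓤.exists_rep u
      have h := 𝓤.comul_mul_s a hx
      change 𝓤.ε (u * 𝓤.s (a * b)) = _
      rw [map_mul 𝓤.s, ← mul_assoc, ← 𝓤.counit_mul_t_eq, rMul_val_rep _ _ _ hx]
      conv_lhs => rw [← 𝓤.counit_left _ _ h.symm]
      clear h hx
      induction x using TensorProduct.induction_on with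
      | zero => simp
      | add x x' hx hx' => simp only [map_add, add_mul, hx, hx']
      | tmul p q =>
        rw [rConv_tmul]
        rw [Algebra.TensorProduct.tmul_mul_tmul]
        change 𝓤.ε (𝓤.s (𝓤.ε (p * 𝓤.s a)) * (q * 1) * 𝓤.t (op b)) =
          𝓤.ε (𝓤.s (𝓤.ε (p * 𝓤.s a)) * q * 𝓤.s b)
        rw [𝓤.counit_mul_t_eq, mul_one])

lemma rS_val (a : A) (u : U) : (𝓤.rS a).val u = 𝓤.ε (u * 𝓤.s a) := rfl

lemma mul_rS_val (φ : 𝓤.RDual) (a : A) (u : U) :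
    (φ * 𝓤.rS a).val u = φ.val (u * 𝓤.t (op a)) := by
  obtain ⟨x, hx⟩ := 𝓤.exists_rep u
  have h := 𝓤.comul_mul_t a hx
  rw [rMul_val_rep _ _ _ hx]
  conv_rhs => rw [← 𝓤.counit_right _ _ h.symm]
  clear h hx
  induction x using TensorProduct.induction_on with
  | zero => simp
  | add x x' hx hx' => simp only [map_add, add_mul, hx, hx']
  | tmul p q =>
    rw [rConv_tmul, Algebra.TensorProduct.tmul_mul_tmul]
    change 𝓤.ε (𝓤.s (φ.val p) * q * 𝓤.s a) =
      φ.val (𝓤.t (op (𝓤.ε (q * 𝓤.t (op a)))) * (p * 1))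
    rw [φ.val_t, mul_assoc, counit_s_mul, 𝓤.counit_mul_t_eq, mul_one]

lemma rS_mul_val (φ : 𝓤.RDual) (a : A) (u : U) :
    (𝓤.rS a * φ).val u = φ.val (u * 𝓤.s a) := by
  obtain ⟨x, hx⟩ := 𝓤.exists_rep u
  have h := 𝓤.comul_mul_s a hx
  rw [rMul_val_rep _ _ _ hx]
  conv_rhs => rw [← 𝓤.counit_left _ _ h.symm]
  clear h hx
  induction x using TensorProduct.induction_on with
  | zero => simp
  | add x x' hx hx' => simp only [map_add, add_mul, hx, hx']
  | tmul p q =>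
    rw [rConv_tmul, rS_val, Algebra.TensorProduct.tmul_mul_tmul]
    change _ = φ.val (𝓤.s (𝓤.ε (p * 𝓤.s a)) * (q * 1))
    rw [mul_one]

/-- The linear map underlying the target of `U^*`. -/
def rTlin : Aᵐᵒᵖ →ₗ[k] 𝓤.RDual where
  toFun a := ⟨LinearMap.mulLeft k (unop a) ∘ₗ 𝓤.ε, fun b u => by
    simp [counit_t_mul, mul_assoc]⟩
  map_add' a b := RDual.ext fun u => add_mul (unop a) (unop b) (𝓤.ε u)
  map_smul' c a := RDual.ext fun u => smul_mul_assoc c (unop a) (𝓤.ε u)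

lemma rTlin_val (a : A) (u : U) : (𝓤.rTlin (op a)).val u = a * 𝓤.ε u := rfl

lemma mul_rTlin_val (φ : 𝓤.RDual) (a : A) (u : U) :
    (φ * 𝓤.rTlin (op a)).val u = a * φ.val u := by
  obtain ⟨x, hx⟩ := 𝓤.exists_rep u
  rw [rMul_val_rep _ _ _ hx]
  conv_rhs => rw [← 𝓤.counit_right _ _ hx]
  clear hx
  induction x using TensorProduct.induction_on with
  | zero => simp
  | add x x' hx hx' => simp only [map_add, mul_add, hx, hx']
  | tmul p q =>
    rw [rConv_tmul, rTlin_val, counit_s_mul]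
    exact congrArg (a * ·) (φ.val_t _ _).symm

/-- The target of `U^*`: `t(a)(u) = a ε(u)`. -/
def rT : Aᵐᵒᵖ →ₐ[k] 𝓤.RDual :=
  AlgHom.ofLinearMap 𝓤.rTlin
    (RDual.ext fun u => one_mul (𝓤.ε u))
    (fun a b => by
      ext u
      rw [← op_unop b, mul_rTlin_val]
      change unop b * unop a * 𝓤.ε u = unop b * (unop a * 𝓤.ε u)
      rw [mul_assoc])

lemma rT_val (a : A) (u : U) : (𝓤.rT (op a)).val u = a * 𝓤.ε u := rfl

lemma mul_rT_val (φ : 𝓤.RDual) (a : A) (u : U) :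
    (φ * 𝓤.rT (op a)).val u = a * φ.val u := 𝓤.mul_rTlin_val φ a u

lemma rT_mul_val (φ : 𝓤.RDual) (a : A) (u : U) :
    (𝓤.rT (op a) * φ).val u = φ.val (𝓤.s a * u) := by
  obtain ⟨x, hx⟩ := 𝓤.exists_rep u
  rw [rMul_val_rep _ _ _ hx]
  conv_rhs => rw [← 𝓤.counit_left _ _ hx]
  clear hx
  induction x using TensorProduct.induction_on with
  | zero => simp
  | add x x' hx hx' => simp only [map_add, mul_add, hx, hx']
  | tmul p q =>
    rw [rConv_tmul, rT_val, map_mul 𝓤.s, mul_assoc (𝓤.s _)]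
    rfl

lemma rS_mul_rT (a : A) (b : Aᵐᵒᵖ) : 𝓤.rS a * 𝓤.rT b = 𝓤.rT b * 𝓤.rS a := by
  ext u
  rw [← op_unop b, mul_rT_val, rT_mul_val, rS_val, rS_val, mul_assoc, counit_s_mul]

/-- `U^*_◀ ⊗_A ▶U^*`. -/
abbrev RSq : Type _ := BalTensor (mulR k 𝓤.rS) (mulR k fun a => 𝓤.rT (op a))

/-- The map `φ ⊗ ψ ↦ φ(- t(ψ(v)))`. -/
def rEval (v : U) : 𝓤.RSq →ₗ[k] 𝓤.RDual :=
  balLift _ _ (LinearMap.mk₂ k (fun φ ψ => φ * 𝓤.rS (ψ.val v))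
    (by intros; simp [add_mul]) (by intros; simp)
    (by intros; simp [mul_add]) (by intros; simp))
    (by intro a φ ψ; simp [mul_rT_val, mul_assoc])

lemma rEval_tmul (v : U) (φ ψ : 𝓤.RDual) :
    𝓤.rEval v (balMk _ _ (φ ⊗ₜ[k] ψ)) = φ * 𝓤.rS (ψ.val v) := rfl

/-- The pairing `⟨φ ⊗ ψ, u ⊗ v⟩ = φ(u t(ψ(v)))`. -/
def rPair (u v : U) (x : 𝓤.RSq) : A := (𝓤.rEval v x).val u

lemma rPair_tmul (u v : U) (φ ψ : 𝓤.RDual) :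
    𝓤.rPair u v (balMk _ _ (φ ⊗ₜ[k] ψ)) = φ.val (u * 𝓤.t (op (ψ.val v))) := by
  rw [rPair, rEval_tmul, mul_rS_val]

lemma rPair_add (u v : U) (x y : 𝓤.RSq) :
    𝓤.rPair u v (x + y) = 𝓤.rPair u v x + 𝓤.rPair u v y := by simp [rPair]

lemma rPair_zero (u v : U) : 𝓤.rPair u v 0 = 0 := by simp [rPair]

/-- The map `φ ↦ φ(- v)`. -/
def rShift (v : U) : 𝓤.RDual →ₗ[k] 𝓤.RDual where
  toFun φ := ⟨φ.val ∘ₗ LinearMap.mulRight k v, fun a u => by simp [mul_assoc, φ.val_t]⟩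
  map_add' φ ψ := by ext u; simp [RDual.val]; rfl
  map_smul' c φ := by ext u; simp [RDual.val]; rfl

lemma rShift_val (u v : U) (φ : 𝓤.RDual) : (𝓤.rShift v φ).val u = φ.val (u * v) := rfl

variable {𝓤} in
/-- A dual basis of `U_◁`. -/
lemma RightFGProjective.exists_dualBasis (h : 𝓤.RightFGProjective) :
    ∃ (n : ℕ) (e : Fin n → U) (e' : Fin n → 𝓤.RDual),
      ∀ u, ∑ i, 𝓤.t (op ((e' i).val u)) * e i = u := by
  obtain ⟨n, e, e', h1, h2⟩ := IsFGProjective.exists_dualBasis 𝓤.t h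
  exact ⟨n, e, fun i => ⟨(opLinearEquiv k).symm.toLinearMap ∘ₗ e' i, fun a u => by
    change unop (e' i (𝓤.t (op a) * u)) = unop (e' i u) * a
    rw [h1]; rfl⟩, h2⟩

variable {n : ℕ} {e : Fin n → U} {e' : Fin n → 𝓤.RDual}

lemma rBasis_val (he : ∀ u, ∑ i, 𝓤.t (op ((e' i).val u)) * e i = u) (φ : 𝓤.RDual) :
    φ = ∑ i, e' i * 𝓤.rT (op (φ.val (e i))) := by
  ext u
  have : ∀ f : Fin n → 𝓤.RDual, (∑ i, f i).val u = ∑ i, (f i).val u := fun f => by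
    let g : 𝓤.RDual →+ A := ⟨⟨fun φ => φ.val u, rfl⟩, fun _ _ => rfl⟩
    exact map_sum g f _
  rw [this]
  conv_lhs => rw [← he u, map_sum]
  simp [φ.val_t, mul_rT_val]

lemma rSq_eq (he : ∀ u, ∑ i, 𝓤.t (op ((e' i).val u)) * e i = u) (x : 𝓤.RSq) :
    x = ∑ i, balMk _ _ (𝓤.rEval (e i) x ⊗ₜ[k] e' i) := by
  obtain ⟨x, rfl⟩ := Submodule.mkQ_surjective _ x
  induction x using TensorProduct.induction_on with
  | zero => simp
  | add x y hx hy =>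
    simp only [map_add, TensorProduct.add_tmul, Finset.sum_add_distrib]
    rw [← hx, ← hy]
  | tmul φ ψ =>
    conv_lhs => rw [𝓤.rBasis_val he ψ, TensorProduct.tmul_sum, map_sum]
    exact Finset.sum_congr rfl fun i _ =>
      (balMk_rel (mulR k 𝓤.rS) (mulR k fun a => 𝓤.rT (op a)) _ _ _).symm

lemma rSq_ext (h : 𝓤.RightFGProjective) {x y : 𝓤.RSq}
    (hxy : ∀ u v, 𝓤.rPair u v x = 𝓤.rPair u v y) : x = y := by
  obtain ⟨n, e, e', he⟩ := h.exists_dualBasis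
  rw [𝓤.rSq_eq he x, 𝓤.rSq_eq he y]
  refine Finset.sum_congr rfl fun i _ => ?_
  rw [show 𝓤.rEval (e i) x = 𝓤.rEval (e i) y from RDual.ext fun u => hxy u _]

/-- The coproduct of `U^*`, `Δ(φ) = ∑ φ(- eᵢ) ⊗ eⁱ` for a dual basis of `U_◁`.  It is determined by
`φ(u v) = φ₁(u t(φ₂(v)))`. -/
noncomputable def rΔ (h : 𝓤.RightFGProjective) : 𝓤.RDual →ₗ[k] 𝓤.RSq :=
  ∑ i, balMk _ _ ∘ₗ (TensorProduct.mk k 𝓤.RDual 𝓤.RDual).flip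
    (h.exists_dualBasis.choose_spec.choose_spec.choose i) ∘ₗ
    𝓤.rShift (h.exists_dualBasis.choose_spec.choose i)

lemma rEval_rΔ (h : 𝓤.RightFGProjective) (v : U) (φ : 𝓤.RDual) :
    𝓤.rEval v (𝓤.rΔ h φ) = 𝓤.rShift v φ := by
  have he := h.exists_dualBasis.choose_spec.choose_spec.choose_spec
  ext u
  have : ∀ (m : ℕ) (f : Fin m → 𝓤.RDual), (∑ i, f i).val u = ∑ i, (f i).val u := fun m f => by
    let g : 𝓤.RDual →+ A := ⟨⟨fun φ => φ.val u, rfl⟩, fun _ _ => rfl⟩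
    exact map_sum g f _
  rw [rShift_val]
  conv_rhs => rw [← he v, Finset.mul_sum, map_sum]
  rw [rΔ, LinearMap.sum_apply, map_sum, this]
  refine Finset.sum_congr rfl fun i _ => ?_
  simp only [LinearMap.comp_apply, LinearMap.flip_apply, TensorProduct.mk_apply, rEval_tmul,
    mul_rS_val, rShift_val, mul_assoc]

lemma rPair_rΔ (h : 𝓤.RightFGProjective) (u v : U) (φ : 𝓤.RDual) :
    𝓤.rPair u v (𝓤.rΔ h φ) = φ.val (u * v) := by
  rw [rPair, rEval_rΔ, rShift_val]

/-- `U^*_◀ ⊗_A ▶U^*_◀ ⊗_A ▶U^*`. -/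
abbrev RCube : Type _ := BalTensor₃ (mulR k 𝓤.rS) (mulR k fun a => 𝓤.rT (op a))
  (mulR k 𝓤.rS) (mulR k fun a => 𝓤.rT (op a))

/-- The map `φ ⊗ ψ ⊗ χ ↦ φ ⊗ ψ(- t(χ(w)))`. -/
def rEval₃ (w : U) : 𝓤.RCube →ₗ[k] 𝓤.RSq :=
  (balRel₃ _ _ _ _).liftQ (TensorProduct.lift (LinearMap.mk₂ k
    (fun φ y => balMk _ _ (φ ⊗ₜ[k] 𝓤.rEval w (balMk _ _ y)))
    (by intros; rw [TensorProduct.add_tmul, map_add])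
    (by intros; rw [← TensorProduct.smul_tmul', map_smul])
    (by intros; rw [map_add, map_add, TensorProduct.tmul_add, map_add])
    (by intros; rw [map_smul, map_smul, TensorProduct.tmul_smul, map_smul]))) (by
    rw [balRel₃, Submodule.span_le]
    rintro _ (⟨b, m, n, p, rfl⟩ | ⟨b, m, n, p, rfl⟩)
    · rw [SetLike.mem_coe, LinearMap.mem_ker, map_sub, sub_eq_zero]
      change balMk _ _ ((m * 𝓤.rS b) ⊗ₜ[k] (n * 𝓤.rS (p.val w))) =
        balMk _ _ (m ⊗ₜ[k] (n * 𝓤.rT (op b) * 𝓤.rS (p.val w)))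
      rw [mul_assoc, ← rS_mul_rT, ← mul_assoc]
      exact balMk_rel (mulR k 𝓤.rS) (mulR k fun a => 𝓤.rT (op a)) _ _ _
    · rw [SetLike.mem_coe, LinearMap.mem_ker, map_sub, sub_eq_zero]
      change balMk _ _ (m ⊗ₜ[k] 𝓤.rEval w (balMk _ _ (mulR k 𝓤.rS b n ⊗ₜ[k] p))) = _
      rw [balMk_rel]
      rfl)

lemma rEval₃_mk (w : U) (φ : 𝓤.RDual) (y : 𝓤.RDual ⊗[k] 𝓤.RDual) :
    𝓤.rEval₃ w ((balRel₃ _ _ _ _).mkQ (φ ⊗ₜ[k] y)) =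
      balMk _ _ (φ ⊗ₜ[k] 𝓤.rEval w (balMk _ _ y)) := rfl

lemma rCube_eq (he : ∀ u, ∑ i, 𝓤.t (op ((e' i).val u)) * e i = u) (x : 𝓤.RCube) :
    x = ∑ i, balAssocL _ _ _ _ (𝓤.rEval₃ (e i) x ⊗ₜ[k] e' i) := by
  obtain ⟨x, rfl⟩ := Submodule.mkQ_surjective _ x
  induction x using TensorProduct.induction_on with
  | zero => simp
  | add x y hx hy =>
    simp only [map_add, TensorProduct.add_tmul, Finset.sum_add_distrib]
    rw [← hx, ← hy]
  | tmul φ y =>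
    have h := congrArg (fun z => balAssocR (mulR k 𝓤.rS) (mulR k fun a => 𝓤.rT (op a))
      (mulR k 𝓤.rS) (mulR k fun a => 𝓤.rT (op a)) (φ ⊗ₜ[k] z)) (𝓤.rSq_eq he (balMk _ _ y))
    simp only [TensorProduct.tmul_sum, map_sum] at h
    exact h

lemma rCube_ext (h : 𝓤.RightFGProjective) {x y : 𝓤.RCube}
    (hxy : ∀ u v w, 𝓤.rPair u v (𝓤.rEval₃ w x) = 𝓤.rPair u v (𝓤.rEval₃ w y)) : x = y := by
  obtain ⟨n, e, e', he⟩ := h.exists_dualBasis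
  rw [𝓤.rCube_eq he x, 𝓤.rCube_eq he y]
  refine Finset.sum_congr rfl fun i _ => ?_
  rw [𝓤.rSq_ext h fun u v => hxy u v (e i)]

end RightDual

end LeftBialgebroid

namespace LeftBialgebroid

variable {k A U : Type*} [CommRing k] [Ring A] [Algebra k A] [Ring U] [Algebra k U]
  (𝓤 : LeftBialgebroid k A U)

section RightDual

/-- The counit of `U^*`: `∂(φ) = φ(1)`. -/
def rCounit : 𝓤.RDual →ₗ[k] A where
  toFun φ := φ.val 1
  map_add' _ _ := rfl
  map_smul' _ _ := rfl

lemma rMul_val_contr (φ φ' : 𝓤.RDual) (u : U) :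
    (φ * φ').val u = φ'.val (𝓤.rContr φ (𝓤.Δ u)) := rfl

lemma rContr_mul_right (φ : 𝓤.RDual) (p : U ⊗[k] U) (v : U) :
    𝓤.rContr φ (balMk _ _ (p * (1 ⊗ₜ[k] v))) = 𝓤.rContr φ (balMk _ _ p) * v := by
  induction p using TensorProduct.induction_on with
  | zero => simp
  | add x y hx hy => simp only [map_add, add_mul, hx, hy]
  | tmul a b =>
    rw [Algebra.TensorProduct.tmul_mul_tmul, rContr_tmul, rContr_tmul, mul_one, mul_assoc]

lemma rContr_comul_mul_t (φ : 𝓤.RDual) (u : U) (a : A) :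
    𝓤.rContr φ (𝓤.Δ (u * 𝓤.t (op a))) = 𝓤.rContr φ (𝓤.Δ u) * 𝓤.t (op a) := by
  obtain ⟨p, hp⟩ := 𝓤.exists_rep u
  rw [𝓤.comul_mul_t a hp, rContr_mul_right, hp]

lemma rContr_takeuchi (φ : 𝓤.RDual) (u : U) (p : U ⊗[k] U) (hp : balMk _ _ p = 𝓤.Δ u)
    (a : A) (v : U) :
    𝓤.rContr φ (balMk _ _ (p * (𝓤.t (op a) ⊗ₜ[k] v))) =
      𝓤.rContr φ (𝓤.Δ u) * (𝓤.s a * v) := by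
  have h1 : 𝓤.t (op a) ⊗ₜ[k] v = (𝓤.t (op a) ⊗ₜ[k] 1) * ((1 : U) ⊗ₜ[k] v) := by simp
  rw [h1, ← mul_assoc, rContr_mul_right, 𝓤.takeuchi a u p hp, rContr_mul_right, hp, mul_assoc]

lemma rVal_sum {n : ℕ} (f : Fin n → 𝓤.RDual) (u : U) :
    (∑ i, f i).val u = ∑ i, (f i).val u := by
  let g : 𝓤.RDual →+ A := ⟨⟨fun φ => φ.val u, rfl⟩, fun _ _ => rfl⟩
  exact map_sum g f _

lemma rPair_sum {n : ℕ} (φ ψ : Fin n → 𝓤.RDual) (u v : U) :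
    𝓤.rPair u v (balMk _ _ (∑ i, φ i ⊗ₜ[k] ψ i)) =
      ∑ i, (φ i).val (u * 𝓤.t (op ((ψ i).val v))) := by
  rw [rPair, map_sum, map_sum, rVal_sum]
  exact Finset.sum_congr rfl fun i _ => 𝓤.rPair_tmul u v _ _

lemma rContr_comul_mul {n : ℕ} (g : 𝓤.RDual) (φ ψ : Fin n → 𝓤.RDual)
    (h : ∀ u v, ∑ i, (φ i).val (u * 𝓤.t (op ((ψ i).val v))) = g.val (u * v)) (u v : U) :
    𝓤.rContr g (𝓤.Δ (u * v)) =
      ∑ i, 𝓤.rContr (φ i) (𝓤.Δ u) * 𝓤.rContr (ψ i) (𝓤.Δ v) := by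
  obtain ⟨p, hp⟩ := 𝓤.exists_rep u
  obtain ⟨q, hq⟩ := 𝓤.exists_rep v
  rw [𝓤.comul_mul u v p q hp hq, ← hq]
  clear hq
  induction q using TensorProduct.induction_on with
  | zero => simp
  | add x y hx hy => simp only [map_add, mul_add, hx, hy, Finset.sum_add_distrib]
  | tmul q₁ q₂ =>
    simp only [rContr_tmul, ← 𝓤.rContr_takeuchi _ u p hp]
    clear hp
    induction p using TensorProduct.induction_on with
    | zero => simp
    | add x y hx hy => simp only [map_add, add_mul, hx, hy, Finset.sum_add_distrib]
    | tmul p₁ p₂ =>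
      simp only [Algebra.TensorProduct.tmul_mul_tmul, rContr_tmul, ← h, map_sum, Finset.sum_mul]

lemma rComul_mul (h : 𝓤.RightFGProjective) {g l : 𝓤.RDual} {x y : 𝓤.RDual ⊗[k] 𝓤.RDual}
    (hx : balMk _ _ x = 𝓤.rΔ h g) (hy : balMk _ _ y = 𝓤.rΔ h l) (u v : U) :
    (g * l).val (u * v) = 𝓤.rPair u v (balMk _ _ (x * y)) := by
  obtain ⟨n, φ, ψ, rfl⟩ := TensorProduct.exists_sum_tmul_eq x
  obtain ⟨m, φ', ψ', rfl⟩ := TensorProduct.exists_sum_tmul_eq y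
  have hx' : ∀ a b, ∑ i, (φ i).val (a * 𝓤.t (op ((ψ i).val b))) = g.val (a * b) := fun a b => by
    rw [← rPair_sum, hx, rPair_rΔ]
  have hy' : ∀ a b, ∑ i, (φ' i).val (a * 𝓤.t (op ((ψ' i).val b))) = l.val (a * b) :=
    fun a b => by rw [← rPair_sum, hy, rPair_rΔ]
  rw [rMul_val_contr, 𝓤.rContr_comul_mul g φ ψ hx', map_sum, Finset.sum_mul, map_sum, rPair,
    map_sum, rVal_sum]
  refine Finset.sum_congr rfl fun i _ => ?_
  rw [← hy', Finset.mul_sum, map_sum, map_sum, rVal_sum]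
  refine Finset.sum_congr rfl fun j _ => ?_
  rw [Algebra.TensorProduct.tmul_mul_tmul, rEval_tmul, mul_rS_val, rMul_val_contr,
    rContr_comul_mul_t, rMul_val_contr]

lemma rPair_assocL (h : 𝓤.RightFGProjective) (x : 𝓤.RDual ⊗[k] 𝓤.RDual) (u v w : U) :
    𝓤.rPair u v (𝓤.rEval₃ w (balAssocL _ _ (mulR k 𝓤.rS) (mulR k fun a => 𝓤.rT (op a))
      (LinearMap.rTensor 𝓤.RDual (𝓤.rΔ h) x))) = 𝓤.rPair (u * v) w (balMk _ _ x) := by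
  induction x using TensorProduct.induction_on with
  | zero => simp [rPair]
  | add x y hx hy => simp only [map_add, rPair_add, hx, hy]
  | tmul φ ψ =>
    obtain ⟨z, hz⟩ := Submodule.mkQ_surjective _ (𝓤.rΔ h φ)
    rw [LinearMap.rTensor_tmul, rPair_tmul, mul_assoc, ← 𝓤.rPair_rΔ h, ← hz]
    clear hz
    induction z using TensorProduct.induction_on with
    | zero => simp [rPair]
    | add x y hx hy =>
      simp only [map_add, TensorProduct.add_tmul, rPair_add, hx, hy]
    | tmul φ₁ φ₂ =>
      change 𝓤.rPair u v (balMk _ _ (φ₁ ⊗ₜ[k] (φ₂ * 𝓤.rS (ψ.val w)))) =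
        𝓤.rPair u (v * 𝓤.t (op (ψ.val w))) (balMk _ _ (φ₁ ⊗ₜ[k] φ₂))
      rw [rPair_tmul, rPair_tmul, mul_rS_val]

lemma rPair_assocR (h : 𝓤.RightFGProjective) (x : 𝓤.RDual ⊗[k] 𝓤.RDual) (u v w : U) :
    𝓤.rPair u v (𝓤.rEval₃ w (balAssocR (mulR k 𝓤.rS) (mulR k fun a => 𝓤.rT (op a)) _ _
      (LinearMap.lTensor 𝓤.RDual (𝓤.rΔ h) x))) = 𝓤.rPair u (v * w) (balMk _ _ x) := by
  induction x using TensorProduct.induction_on with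
  | zero => simp [rPair]
  | add x y hx hy => simp only [map_add, rPair_add, hx, hy]
  | tmul φ ψ =>
    obtain ⟨z, hz⟩ := Submodule.mkQ_surjective _ (𝓤.rΔ h ψ)
    rw [LinearMap.lTensor_tmul, rPair_tmul, ← 𝓤.rPair_rΔ h v w ψ, ← hz]
    change 𝓤.rPair u v (balMk _ _ (φ ⊗ₜ[k] 𝓤.rEval w (balMk _ _ z))) = _
    rw [rPair_tmul]
    rfl

/-- The right dual `U^*` as a right bialgebroid. -/
noncomputable def rightDual (h : 𝓤.RightFGProjective) : RightBialgebroid k A 𝓤.RDual where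
  s := 𝓤.rS
  t := 𝓤.rT
  Δ := 𝓤.rΔ h
  counit := 𝓤.rCounit
  s_mul_t := 𝓤.rS_mul_rT
  comul_bimod a b g x hx := 𝓤.rSq_ext h fun u v => by
    have h1 := 𝓤.rPair_rΔ h u (v * 𝓤.t (op b)) g
    obtain ⟨n, φ, ψ, rfl⟩ := TensorProduct.exists_sum_tmul_eq x
    rw [rPair_rΔ, mul_rS_val, mul_rT_val, mul_assoc, ← h1, ← hx, rPair_sum, Finset.sum_mul,
      Finset.mul_sum]
    simp only [Algebra.TensorProduct.tmul_mul_tmul]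
    rw [rPair_sum]
    simp only [mul_rS_val, mul_rT_val]
  counit_bimod a b g := by
    change (g * 𝓤.rT (op a) * 𝓤.rS b).val 1 = a * g.val 1 * b
    rw [mul_rS_val, mul_rT_val, one_mul, mul_assoc, ← g.val_t, mul_one]
  coassoc g x y hx hy := 𝓤.rCube_ext h fun u v w => by
    rw [rPair_assocL, rPair_assocR, hx, hy, rPair_rΔ, rPair_rΔ, mul_assoc]
  counit_left g x hx := RDual.ext fun u => by
    conv_rhs => rw [← one_mul u, ← 𝓤.rPair_rΔ h, ← hx]
    obtain ⟨n, φ, ψ, rfl⟩ := TensorProduct.exists_sum_tmul_eq x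
    rw [rPair_sum, map_sum, map_sum, map_sum, rVal_sum]
    refine Finset.sum_congr rfl fun i _ => ?_
    change (ψ i * 𝓤.rT (op ((φ i).val 1))).val u = _
    rw [mul_rT_val, one_mul, ← mul_one (𝓤.t _), (φ i).val_t]
  counit_right g x hx := RDual.ext fun u => by
    conv_rhs => rw [← mul_one u, ← 𝓤.rPair_rΔ h, ← hx]
    obtain ⟨n, φ, ψ, rfl⟩ := TensorProduct.exists_sum_tmul_eq x
    rw [rPair_sum, map_sum, map_sum, rVal_sum]
    refine Finset.sum_congr rfl fun i _ => ?_
    change (φ i * 𝓤.rS ((ψ i).val 1)).val u = _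
    rw [mul_rS_val]
  takeuchi a g x hx := 𝓤.rSq_ext h fun u v => by
    have h1 := (𝓤.rPair_rΔ h (u * 𝓤.s a) v g).trans
      ((congrArg g.val (mul_assoc u (𝓤.s a) v)).trans (𝓤.rPair_rΔ h u (𝓤.s a * v) g).symm)
    rw [← hx] at h1
    obtain ⟨n, φ, ψ, rfl⟩ := TensorProduct.exists_sum_tmul_eq x
    rw [rPair_sum, rPair_sum] at h1
    rw [Finset.mul_sum, Finset.mul_sum]
    simp only [Algebra.TensorProduct.tmul_mul_tmul]
    rw [rPair_sum, rPair_sum]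
    simp only [rS_mul_val, rT_mul_val, one_mul, ← h1]
    simp only [mul_assoc, 𝓤.s_mul_t]
  comul_one := 𝓤.rSq_ext h fun u v => by
    rw [rPair_rΔ, rPair_tmul]
    exact 𝓤.counit_mul_t u v
  comul_mul g l x y hx hy := 𝓤.rSq_ext h fun u v => by
    rw [rPair_rΔ, 𝓤.rComul_mul h hx hy]
  counit_one := 𝓤.counit_one
  counit_mul_s g l := by
    change (g * l).val 1 = (𝓤.rS (g.val 1) * l).val 1
    rw [rMul_val_contr, 𝓤.comul_one, rContr_tmul, rS_mul_val, mul_one, one_mul]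
  counit_mul_t g l := by
    change (g * l).val 1 = (𝓤.rT (op (g.val 1)) * l).val 1
    rw [rMul_val_contr, 𝓤.comul_one, rContr_tmul, rT_mul_val]

end RightDual
end LeftBialgebroid

namespace LeftBialgebroid

variable {k A U : Type*} [CommRing k] [Ring A] [Algebra k A] [Ring U] [Algebra k U]
  (𝓤 : LeftBialgebroid k A U)

section LeftDual

/-- The left dual `U_* = Hom_A(▷U, A)`. -/
def lDualSub : Submodule k (U →ₗ[k] A) where
  carrier := {φ | ∀ a u, φ (𝓤.s a * u) = a * φ u}
  add_mem' h h' a u := by simp [h a u, h' a u, mul_add]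
  zero_mem' a u := by simp
  smul_mem' c φ h a u := by simp [h a u]

/-- The left dual `U_* = Hom_A(▷U, A)`, as a type. -/
def LDual : Type _ := 𝓤.lDualSub

instance : AddCommGroup 𝓤.LDual := inferInstanceAs (AddCommGroup 𝓤.lDualSub)
instance : Module k 𝓤.LDual := inferInstanceAs (Module k 𝓤.lDualSub)

variable {𝓤} in
/-- The underlying linear map of an element of `U_*`. -/
def LDual.val (φ : 𝓤.LDual) : U →ₗ[k] A := Subtype.val φ

variable {𝓤} in
@[ext] lemma LDual.ext {φ ψ : 𝓤.LDual} (h : ∀ u, φ.val u = ψ.val u) : φ = ψ :=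
  Subtype.ext (LinearMap.ext h)

variable {𝓤} in
lemma LDual.val_s (φ : 𝓤.LDual) (a : A) (u : U) : φ.val (𝓤.s a * u) = a * φ.val u :=
  φ.2 a u

variable {𝓤} in
@[simp] lemma LDual.val_add (φ ψ : 𝓤.LDual) : (φ + ψ).val = φ.val + ψ.val := rfl

variable {𝓤} in
@[simp] lemma LDual.val_smul (c : k) (φ : 𝓤.LDual) : (c • φ).val = c • φ.val := rfl

variable {𝓤} in
@[simp] lemma LDual.val_zero : (0 : 𝓤.LDual).val = 0 := rfl

/-- The map `U_◁ ⊗_A ▷U → U`, `u ⊗ v ↦ t(ψ(v)) u`. -/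
def lContr (ψ : 𝓤.LDual) : 𝓤.Sq →ₗ[k] U :=
  balLift _ _ (LinearMap.mk₂ k (fun u v => 𝓤.t (op (ψ.val v)) * u)
    (by intros; simp [mul_add]) (by intros; simp)
    (by intros; simp [add_mul]) (by intros; simp))
    (by intro a u v; simp [ψ.val_s, mul_assoc])

lemma lContr_tmul (ψ : 𝓤.LDual) (u v : U) :
    𝓤.lContr ψ (balMk _ _ (u ⊗ₜ[k] v)) = 𝓤.t (op (ψ.val v)) * u := rfl

/-- The map `U_◁ ⊗_A ▷U → A`, `u ⊗ v ↦ ψ'(t(ψ(v)) u)`. -/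
def lConv (ψ : 𝓤.LDual) (ψ' : U →ₗ[k] A) : 𝓤.Sq →ₗ[k] A := ψ' ∘ₗ 𝓤.lContr ψ

lemma lConv_tmul (ψ : 𝓤.LDual) (ψ' : U →ₗ[k] A) (u v : U) :
    𝓤.lConv ψ ψ' (balMk _ _ (u ⊗ₜ[k] v)) = ψ' (𝓤.t (op (ψ.val v)) * u) := rfl

/-- The product of `U_*`: `(ψ ψ')(u) = ψ'(t(ψ(u₂)) u₁)`. -/
instance : Mul 𝓤.LDual where
  mul ψ ψ' := ⟨𝓤.lConv ψ ψ'.val ∘ₗ 𝓤.Δ, fun a u => by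
    obtain ⟨x, hx⟩ := 𝓤.exists_rep u
    rw [LinearMap.comp_apply, LinearMap.comp_apply, 𝓤.comul_s_mul a hx, ← hx]
    clear hx
    induction x using TensorProduct.induction_on with
    | zero => simp
    | add x x' hx hx' => simp only [map_add, mul_add, hx, hx']
    | tmul p q =>
      rw [Algebra.TensorProduct.tmul_mul_tmul, lConv_tmul, lConv_tmul, ← mul_assoc, one_mul,
        ← 𝓤.s_mul_t, mul_assoc, ψ'.val_s]⟩

lemma lMul_val (φ φ' : 𝓤.LDual) (u : U) : (φ * φ').val u = 𝓤.lConv φ φ'.val (𝓤.Δ u) := rfl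

/-- The unit of `U_*` is the counit of `U`. -/
instance : One 𝓤.LDual where
  one := ⟨𝓤.ε, fun a u => 𝓤.counit_s_mul a u⟩

@[simp] lemma lOne_val : (1 : 𝓤.LDual).val = 𝓤.ε := rfl

/-- The map `u ⊗ v ⊗ w ↦ χ(t(ψ(t(φ(w)) v)) u)`. -/
def lConv₃ (φ ψ : 𝓤.LDual) (χ : U →ₗ[k] A) :
    BalTensor₃ (mulL k fun a => 𝓤.t (op a)) (mulL k 𝓤.s)
      (mulL k fun a => 𝓤.t (op a)) (mulL k 𝓤.s) →ₗ[k] A :=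
  (balRel₃ _ _ _ _).liftQ (TensorProduct.lift (LinearMap.mk₂ k
    (fun u (y : U ⊗[k] U) => 𝓤.lConv ψ χ (balMk _ _ (u ⊗ₜ[k] 𝓤.lContr φ (balMk _ _ y))))
    (by intros; rw [TensorProduct.add_tmul, map_add, map_add])
    (by intros; rw [← TensorProduct.smul_tmul', map_smul, map_smul])
    (by intros; rw [map_add, map_add, TensorProduct.tmul_add, map_add, map_add])
    (by intros; rw [map_smul, map_smul, TensorProduct.tmul_smul, map_smul, map_smul]))) (by
    rw [balRel₃, Submodule.span_le]
    rintro _ (⟨b, m, n, p, rfl⟩ | ⟨b, m, n, p, rfl⟩)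
    · rw [SetLike.mem_coe, LinearMap.mem_ker, map_sub, sub_eq_zero]
      change χ (𝓤.t (op (ψ.val (𝓤.t (op (φ.val p)) * n))) * (𝓤.t (op b) * m)) =
        χ (𝓤.t (op (ψ.val (𝓤.t (op (φ.val p)) * (𝓤.s b * n)))) * m)
      rw [← mul_assoc (𝓤.t _) (𝓤.s _), ← 𝓤.s_mul_t, mul_assoc, ψ.val_s, op_mul, map_mul 𝓤.t,
        mul_assoc]
    · rw [SetLike.mem_coe, LinearMap.mem_ker, map_sub, sub_eq_zero]
      change 𝓤.lConv ψ χ (balMk _ _ (m ⊗ₜ[k] 𝓤.lContr φ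
        (balMk _ _ (mulL k (fun a => 𝓤.t (op a)) b n ⊗ₜ[k] p)))) = _
      rw [balMk_rel]
      rfl)

lemma lConv₃_mk (φ ψ : 𝓤.LDual) (χ : U →ₗ[k] A) (u v w : U) :
    𝓤.lConv₃ φ ψ χ ((balRel₃ _ _ _ _).mkQ (u ⊗ₜ[k] (v ⊗ₜ[k] w))) =
      χ (𝓤.t (op (ψ.val (𝓤.t (op (φ.val w)) * v))) * u) := rfl

lemma lMul_assoc (φ ψ χ : 𝓤.LDual) : φ * ψ * χ = φ * (ψ * χ) := by
  ext u
  obtain ⟨x, hx⟩ := 𝓤.exists_rep u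
  have h := (congrArg (𝓤.lConv₃ φ ψ χ.val) (𝓤.coassoc u x x hx hx)).symm
  rw [lMul_val, lMul_val, ← hx]
  convert h using 1
  · clear h hx
    induction x using TensorProduct.induction_on with
    | zero => simp
    | add x x' hx hx' => simp only [map_add, hx, hx']
    | tmul p q =>
      obtain ⟨y, hy⟩ := 𝓤.exists_rep q
      rw [lConv_tmul, lMul_val, LinearMap.lTensor_tmul, ← hy]
      rfl
  · clear h hx
    induction x using TensorProduct.induction_on with
    | zero => simp
    | add x x' hx hx' => simp only [map_add, hx, hx']
    | tmul p q =>
      obtain ⟨y, hy⟩ := 𝓤.exists_rep p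
      rw [lConv_tmul, lMul_val, LinearMap.rTensor_tmul, 𝓤.comul_t_mul _ hy, ← hy]
      clear hy
      induction y using TensorProduct.induction_on with
      | zero => simp
      | add x x' hx hx' => simp only [map_add, TensorProduct.add_tmul, mul_add, hx, hx']
      | tmul m n =>
        rw [Algebra.TensorProduct.tmul_mul_tmul, one_mul, lConv_tmul]
        exact (𝓤.lConv₃_mk φ ψ χ.val m n q).symm

instance : Ring 𝓤.LDual :=
  { (inferInstance : AddCommGroup 𝓤.LDual), (inferInstance : Mul 𝓤.LDual),
    (inferInstance : One 𝓤.LDual) with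
    mul_assoc := 𝓤.lMul_assoc
    one_mul := fun φ => by
      ext u
      obtain ⟨x, hx⟩ := 𝓤.exists_rep u
      conv_rhs => rw [← 𝓤.counit_right u x hx]
      rw [lMul_val, ← hx]
      clear hx
      induction x using TensorProduct.induction_on with
      | zero => simp
      | add x x' hx hx' => simp only [map_add, hx, hx']
      | tmul p q => rfl
    mul_one := fun φ => by
      ext u
      obtain ⟨x, hx⟩ := 𝓤.exists_rep u
      conv_rhs => rw [← 𝓤.counit_left u x hx]
      rw [lMul_val, ← hx]
      clear hx
      induction x using TensorProduct.induction_on with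
      | zero => simp
      | add x x' hx hx' => simp only [map_add, hx, hx']
      | tmul p q =>
        rw [lConv_tmul, lOne_val, 𝓤.counit_t_mul]
        exact (φ.val_s _ _).symm
    left_distrib := fun φ ψ χ => by
      ext u
      obtain ⟨x, hx⟩ := 𝓤.exists_rep u
      rw [LDual.val_add, LinearMap.add_apply, lMul_val, lMul_val, lMul_val, ← hx]
      clear hx
      induction x using TensorProduct.induction_on with
      | zero => simp
      | add x x' hx hx' => simp only [map_add, hx, hx']; abel
      | tmul p q => simp only [lConv_tmul, LDual.val_add, LinearMap.add_apply]
    right_distrib := fun φ ψ χ => by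
      ext u
      obtain ⟨x, hx⟩ := 𝓤.exists_rep u
      rw [LDual.val_add, LinearMap.add_apply, lMul_val, lMul_val, lMul_val, ← hx]
      clear hx
      induction x using TensorProduct.induction_on with
      | zero => simp
      | add x x' hx hx' => simp only [map_add, hx, hx']; abel
      | tmul p q =>
        simp only [lConv_tmul, LDual.val_add, LinearMap.add_apply, map_add, op_add, add_mul]
    zero_mul := fun φ => by
      ext u
      obtain ⟨x, hx⟩ := 𝓤.exists_rep u
      rw [lMul_val, ← hx]
      clear hx
      induction x using TensorProduct.induction_on with
      | zero => simp
      | add x x' hx hx' => simp only [map_add, hx, hx']; simp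
      | tmul p q => simp [lConv_tmul, -Submodule.mkQ_apply]
    mul_zero := fun φ => by
      ext u
      obtain ⟨x, hx⟩ := 𝓤.exists_rep u
      rw [lMul_val, ← hx]
      clear hx
      induction x using TensorProduct.induction_on with
      | zero => simp
      | add x x' hx hx' => simp only [map_add, hx, hx']; simp
      | tmul p q => simp [lConv_tmul, -Submodule.mkQ_apply] }

instance : Algebra k 𝓤.LDual := Algebra.ofModule
  (fun c φ ψ => by
    ext u
    obtain ⟨x, hx⟩ := 𝓤.exists_rep u
    rw [LDual.val_smul, LinearMap.smul_apply, lMul_val, lMul_val, ← hx]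
    clear hx
    induction x using TensorProduct.induction_on with
    | zero => simp
    | add x x' hx hx' => simp only [map_add, hx, hx', smul_add]
    | tmul p q => simp only [lConv_tmul, LDual.val_smul, LinearMap.smul_apply, map_smul,
        op_smul, smul_mul_assoc])
  (fun c φ ψ => by
    ext u
    obtain ⟨x, hx⟩ := 𝓤.exists_rep u
    rw [LDual.val_smul, LinearMap.smul_apply, lMul_val, lMul_val, ← hx]
    clear hx
    induction x using TensorProduct.induction_on with
    | zero => simp
    | add x x' hx hx' => simp only [map_add, hx, hx', smul_add]
    | tmul p q => simp only [lConv_tmul, LDual.val_smul, LinearMap.smul_apply])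

lemma lMul_val_rep (φ φ' : 𝓤.LDual) {u : U} {x : U ⊗[k] U} (hx : balMk _ _ x = 𝓤.Δ u) :
    (φ * φ').val u = 𝓤.lConv φ φ'.val (balMk _ _ x) := by
  rw [lMul_val, hx]

/-- The linear map underlying the source of `U_*`. -/
def lSlin : A →ₗ[k] 𝓤.LDual where
  toFun a := ⟨LinearMap.mulRight k a ∘ₗ 𝓤.ε, fun b u => by
    simp [counit_s_mul, mul_assoc]⟩
  map_add' a b := LDual.ext fun u => mul_add (𝓤.ε u) a b
  map_smul' c a := LDual.ext fun u => mul_smul_comm c (𝓤.ε u) a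

lemma lSlin_val (a : A) (u : U) : (𝓤.lSlin a).val u = 𝓤.ε u * a := rfl

lemma mul_lSlin_val (φ : 𝓤.LDual) (a : A) (u : U) :
    (φ * 𝓤.lSlin a).val u = φ.val u * a := by
  obtain ⟨x, hx⟩ := 𝓤.exists_rep u
  rw [lMul_val_rep _ _ _ hx]
  conv_rhs => rw [← 𝓤.counit_left _ _ hx]
  clear hx
  induction x using TensorProduct.induction_on with
  | zero => simp
  | add x x' hx hx' => simp only [map_add, add_mul, hx, hx']
  | tmul p q =>
    rw [lConv_tmul, lSlin_val, counit_t_mul]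
    exact congrArg (· * a) (φ.val_s _ _).symm

/-- The source of `U_*`: `s(a)(u) = ε(u) a`. -/
def lS : A →ₐ[k] 𝓤.LDual :=
  AlgHom.ofLinearMap 𝓤.lSlin
    (LDual.ext fun u => mul_one (𝓤.ε u))
    (fun a b => by
      ext u
      rw [mul_lSlin_val]
      exact (mul_assoc _ _ _).symm)

lemma lS_val (a : A) (u : U) : (𝓤.lS a).val u = 𝓤.ε u * a := rfl

lemma mul_lS_val (φ : 𝓤.LDual) (a : A) (u : U) :
    (φ * 𝓤.lS a).val u = φ.val u * a := 𝓤.mul_lSlin_val φ a u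

lemma lS_mul_val (φ : 𝓤.LDual) (a : A) (u : U) :
    (𝓤.lS a * φ).val u = φ.val (𝓤.t (op a) * u) := by
  obtain ⟨x, hx⟩ := 𝓤.exists_rep u
  rw [lMul_val_rep _ _ _ hx]
  conv_rhs => rw [← 𝓤.counit_right _ _ hx]
  clear hx
  induction x using TensorProduct.induction_on with
  | zero => simp
  | add x x' hx hx' => simp only [map_add, mul_add, hx, hx']
  | tmul p q =>
    rw [lConv_tmul, lS_val, op_mul, map_mul 𝓤.t, mul_assoc (𝓤.t _)]
    rfl

/-- The linear map underlying the target of `U_*`. -/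
def lTlin : Aᵐᵒᵖ →ₗ[k] 𝓤.LDual where
  toFun a := ⟨𝓤.ε ∘ₗ LinearMap.mulRight k (𝓤.t a), fun b u => by
    simp [mul_assoc, counit_s_mul]⟩
  map_add' a b := LDual.ext fun u => by
    change 𝓤.ε (u * 𝓤.t (a + b)) = 𝓤.ε (u * 𝓤.t a) + 𝓤.ε (u * 𝓤.t b)
    rw [map_add, mul_add, map_add]
  map_smul' c a := LDual.ext fun u => by
    change 𝓤.ε (u * 𝓤.t (c • a)) = c • 𝓤.ε (u * 𝓤.t a)
    rw [map_smul, mul_smul_comm, map_smul]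

lemma lTlin_val (a : A) (u : U) : (𝓤.lTlin (op a)).val u = 𝓤.ε (u * 𝓤.t (op a)) := rfl

lemma mul_lTlin_val (φ : 𝓤.LDual) (a : A) (u : U) :
    (φ * 𝓤.lTlin (op a)).val u = φ.val (u * 𝓤.s a) := by
  obtain ⟨x, hx⟩ := 𝓤.exists_rep u
  have h := 𝓤.comul_mul_s a hx
  rw [lMul_val_rep _ _ _ hx]
  conv_rhs => rw [← 𝓤.counit_left _ _ h.symm]
  clear h hx
  induction x using TensorProduct.induction_on with
  | zero => simp
  | add x x' hx hx' => simp only [map_add, add_mul, hx, hx']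
  | tmul p q =>
    rw [lConv_tmul, Algebra.TensorProduct.tmul_mul_tmul]
    change 𝓤.ε (𝓤.t (op (φ.val q)) * p * 𝓤.t (op a)) =
      φ.val (𝓤.s (𝓤.ε (p * 𝓤.s a)) * (q * 1))
    rw [φ.val_s, mul_assoc, counit_t_mul, 𝓤.counit_mul_t_eq, mul_one]

/-- The target of `U_*`: `t(a)(u) = ε(u t(a))`. -/
def lT : Aᵐᵒᵖ →ₐ[k] 𝓤.LDual :=
  AlgHom.ofLinearMap 𝓤.lTlin
    (LDual.ext fun u => by
      change 𝓤.ε (u * 𝓤.t 1) = 𝓤.ε u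
      rw [map_one, mul_one])
    (fun a b => by
      ext u
      rw [← op_unop a, ← op_unop b, ← op_mul, mul_lTlin_val, lTlin_val, lTlin_val,
        𝓤.counit_mul_t_eq, map_mul 𝓤.s, ← mul_assoc, 𝓤.counit_mul_t_eq])

lemma lT_val (a : A) (u : U) : (𝓤.lT (op a)).val u = 𝓤.ε (u * 𝓤.t (op a)) := rfl

lemma mul_lT_val (φ : 𝓤.LDual) (a : A) (u : U) :
    (φ * 𝓤.lT (op a)).val u = φ.val (u * 𝓤.s a) := 𝓤.mul_lTlin_val φ a u

lemma lT_mul_val (φ : 𝓤.LDual) (a : A) (u : U) :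
    (𝓤.lT (op a) * φ).val u = φ.val (u * 𝓤.t (op a)) := by
  obtain ⟨x, hx⟩ := 𝓤.exists_rep u
  have h := 𝓤.comul_mul_t a hx
  rw [lMul_val_rep _ _ _ hx]
  conv_rhs => rw [← 𝓤.counit_right _ _ h.symm]
  clear h hx
  induction x using TensorProduct.induction_on with
  | zero => simp
  | add x x' hx hx' => simp only [map_add, add_mul, hx, hx']
  | tmul p q =>
    rw [lConv_tmul, lT_val, Algebra.TensorProduct.tmul_mul_tmul]
    change _ = φ.val (𝓤.t (op (𝓤.ε (q * 𝓤.t (op a)))) * (p * 1))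
    rw [mul_one]

lemma lS_mul_lT (a : A) (b : Aᵐᵒᵖ) : 𝓤.lS a * 𝓤.lT b = 𝓤.lT b * 𝓤.lS a := by
  ext u
  rw [← op_unop b, mul_lS_val, lS_mul_val, lT_val, lT_val, mul_assoc, counit_t_mul]

/-- `U_*_◀ ⊗_A ▶U_*`. -/
abbrev LSq : Type _ := BalTensor (mulR k 𝓤.lS) (mulR k fun a => 𝓤.lT (op a))

/-- The map `φ ⊗ ψ ↦ ψ(- s(φ(v)))`. -/
def lEval (v : U) : 𝓤.LSq →ₗ[k] 𝓤.LDual :=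
  balLift _ _ (LinearMap.mk₂ k (fun φ ψ => ψ * 𝓤.lT (op (φ.val v)))
    (by intros; simp [mul_add]) (by intros; simp)
    (by intros; simp [add_mul]) (by intros; simp))
    (by intro a φ ψ; simp [mul_lS_val, mul_assoc])

lemma lEval_tmul (v : U) (φ ψ : 𝓤.LDual) :
    𝓤.lEval v (balMk _ _ (φ ⊗ₜ[k] ψ)) = ψ * 𝓤.lT (op (φ.val v)) := rfl

/-- The pairing `⟨φ ⊗ ψ, u ⊗ v⟩ = ψ(u s(φ(v)))`. -/
def lPair (u v : U) (x : 𝓤.LSq) : A := (𝓤.lEval v x).val u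

lemma lPair_tmul (u v : U) (φ ψ : 𝓤.LDual) :
    𝓤.lPair u v (balMk _ _ (φ ⊗ₜ[k] ψ)) = ψ.val (u * 𝓤.s (φ.val v)) := by
  rw [lPair, lEval_tmul, mul_lT_val]

lemma lPair_add (u v : U) (x y : 𝓤.LSq) :
    𝓤.lPair u v (x + y) = 𝓤.lPair u v x + 𝓤.lPair u v y := by simp [lPair]

/-- The map `φ ↦ φ(- v)`. -/
def lShift (v : U) : 𝓤.LDual →ₗ[k] 𝓤.LDual where
  toFun φ := ⟨φ.val ∘ₗ LinearMap.mulRight k v, fun a u => by simp [mul_assoc, φ.val_s]⟩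
  map_add' φ ψ := by ext u; simp [LDual.val]; rfl
  map_smul' c φ := by ext u; simp [LDual.val]; rfl

lemma lShift_val (u v : U) (φ : 𝓤.LDual) : (𝓤.lShift v φ).val u = φ.val (u * v) := rfl

lemma lVal_sum {n : ℕ} (f : Fin n → 𝓤.LDual) (u : U) :
    (∑ i, f i).val u = ∑ i, (f i).val u := by
  let g : 𝓤.LDual →+ A := ⟨⟨fun φ => φ.val u, rfl⟩, fun _ _ => rfl⟩
  exact map_sum g f _

variable {𝓤} in
/-- A dual basis of `▷U`. -/
lemma LeftFGProjective.exists_dualBasis (h : 𝓤.LeftFGProjective) :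
    ∃ (n : ℕ) (e : Fin n → U) (e' : Fin n → 𝓤.LDual),
      ∀ u, ∑ i, 𝓤.s ((e' i).val u) * e i = u := by
  obtain ⟨n, e, e', h1, h2⟩ := IsFGProjective.exists_dualBasis 𝓤.s h
  exact ⟨n, e, fun i => ⟨e' i, fun a u => h1 i a u⟩, h2⟩

variable {n : ℕ} {e : Fin n → U} {e' : Fin n → 𝓤.LDual}

lemma lBasis_val (he : ∀ u, ∑ i, 𝓤.s ((e' i).val u) * e i = u) (φ : 𝓤.LDual) :
    φ = ∑ i, e' i * 𝓤.lS (φ.val (e i)) := by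
  ext u
  rw [lVal_sum]
  conv_lhs => rw [← he u, map_sum]
  simp [φ.val_s, mul_lS_val]

lemma lSq_eq (he : ∀ u, ∑ i, 𝓤.s ((e' i).val u) * e i = u) (x : 𝓤.LSq) :
    x = ∑ i, balMk _ _ (e' i ⊗ₜ[k] 𝓤.lEval (e i) x) := by
  obtain ⟨x, rfl⟩ := Submodule.mkQ_surjective _ x
  induction x using TensorProduct.induction_on with
  | zero => simp
  | add x y hx hy =>
    simp only [map_add, TensorProduct.tmul_add, Finset.sum_add_distrib]
    rw [← hx, ← hy]
  | tmul φ ψ =>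
    conv_lhs => rw [𝓤.lBasis_val he φ, TensorProduct.sum_tmul, map_sum]
    exact Finset.sum_congr rfl fun i _ =>
      balMk_rel (mulR k 𝓤.lS) (mulR k fun a => 𝓤.lT (op a)) _ _ _

lemma lSq_ext (h : 𝓤.LeftFGProjective) {x y : 𝓤.LSq}
    (hxy : ∀ u v, 𝓤.lPair u v x = 𝓤.lPair u v y) : x = y := by
  obtain ⟨n, e, e', he⟩ := h.exists_dualBasis
  rw [𝓤.lSq_eq he x, 𝓤.lSq_eq he y]
  refine Finset.sum_congr rfl fun i _ => ?_
  rw [show 𝓤.lEval (e i) x = 𝓤.lEval (e i) y from LDual.ext fun u => hxy u _]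

/-- The coproduct of `U_*`, `Δ(ψ) = ∑ eⁱ ⊗ ψ(- eᵢ)` for a dual basis of `▷U`.  It is determined by
`ψ(u v) = ψ₂(u s(ψ₁(v)))`. -/
noncomputable def lΔ (h : 𝓤.LeftFGProjective) : 𝓤.LDual →ₗ[k] 𝓤.LSq :=
  ∑ i, balMk _ _ ∘ₗ TensorProduct.mk k 𝓤.LDual 𝓤.LDual
    (h.exists_dualBasis.choose_spec.choose_spec.choose i) ∘ₗ
    𝓤.lShift (h.exists_dualBasis.choose_spec.choose i)

lemma lEval_lΔ (h : 𝓤.LeftFGProjective) (v : U) (φ : 𝓤.LDual) :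
    𝓤.lEval v (𝓤.lΔ h φ) = 𝓤.lShift v φ := by
  have he := h.exists_dualBasis.choose_spec.choose_spec.choose_spec
  ext u
  rw [lShift_val]
  conv_rhs => rw [← he v, Finset.mul_sum, map_sum]
  rw [lΔ, LinearMap.sum_apply, map_sum, lVal_sum]
  refine Finset.sum_congr rfl fun i _ => ?_
  simp only [LinearMap.comp_apply, TensorProduct.mk_apply, lEval_tmul,
    mul_lT_val, lShift_val, mul_assoc]

lemma lPair_lΔ (h : 𝓤.LeftFGProjective) (u v : U) (φ : 𝓤.LDual) :
    𝓤.lPair u v (𝓤.lΔ h φ) = φ.val (u * v) := by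
  rw [lPair, lEval_lΔ, lShift_val]

/-- `U_*_◀ ⊗_A ▶U_*_◀ ⊗_A ▶U_*`. -/
abbrev LCube : Type _ := BalTensor₃ (mulR k 𝓤.lS) (mulR k fun a => 𝓤.lT (op a))
  (mulR k 𝓤.lS) (mulR k fun a => 𝓤.lT (op a))

/-- The map `φ ⊗ ψ ⊗ χ ↦ ψ(- s(φ(w))) ⊗ χ`. -/
def lEval₃ (w : U) : 𝓤.LCube →ₗ[k] 𝓤.LSq :=
  (balRel₃ _ _ _ _).liftQ (TensorProduct.lift (LinearMap.mk₂ k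
    (fun φ y => balMk _ _ (LinearMap.rTensor 𝓤.LDual
      (LinearMap.mulRight k (𝓤.lT (op (φ.val w)))) y))
    (by intro φ φ' y
        induction y using TensorProduct.induction_on with
        | zero => simp
        | add x y hx hy => simp only [map_add, hx, hy]; abel
        | tmul a b => simp only [LinearMap.rTensor_tmul, LinearMap.mulRight_apply, LDual.val_add,
            LinearMap.add_apply, op_add, map_add, mul_add, TensorProduct.add_tmul])
    (by intro c φ y
        induction y using TensorProduct.induction_on with
        | zero => simp
        | add x y hx hy => simp only [map_add, hx, hy, smul_add]
        | tmul a b => simp only [LinearMap.rTensor_tmul, LinearMap.mulRight_apply, LDual.val_smul,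
            LinearMap.smul_apply, op_smul, map_smul, mul_smul_comm, ← TensorProduct.smul_tmul'])
    (by intros; simp only [map_add])
    (by intros; simp only [map_smul]))) (by
    rw [balRel₃, Submodule.span_le]
    rintro _ (⟨b, m, n, p, rfl⟩ | ⟨b, m, n, p, rfl⟩)
    · rw [SetLike.mem_coe, LinearMap.mem_ker, map_sub, sub_eq_zero]
      change balMk _ _ ((n * 𝓤.lT (op ((m * 𝓤.lS b).val w))) ⊗ₜ[k] p) =
        balMk _ _ ((n * 𝓤.lT (op b) * 𝓤.lT (op (m.val w))) ⊗ₜ[k] p)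
      rw [mul_lS_val, op_mul, map_mul, mul_assoc]
    · rw [SetLike.mem_coe, LinearMap.mem_ker, map_sub, sub_eq_zero]
      change balMk _ _ ((n * 𝓤.lS b * 𝓤.lT (op (m.val w))) ⊗ₜ[k] p) =
        balMk _ _ ((n * 𝓤.lT (op (m.val w))) ⊗ₜ[k] (p * 𝓤.lT (op b)))
      rw [mul_assoc, lS_mul_lT, ← mul_assoc]
      exact balMk_rel (mulR k 𝓤.lS) (mulR k fun a => 𝓤.lT (op a)) _ _ _)

lemma lEval₃_mk (w : U) (φ ψ χ : 𝓤.LDual) :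
    𝓤.lEval₃ w ((balRel₃ _ _ _ _).mkQ (φ ⊗ₜ[k] (ψ ⊗ₜ[k] χ))) =
      balMk _ _ ((ψ * 𝓤.lT (op (φ.val w))) ⊗ₜ[k] χ) := rfl

lemma lEval₃_assocL (w : U) (z : 𝓤.LSq) (χ : 𝓤.LDual) :
    𝓤.lEval₃ w (balAssocL _ _ (mulR k 𝓤.lS) (mulR k fun a => 𝓤.lT (op a)) (z ⊗ₜ[k] χ)) =
      balMk _ _ (𝓤.lEval w z ⊗ₜ[k] χ) := by
  obtain ⟨z, rfl⟩ := Submodule.mkQ_surjective _ z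
  induction z using TensorProduct.induction_on with
  | zero => simp
  | add x y hx hy => simp only [map_add, TensorProduct.add_tmul, hx, hy]
  | tmul a b => rfl

lemma lCube_eq (he : ∀ u, ∑ i, 𝓤.s ((e' i).val u) * e i = u) (x : 𝓤.LCube) :
    x = ∑ i, balAssocR _ _ _ _ (e' i ⊗ₜ[k] 𝓤.lEval₃ (e i) x) := by
  obtain ⟨x, rfl⟩ := Submodule.mkQ_surjective _ x
  induction x using TensorProduct.induction_on with
  | zero => simp
  | add x y hx hy =>
    simp only [map_add, TensorProduct.tmul_add, Finset.sum_add_distrib]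
    rw [← hx, ← hy]
  | tmul φ y =>
    induction y using TensorProduct.induction_on with
    | zero => simp
    | add x y hx hy =>
      simp only [map_add, TensorProduct.tmul_add, Finset.sum_add_distrib]
      rw [← hx, ← hy]
    | tmul ψ χ =>
      have h := congrArg (fun z => balAssocL (mulR k 𝓤.lS) (mulR k fun a => 𝓤.lT (op a))
        (mulR k 𝓤.lS) (mulR k fun a => 𝓤.lT (op a)) (z ⊗ₜ[k] χ))
        (𝓤.lSq_eq he (balMk _ _ (φ ⊗ₜ[k] ψ)))
      simp only [TensorProduct.sum_tmul, map_sum] at h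
      exact h

lemma lCube_ext (h : 𝓤.LeftFGProjective) {x y : 𝓤.LCube}
    (hxy : ∀ u v w, 𝓤.lPair u v (𝓤.lEval₃ w x) = 𝓤.lPair u v (𝓤.lEval₃ w y)) : x = y := by
  obtain ⟨n, e, e', he⟩ := h.exists_dualBasis
  rw [𝓤.lCube_eq he x, 𝓤.lCube_eq he y]
  refine Finset.sum_congr rfl fun i _ => ?_
  rw [𝓤.lSq_ext h fun u v => hxy u v (e i)]

/-- The counit of `U_*`: `∂(ψ) = ψ(1)`. -/
def lCounit : 𝓤.LDual →ₗ[k] A where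
  toFun φ := φ.val 1
  map_add' _ _ := rfl
  map_smul' _ _ := rfl

lemma lMul_val_contr (φ φ' : 𝓤.LDual) (u : U) :
    (φ * φ').val u = φ'.val (𝓤.lContr φ (𝓤.Δ u)) := rfl

lemma lContr_mul_left (φ : 𝓤.LDual) (p : U ⊗[k] U) (v : U) :
    𝓤.lContr φ (balMk _ _ (p * (v ⊗ₜ[k] 1))) = 𝓤.lContr φ (balMk _ _ p) * v := by
  induction p using TensorProduct.induction_on with
  | zero => simp
  | add x y hx hy => simp only [map_add, add_mul, hx, hy]
  | tmul a b =>
    rw [Algebra.TensorProduct.tmul_mul_tmul, lContr_tmul, lContr_tmul, mul_one, mul_assoc]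

lemma lContr_comul_mul_s (φ : 𝓤.LDual) (u : U) (a : A) :
    𝓤.lContr φ (𝓤.Δ (u * 𝓤.s a)) = 𝓤.lContr φ (𝓤.Δ u) * 𝓤.s a := by
  obtain ⟨p, hp⟩ := 𝓤.exists_rep u
  rw [𝓤.comul_mul_s a hp, lContr_mul_left, hp]

lemma lContr_takeuchi (φ : 𝓤.LDual) (u : U) (p : U ⊗[k] U) (hp : balMk _ _ p = 𝓤.Δ u)
    (a : A) (v : U) :
    𝓤.lContr φ (balMk _ _ (p * (v ⊗ₜ[k] 𝓤.s a))) =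
      𝓤.lContr φ (𝓤.Δ u) * (𝓤.t (op a) * v) := by
  have h1 : v ⊗ₜ[k] 𝓤.s a = ((1 : U) ⊗ₜ[k] 𝓤.s a) * (v ⊗ₜ[k] (1 : U)) := by simp
  rw [h1, ← mul_assoc, lContr_mul_left, ← 𝓤.takeuchi a u p hp, lContr_mul_left, hp, mul_assoc]

lemma lPair_sum {n : ℕ} (φ ψ : Fin n → 𝓤.LDual) (u v : U) :
    𝓤.lPair u v (balMk _ _ (∑ i, φ i ⊗ₜ[k] ψ i)) =
      ∑ i, (ψ i).val (u * 𝓤.s ((φ i).val v)) := by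
  rw [lPair, map_sum, map_sum, lVal_sum]
  exact Finset.sum_congr rfl fun i _ => 𝓤.lPair_tmul u v _ _

lemma lContr_comul_mul {n : ℕ} (g : 𝓤.LDual) (φ ψ : Fin n → 𝓤.LDual)
    (h : ∀ u v, ∑ i, (ψ i).val (u * 𝓤.s ((φ i).val v)) = g.val (u * v)) (u v : U) :
    𝓤.lContr g (𝓤.Δ (u * v)) =
      ∑ i, 𝓤.lContr (ψ i) (𝓤.Δ u) * 𝓤.lContr (φ i) (𝓤.Δ v) := by
  obtain ⟨p, hp⟩ := 𝓤.exists_rep u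
  obtain ⟨q, hq⟩ := 𝓤.exists_rep v
  rw [𝓤.comul_mul u v p q hp hq, ← hq]
  clear hq
  induction q using TensorProduct.induction_on with
  | zero => simp
  | add x y hx hy => simp only [map_add, mul_add, hx, hy, Finset.sum_add_distrib]
  | tmul q₁ q₂ =>
    simp only [lContr_tmul, ← 𝓤.lContr_takeuchi _ u p hp]
    clear hp
    induction p using TensorProduct.induction_on with
    | zero => simp
    | add x y hx hy => simp only [map_add, add_mul, hx, hy, Finset.sum_add_distrib]
    | tmul p₁ p₂ =>
      simp only [Algebra.TensorProduct.tmul_mul_tmul, lContr_tmul, ← h, Finset.op_sum, map_sum,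
        Finset.sum_mul]

lemma lComul_mul (h : 𝓤.LeftFGProjective) {g l : 𝓤.LDual} {x y : 𝓤.LDual ⊗[k] 𝓤.LDual}
    (hx : balMk _ _ x = 𝓤.lΔ h g) (hy : balMk _ _ y = 𝓤.lΔ h l) (u v : U) :
    (g * l).val (u * v) = 𝓤.lPair u v (balMk _ _ (x * y)) := by
  obtain ⟨n, φ, ψ, rfl⟩ := TensorProduct.exists_sum_tmul_eq x
  obtain ⟨m, φ', ψ', rfl⟩ := TensorProduct.exists_sum_tmul_eq y
  have hx' : ∀ a b, ∑ i, (ψ i).val (a * 𝓤.s ((φ i).val b)) = g.val (a * b) := fun a b => by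
    rw [← lPair_sum, hx, lPair_lΔ]
  have hy' : ∀ a b, ∑ i, (ψ' i).val (a * 𝓤.s ((φ' i).val b)) = l.val (a * b) :=
    fun a b => by rw [← lPair_sum, hy, lPair_lΔ]
  rw [lMul_val_contr, 𝓤.lContr_comul_mul g φ ψ hx', map_sum, Finset.sum_mul, map_sum, lPair,
    map_sum, lVal_sum]
  refine Finset.sum_congr rfl fun i _ => ?_
  rw [← hy', Finset.mul_sum, map_sum, map_sum, lVal_sum]
  refine Finset.sum_congr rfl fun j _ => ?_
  rw [Algebra.TensorProduct.tmul_mul_tmul, lEval_tmul, mul_lT_val, lMul_val_contr,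
    lContr_comul_mul_s, lMul_val_contr]

lemma lPair_assocL (h : 𝓤.LeftFGProjective) (x : 𝓤.LDual ⊗[k] 𝓤.LDual) (u v w : U) :
    𝓤.lPair u v (𝓤.lEval₃ w (balAssocL _ _ (mulR k 𝓤.lS) (mulR k fun a => 𝓤.lT (op a))
      (LinearMap.rTensor 𝓤.LDual (𝓤.lΔ h) x))) = 𝓤.lPair u (v * w) (balMk _ _ x) := by
  induction x using TensorProduct.induction_on with
  | zero => simp [lPair]
  | add x y hx hy => simp only [map_add, lPair_add, hx, hy]
  | tmul φ ψ =>
    rw [LinearMap.rTensor_tmul, lEval₃_assocL, lPair_tmul, lPair_tmul, lEval_lΔ, lShift_val]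

lemma lPair_assocR (h : 𝓤.LeftFGProjective) (x : 𝓤.LDual ⊗[k] 𝓤.LDual) (u v w : U) :
    𝓤.lPair u v (𝓤.lEval₃ w (balAssocR (mulR k 𝓤.lS) (mulR k fun a => 𝓤.lT (op a)) _ _
      (LinearMap.lTensor 𝓤.LDual (𝓤.lΔ h) x))) = 𝓤.lPair (u * v) w (balMk _ _ x) := by
  induction x using TensorProduct.induction_on with
  | zero => simp [lPair]
  | add x y hx hy => simp only [map_add, lPair_add, hx, hy]
  | tmul φ ψ =>
    obtain ⟨z, hz⟩ := Submodule.mkQ_surjective _ (𝓤.lΔ h ψ)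
    rw [LinearMap.lTensor_tmul, lPair_tmul, mul_assoc, ← 𝓤.lPair_lΔ h, ← hz]
    clear hz
    induction z using TensorProduct.induction_on with
    | zero => simp [lPair]
    | add x y hx hy =>
      simp only [map_add, TensorProduct.tmul_add, lPair_add, hx, hy]
    | tmul ψ₁ ψ₂ =>
      change 𝓤.lPair u v (balMk _ _ ((ψ₁ * 𝓤.lT (op (φ.val w))) ⊗ₜ[k] ψ₂)) = _
      rw [lPair_tmul, mul_lT_val]
      exact (𝓤.lPair_tmul _ _ _ _).symm

/-- The left dual `U_*` as a right bialgebroid. -/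
noncomputable def leftDual (h : 𝓤.LeftFGProjective) : RightBialgebroid k A 𝓤.LDual where
  s := 𝓤.lS
  t := 𝓤.lT
  Δ := 𝓤.lΔ h
  counit := 𝓤.lCounit
  s_mul_t := 𝓤.lS_mul_lT
  comul_bimod a b g x hx := 𝓤.lSq_ext h fun u v => by
    have h1 := 𝓤.lPair_lΔ h u (v * 𝓤.s a) g
    obtain ⟨n, φ, ψ, rfl⟩ := TensorProduct.exists_sum_tmul_eq x
    rw [lPair_lΔ, mul_lS_val, mul_lT_val, mul_assoc, ← h1, ← hx, lPair_sum, Finset.sum_mul,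
      Finset.sum_mul]
    simp only [Algebra.TensorProduct.tmul_mul_tmul]
    rw [lPair_sum]
    simp only [mul_lS_val, mul_lT_val]
  counit_bimod a b g := by
    change (g * 𝓤.lT (op a) * 𝓤.lS b).val 1 = a * g.val 1 * b
    rw [mul_lS_val, mul_lT_val, one_mul, ← g.val_s, mul_one]
  coassoc g x y hx hy := 𝓤.lCube_ext h fun u v w => by
    rw [lPair_assocL, lPair_assocR, hx, hy, lPair_lΔ, lPair_lΔ, mul_assoc]
  counit_left g x hx := LDual.ext fun u => by
    conv_rhs => rw [← mul_one u, ← 𝓤.lPair_lΔ h, ← hx]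
    obtain ⟨n, φ, ψ, rfl⟩ := TensorProduct.exists_sum_tmul_eq x
    rw [lPair_sum, map_sum, map_sum, map_sum, lVal_sum]
    refine Finset.sum_congr rfl fun i _ => ?_
    change (ψ i * 𝓤.lT (op ((φ i).val 1))).val u = _
    rw [mul_lT_val]
  counit_right g x hx := LDual.ext fun u => by
    conv_rhs => rw [← one_mul u, ← 𝓤.lPair_lΔ h, ← hx]
    obtain ⟨n, φ, ψ, rfl⟩ := TensorProduct.exists_sum_tmul_eq x
    rw [lPair_sum, map_sum, map_sum, lVal_sum]
    refine Finset.sum_congr rfl fun i _ => ?_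
    change (φ i * 𝓤.lS ((ψ i).val 1)).val u = _
    rw [mul_lS_val, one_mul, ← mul_one (𝓤.s _), (ψ i).val_s]
  takeuchi a g x hx := 𝓤.lSq_ext h fun u v => by
    have h1 := (𝓤.lPair_lΔ h (u * 𝓤.t (op a)) v g).trans
      ((congrArg g.val (mul_assoc u (𝓤.t (op a)) v)).trans
        (𝓤.lPair_lΔ h u (𝓤.t (op a) * v) g).symm)
    rw [← hx] at h1
    obtain ⟨n, φ, ψ, rfl⟩ := TensorProduct.exists_sum_tmul_eq x
    rw [lPair_sum, lPair_sum] at h1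
    rw [Finset.mul_sum, Finset.mul_sum]
    simp only [Algebra.TensorProduct.tmul_mul_tmul]
    rw [lPair_sum, lPair_sum]
    simp only [lS_mul_val, lT_mul_val, one_mul, ← h1]
    simp only [mul_assoc, 𝓤.s_mul_t]
  comul_one := 𝓤.lSq_ext h fun u v => by
    rw [lPair_lΔ, lPair_tmul]
    exact 𝓤.counit_mul_s u v
  comul_mul g l x y hx hy := 𝓤.lSq_ext h fun u v => by
    rw [lPair_lΔ, 𝓤.lComul_mul h hx hy]
  counit_one := 𝓤.counit_one
  counit_mul_s g l := by
    change (g * l).val 1 = (𝓤.lS (g.val 1) * l).val 1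
    rw [lMul_val_contr, 𝓤.comul_one, lContr_tmul, lS_mul_val]
  counit_mul_t g l := by
    change (g * l).val 1 = (𝓤.lT (op (g.val 1)) * l).val 1
    rw [lMul_val_contr, 𝓤.comul_one, lContr_tmul, lT_mul_val, mul_one, one_mul]

end LeftDual

end LeftBialgebroid

namespace LeftBialgebroid

variable {k A U A' U' : Type*} [CommRing k] [Ring A] [Algebra k A] [Ring U] [Algebra k U]
  [Ring A'] [Algebra k A'] [Ring U'] [Algebra k U'] (𝓤 : LeftBialgebroid k A U)

/-- `▶U ⊗_{A^op} U_◁`, the domain of the Hopf-Galois map. -/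
abbrev GaloisSq : Type _ :=
  BalTensor (mulR k fun a => 𝓤.t (op a)) (mulL k fun a => 𝓤.t (op a))

/-- The map `u ⊗ w ↦ u ⊗ w v` on `U_◁ ⊗_A ▷U`. -/
def sqMulRight (v : U) : 𝓤.Sq →ₗ[k] 𝓤.Sq :=
  Submodule.mapQ _ _ (LinearMap.lTensor U (LinearMap.mulRight k v)) (by
    rw [balRel, Submodule.span_le]
    rintro _ ⟨a, m, n, rfl⟩
    exact Submodule.subset_span ⟨a, m, n * v, by simp [mul_assoc]⟩)

lemma sqMulRight_mk (v : U) (x : U ⊗[k] U) : 𝓤.sqMulRight v (balMk _ _ x) =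
    balMk _ _ (LinearMap.lTensor U (LinearMap.mulRight k v) x) := rfl

/-- The map `u ⊗ w ↦ s(a) u ⊗ w` on `U_◁ ⊗_A ▷U`. -/
def sqSMul (a : A) : 𝓤.Sq →ₗ[k] 𝓤.Sq :=
  Submodule.mapQ _ _ (LinearMap.mulLeft k (𝓤.s a ⊗ₜ[k] (1 : U))) (by
    rw [balRel, Submodule.span_le]
    rintro _ ⟨b, m, n, rfl⟩
    refine Submodule.subset_span ⟨b, 𝓤.s a * m, n, ?_⟩
    simp [mul_sub, ← mul_assoc, 𝓤.s_mul_t])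

lemma sqSMul_mk (a : A) (x : U ⊗[k] U) :
    𝓤.sqSMul a (balMk _ _ x) = balMk _ _ ((𝓤.s a ⊗ₜ[k] 1) * x) := rfl

lemma balLift_tmul {M N P R : Type*} [AddCommGroup M] [AddCommGroup N] [AddCommGroup P]
    [Module k M] [Module k N] [Module k P] (r : R → Module.End k M) (l : R → Module.End k N)
    (f : M →ₗ[k] N →ₗ[k] P) (hf : ∀ a m n, f (r a m) n = f m (l a n)) (m : M) (n : N) :
    balLift r l f hf (balMk r l (m ⊗ₜ[k] n)) = f m n := rfl

/-- The bilinear map `(u, v) ↦ u₁ ⊗ u₂ v`. -/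
def galoisBil : U →ₗ[k] U →ₗ[k] 𝓤.Sq :=
  LinearMap.mk₂ k (fun u v => 𝓤.sqMulRight v (𝓤.Δ u))
    (by intros; rw [map_add, map_add]) (by intros; rw [map_smul, map_smul])
    (by intro u v w
        obtain ⟨x, hx⟩ := 𝓤.exists_rep u
        have h : LinearMap.mulRight k (v + w) = LinearMap.mulRight k v + LinearMap.mulRight k w :=
          LinearMap.ext fun y => mul_add y v w
        rw [← hx, sqMulRight_mk, sqMulRight_mk, sqMulRight_mk, h, LinearMap.lTensor_add,
          LinearMap.add_apply, map_add])
    (by intro c u v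
        obtain ⟨x, hx⟩ := 𝓤.exists_rep u
        have h : LinearMap.mulRight k (c • v) = c • LinearMap.mulRight k v :=
          LinearMap.ext fun y => mul_smul_comm c y v
        rw [← hx, sqMulRight_mk, sqMulRight_mk, h, LinearMap.lTensor_smul,
          LinearMap.smul_apply, map_smul])

lemma galoisBil_apply (u v : U) : 𝓤.galoisBil u v = 𝓤.sqMulRight v (𝓤.Δ u) :=
  LinearMap.mk₂_apply ..

lemma galoisBil_bal (a : A) (u v : U) :
    𝓤.galoisBil (mulR k (fun a => 𝓤.t (op a)) a u) v =
      𝓤.galoisBil u (mulL k (fun a => 𝓤.t (op a)) a v) := by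
  obtain ⟨x, hx⟩ := 𝓤.exists_rep u
  rw [galoisBil_apply, galoisBil_apply, LinearMap.mulLeft_apply, LinearMap.mulRight_apply,
    𝓤.comul_mul_t a hx, ← hx, sqMulRight_mk, sqMulRight_mk]
  congr 1
  clear hx
  induction x using TensorProduct.induction_on with
  | zero => simp
  | add x y hx hy => simp only [map_add, add_mul, hx, hy]
  | tmul p q => simp [mul_assoc]

/-- The Hopf-Galois map `α_ℓ : ▶U ⊗_{A^op} U_◁ → U_◁ ⊗_A ▷U`, `u ⊗ v ↦ u₁ ⊗ u₂ v`. -/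
def hopfGalois : 𝓤.GaloisSq →ₗ[k] 𝓤.Sq := balLift _ _ 𝓤.galoisBil 𝓤.galoisBil_bal

lemma hopfGalois_tmul (u v : U) :
    𝓤.hopfGalois (balMk _ _ (u ⊗ₜ[k] v)) = 𝓤.sqMulRight v (𝓤.Δ u) := by
  rw [hopfGalois, balLift_tmul, galoisBil_apply]

/-- A left bialgebroid is a left Hopf algebroid if `α_ℓ` is bijective. -/
def IsLeftHopf : Prop := Function.Bijective 𝓤.hopfGalois

variable {𝓤}

/-- The translation map `u ↦ u₊ ⊗ u₋ = α_ℓ⁻¹(u ⊗ 1)`. -/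
noncomputable def IsLeftHopf.translation (h : 𝓤.IsLeftHopf) : U →ₗ[k] 𝓤.GaloisSq :=
  (LinearEquiv.ofBijective 𝓤.hopfGalois h).symm.toLinearMap ∘ₗ
    balMk _ _ ∘ₗ (TensorProduct.mk k U U).flip 1

lemma IsLeftHopf.hopfGalois_translation (h : 𝓤.IsLeftHopf) (u : U) :
    𝓤.hopfGalois (h.translation u) = balMk _ _ (u ⊗ₜ[k] 1) :=
  (LinearEquiv.ofBijective 𝓤.hopfGalois h).apply_symm_apply _

variable (𝓤) in
/-- The map `u ⊗ v ↦ ε(u t(φ(v)))`. -/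
def evalS (φ : 𝓤.RDual) : 𝓤.GaloisSq →ₗ[k] A :=
  balLift _ _ (LinearMap.mk₂ k (fun u v => 𝓤.ε (u * 𝓤.t (op (φ.val v))))
    (by intros; simp [add_mul]) (by intros; simp)
    (by intros; simp [mul_add]) (by intros; simp))
    (by intro a u v; simp [φ.val_t, mul_assoc])

lemma evalS_tmul (φ : 𝓤.RDual) (u v : U) :
    𝓤.evalS φ (balMk _ _ (u ⊗ₜ[k] v)) = 𝓤.ε (u * 𝓤.t (op (φ.val v))) := rfl

lemma IsLeftHopf.evalS_s_mul (h : 𝓤.IsLeftHopf) (φ : 𝓤.RDual) (a : A) (u : U) :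
    𝓤.evalS φ (h.translation (𝓤.s a * u)) = a * 𝓤.evalS φ (h.translation u) := by
  obtain ⟨y, hy⟩ := Submodule.mkQ_surjective _ (h.translation u)
  have key : ∀ y : U ⊗[k] U, 𝓤.hopfGalois (balMk _ _ ((𝓤.s a ⊗ₜ[k] 1) * y)) =
      𝓤.sqSMul a (𝓤.hopfGalois (balMk _ _ y)) := fun y => by
    induction y using TensorProduct.induction_on with
    | zero => simp
    | add x y hx hy => simp only [map_add, mul_add, hx, hy]
    | tmul p q =>
      obtain ⟨x, hx⟩ := 𝓤.exists_rep p
      rw [Algebra.TensorProduct.tmul_mul_tmul, one_mul, hopfGalois_tmul, hopfGalois_tmul,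
        𝓤.comul_s_mul a hx, ← hx, sqMulRight_mk, sqMulRight_mk, sqSMul_mk]
      congr 1
      clear hx
      induction x using TensorProduct.induction_on with
      | zero => simp
      | add x y hx hy => simp only [map_add, mul_add, hx, hy]
      | tmul p q => simp
  have h1 : h.translation (𝓤.s a * u) = balMk _ _ ((𝓤.s a ⊗ₜ[k] 1) * y) := by
    apply h.1
    rw [key, hopfGalois_translation, balMk, hy, hopfGalois_translation, sqSMul_mk,
      Algebra.TensorProduct.tmul_mul_tmul, one_mul]
  rw [h1, ← hy]
  clear h1 hy
  induction y using TensorProduct.induction_on with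
  | zero => simp
  | add x y hx hy => simp only [map_add, mul_add, hx, hy]
  | tmul p q =>
    rw [Algebra.TensorProduct.tmul_mul_tmul, one_mul, evalS_tmul, evalS_tmul, mul_assoc,
      counit_s_mul]

/-- The map `S^* : U^* → U_*` of a left Hopf algebroid, `S^*(φ)(u) = ε(u₊ t(φ(u₋)))`. -/
noncomputable def IsLeftHopf.dualS (h : 𝓤.IsLeftHopf) : 𝓤.RDual →ₗ[k] 𝓤.LDual where
  toFun φ := ⟨𝓤.evalS φ ∘ₗ h.translation, fun a u => h.evalS_s_mul φ a u⟩
  map_add' φ ψ := LDual.ext fun u => by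
    change 𝓤.evalS (φ + ψ) (h.translation u) =
      𝓤.evalS φ (h.translation u) + 𝓤.evalS ψ (h.translation u)
    obtain ⟨y, hy⟩ := Submodule.mkQ_surjective _ (h.translation u)
    rw [← hy]
    clear hy
    induction y using TensorProduct.induction_on with
    | zero => simp
    | add x y hx hy => simp only [map_add, hx, hy]; abel
    | tmul p q => simp only [evalS_tmul, RDual.val_add, LinearMap.add_apply, op_add, map_add,
        mul_add]
  map_smul' c φ := LDual.ext fun u => by
    change 𝓤.evalS (c • φ) (h.translation u) = c • 𝓤.evalS φ (h.translation u)
    obtain ⟨y, hy⟩ := Submodule.mkQ_surjective _ (h.translation u)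
    rw [← hy]
    clear hy
    induction y using TensorProduct.induction_on with
    | zero => simp
    | add x y hx hy => simp only [map_add, hx, hy, smul_add]
    | tmul p q => simp only [evalS_tmul, RDual.val_smul, LinearMap.smul_apply, op_smul, map_smul,
        mul_smul_comm]

variable {𝓥 : LeftBialgebroid k A' U'} {F : U →ₗ[k] U'} {f : A ≃ₐ[k] A'}

/-- The transpose `V^* → U^*`, `φ ↦ f⁻¹ ∘ φ ∘ F`, of a morphism `(F, f) : U → V` of left
bialgebroids with `f` bijective. -/
def IsHom.transposeR (hF : 𝓤.IsHom 𝓥 F (f : A →ₐ[k] A')) : 𝓥.RDual →ₗ[k] 𝓤.RDual where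
  toFun φ := ⟨f.symm.toLinearMap ∘ₗ φ.val ∘ₗ F, fun a u => by
    simp [hF.map_mul, hF.map_t, φ.val_t]⟩
  map_add' φ ψ := RDual.ext fun u => map_add f.symm (φ.val (F u)) (ψ.val (F u))
  map_smul' c φ := RDual.ext fun u => map_smul f.symm c (φ.val (F u))

/-- The transpose `V_* → U_*`, `ψ ↦ f⁻¹ ∘ ψ ∘ F`, of a morphism `(F, f) : U → V` of left
bialgebroids with `f` bijective. -/
def IsHom.transposeL (hF : 𝓤.IsHom 𝓥 F (f : A →ₐ[k] A')) : 𝓥.LDual →ₗ[k] 𝓤.LDual where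
  toFun φ := ⟨f.symm.toLinearMap ∘ₗ φ.val ∘ₗ F, fun a u => by
    simp [hF.map_mul, hF.map_s, φ.val_s]⟩
  map_add' φ ψ := LDual.ext fun u => map_add f.symm (φ.val (F u)) (ψ.val (F u))
  map_smul' c φ := LDual.ext fun u => map_smul f.symm c (φ.val (F u))

end LeftBialgebroid

/-- A full Hopf algebroid: a left bialgebroid structure over `A` and a right bialgebroid structure
over `B` on the same `k`-algebra `H`, together with an antipode `S`. -/
structure HopfAlgebroid (k A B H : Type*) [CommRing k] [Ring A] [Algebra k A] [Ring B]
    [Algebra k B] [Ring H] [Algebra k H] where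
  /-- `H^ℓ` -/
  left : LeftBialgebroid k A H
  /-- `H^r` -/
  right : RightBialgebroid k B H
  /-- the antipode -/
  S : H →ₗ[k] H
  s_counit_t : ∀ b, left.s (left.ε (right.t (op b))) = right.t (op b)
  t_counit_s : ∀ b, left.t (op (left.ε (right.s b))) = right.s b
  s_counit_t' : ∀ a, right.s (right.counit (left.t (op a))) = left.t (op a)
  t_counit_s' : ∀ a, right.t (op (right.counit (left.s a))) = left.s a
  /-- `(Δ_ℓ ⊗_B id) Δ_r = (id ⊗_A Δ_r) Δ_ℓ` -/
  coassoc_lr : ∀ h x y, balMk _ _ x = right.Δ h → balMk _ _ y = left.Δ h →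
    balAssocL _ _ (mulR k right.s) (mulR k fun b => right.t (op b))
        (LinearMap.rTensor H left.Δ x) =
      balAssocR (mulL k fun a => left.t (op a)) (mulL k left.s) _ _
        (LinearMap.lTensor H right.Δ y)
  /-- `(Δ_r ⊗_A id) Δ_ℓ = (id ⊗_B Δ_ℓ) Δ_r` -/
  coassoc_rl : ∀ h x y, balMk _ _ x = left.Δ h → balMk _ _ y = right.Δ h →
    balAssocL _ _ (mulL k fun a => left.t (op a)) (mulL k left.s)
        (LinearMap.rTensor H right.Δ x) =
      balAssocR (mulR k right.s) (mulR k fun b => right.t (op b)) _ _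
        (LinearMap.lTensor H left.Δ y)
  antipode_bimod : ∀ a b h,
    S (left.t (op a) * h * right.t (op b)) = right.s b * S h * left.s a
  /-- `S(h₍₁₎) h₍₂₎ = s^r(∂(h))` -/
  antipode_left : ∀ h x, balMk _ _ x = left.Δ h →
    LinearMap.mul' k H (TensorProduct.map S LinearMap.id x) = right.s (right.counit h)
  /-- `h⁽¹⁾ S(h⁽²⁾) = s^ℓ(ε(h))` -/
  antipode_right : ∀ h x, balMk _ _ x = right.Δ h →
    LinearMap.mul' k H (TensorProduct.map LinearMap.id S x) = left.s (left.ε h)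

namespace HopfAlgebroid

variable {k A B H : Type*} [CommRing k] [Ring A] [Algebra k A] [Ring B] [Algebra k B] [Ring H]
  [Algebra k H] (𝓗 : HopfAlgebroid k A B H)

lemma right_counit_t (b : B) : 𝓗.right.counit (𝓗.right.t (op b)) = b := by
  simpa [𝓗.right.counit_one] using 𝓗.right.counit_bimod b 1 1

/-- The isomorphism `ν = ∂ s^ℓ : A → B^op`, with inverse `ε t^r`. -/
def nu : A ≃ₐ[k] Bᵐᵒᵖ :=
  AlgEquiv.ofLinearEquiv
    { toFun := fun a => op (𝓗.right.counit (𝓗.left.s a))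
      map_add' := fun a b => by simp
      map_smul' := fun c a => by simp
      invFun := fun b => 𝓗.left.ε (𝓗.right.t b)
      left_inv := fun a => by
        change 𝓗.left.ε (𝓗.right.t (op (𝓗.right.counit (𝓗.left.s a)))) = a
        rw [𝓗.t_counit_s', 𝓗.left.counit_s]
      right_inv := fun b => by
        change op (𝓗.right.counit (𝓗.left.s (𝓗.left.ε (𝓗.right.t b)))) = b
        rw [← op_unop b, 𝓗.s_counit_t, 𝓗.right_counit_t] }
    (by
      change op (𝓗.right.counit (𝓗.left.s 1)) = 1
      rw [map_one, 𝓗.right.counit_one, op_one])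
    (fun a b => by
      change op (𝓗.right.counit (𝓗.left.s (a * b))) =
        op (𝓗.right.counit (𝓗.left.s a)) * op (𝓗.right.counit (𝓗.left.s b))
      rw [← op_mul, ← 𝓗.right_counit_t (_ * _), op_mul, map_mul 𝓗.right.t, 𝓗.t_counit_s',
        𝓗.t_counit_s', map_mul])

/-- The antipode as a map `H → H^op`. -/
def antipodeOp : H →ₗ[k] Hᵐᵒᵖ := (opLinearEquiv k).toLinearMap ∘ₗ 𝓗.S

end HopfAlgebroid

section BalancedSum

variable {k : Type*} [CommRing k] {M N P Q Q' : Type*} [AddCommGroup M] [AddCommGroup N]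
  [AddCommGroup P] [AddCommGroup Q] [AddCommGroup Q'] [Module k M] [Module k N] [Module k P]
  {A B : Type*}

/-- `f` is biadditive, and balanced over `k` and over `A`. -/
structure IsBal (r : A → Module.End k M) (l : A → Module.End k N) (f : M → N → Q) : Prop where
  add_left : ∀ m m' n, f (m + m') n = f m n + f m' n
  add_right : ∀ m n n', f m (n + n') = f m n + f m n'
  smul : ∀ (c : k) m n, f (c • m) n = f m (c • n)
  bal : ∀ a m n, f (r a m) n = f m (l a n)

variable {r : A → Module.End k M} {l : A → Module.End k N}

namespace IsBal

variable {f : M → N → Q}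

/-- The additive map on `M ⊗_k N` induced by a balanced map. -/
noncomputable def liftK (hf : IsBal r l f) : (M ⊗[k] N) →+ Q :=
  TensorProduct.liftAddHom (AddMonoidHom.mk' (fun m => AddMonoidHom.mk' (f m) (hf.add_right m))
    fun m m' => AddMonoidHom.ext fun n => hf.add_left m m' n) hf.smul

lemma liftK_tmul (hf : IsBal r l f) (m : M) (n : N) : hf.liftK (m ⊗ₜ n) = f m n := rfl

lemma liftK_rel (hf : IsBal r l f) {x : M ⊗[k] N} (hx : x ∈ balRel r l) : hf.liftK x = 0 := by
  suffices h : ∀ c : k, hf.liftK (c • x) = 0 by simpa using h 1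
  induction hx using Submodule.span_induction with
  | zero => simp
  | add x y _ _ hx hy => intro c; rw [smul_add, map_add, hx, hy, add_zero]
  | smul d x _ hx => intro c; rw [smul_smul]; exact hx _
  | mem x hx =>
    obtain ⟨a, m, n, rfl⟩ := hx
    intro c
    rw [smul_sub, map_sub, TensorProduct.smul_tmul', TensorProduct.smul_tmul', liftK_tmul,
      liftK_tmul, ← map_smul, hf.bal, sub_self]

/-- The additive map on `M ⊗_A N` induced by a balanced map. -/
noncomputable def lift (hf : IsBal r l f) : BalTensor r l →+ Q :=
  QuotientAddGroup.lift (balRel r l).toAddSubgroup hf.liftK fun _ hx => hf.liftK_rel hx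

lemma lift_tmul (hf : IsBal r l f) (m : M) (n : N) :
    hf.lift (balMk r l (m ⊗ₜ n)) = f m n := rfl

end IsBal

lemma exists_balRep (z : BalTensor r l) : ∃ (n : ℕ) (m : Fin n → M) (m' : Fin n → N),
    balMk r l (∑ i, m i ⊗ₜ m' i) = z := by
  obtain ⟨x, rfl⟩ := Submodule.mkQ_surjective _ z
  obtain ⟨n, m, m', rfl⟩ := TensorProduct.exists_sum_tmul_eq x
  exact ⟨n, m, m', rfl⟩

/-- The length of a chosen representative of `z`. -/
noncomputable def balN (z : BalTensor r l) : ℕ := (exists_balRep z).choose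

/-- The left tensor factors of a chosen representative of `z`. -/
noncomputable def balFst (z : BalTensor r l) : Fin (balN z) → M :=
  (exists_balRep z).choose_spec.choose

/-- The right tensor factors of a chosen representative of `z`. -/
noncomputable def balSnd (z : BalTensor r l) : Fin (balN z) → N :=
  (exists_balRep z).choose_spec.choose_spec.choose

lemma balRep_spec (z : BalTensor r l) : balMk r l (∑ i, balFst z i ⊗ₜ balSnd z i) = z :=
  (exists_balRep z).choose_spec.choose_spec.choose_spec

/-- `∑ f(z₁, z₂)`, for a chosen representative `∑ z₁ ⊗ z₂` of `z ∈ M ⊗_A N`. -/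
noncomputable def balSum (z : BalTensor r l) (f : M → N → Q) : Q :=
  ∑ i, f (balFst z i) (balSnd z i)

lemma IsBal.balSum_eq {f : M → N → Q} (hf : IsBal r l f) (z : BalTensor r l) :
    balSum z f = hf.lift z := by
  conv_rhs => rw [← balRep_spec z, map_sum, map_sum]
  rfl

lemma IsBal.balSum_tmul {f : M → N → Q} (hf : IsBal r l f) (m : M) (n : N) :
    balSum (balMk r l (m ⊗ₜ n)) f = f m n := hf.balSum_eq _

lemma IsBal.balSum_add {f : M → N → Q} (hf : IsBal r l f) (z z' : BalTensor r l) :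
    balSum (z + z') f = balSum z f + balSum z' f := by
  simp only [hf.balSum_eq, map_add]

lemma IsBal.balSum_rep {f : M → N → Q} (hf : IsBal r l f) {n : ℕ} {m : Fin n → M}
    {m' : Fin n → N} {z : BalTensor r l} (h : balMk r l (∑ i, m i ⊗ₜ m' i) = z) :
    balSum z f = ∑ i, f (m i) (m' i) := by
  rw [hf.balSum_eq, ← h, map_sum, map_sum]
  rfl

lemma map_balSum {F : Type*} [FunLike F Q Q'] [AddMonoidHomClass F Q Q'] (g : F)
    (z : BalTensor r l) (f : M → N → Q) :
    g (balSum z f) = balSum z fun m n => g (f m n) := map_sum g _ _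

lemma balSum_congr {z : BalTensor r l} {f g : M → N → Q} (h : ∀ m n, f m n = g m n) :
    balSum z f = balSum z g := Finset.sum_congr rfl fun _ _ => h _ _

lemma balSum_fun_add (z : BalTensor r l) (f g : M → N → Q) :
    (balSum z fun m n => f m n + g m n) = balSum z f + balSum z g := Finset.sum_add_distrib

lemma balSum_mul {R : Type*} [Ring R] (z : BalTensor r l) (f : M → N → R) (x : R) :
    balSum z f * x = balSum z fun m n => f m n * x := Finset.sum_mul _ _ _

lemma mul_balSum {R : Type*} [Ring R] (z : BalTensor r l) (f : M → N → R) (x : R) :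
    x * balSum z f = balSum z fun m n => x * f m n := Finset.mul_sum _ _ _

lemma balSum_comm {M' N' : Type*} [AddCommGroup M'] [AddCommGroup N'] [Module k M'] [Module k N']
    {r' : B → Module.End k M'} {l' : B → Module.End k N'} (z : BalTensor r l)
    (z' : BalTensor r' l') (f : M → N → M' → N' → Q) :
    (balSum z fun m n => balSum z' fun m' n' => f m n m' n') =
      balSum z' fun m' n' => balSum z fun m n => f m n m' n' := Finset.sum_comm

lemma sum_balSum {ι : Type*} (t : Finset ι) (z : BalTensor r l) (f : ι → M → N → Q) :
    ∑ i ∈ t, balSum z (f i) = balSum z fun m n => ∑ i ∈ t, f i m n := Finset.sum_comm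

lemma balSum_balMk (z : BalTensor r l) : (balSum z fun m n => balMk r l (m ⊗ₜ n)) = z := by
  conv_rhs => rw [← balRep_spec z, map_sum]
  rfl

lemma isBal_balMk : IsBal r l fun m n => balMk r l (m ⊗ₜ n) where
  add_left m m' n := by rw [TensorProduct.add_tmul, map_add]
  add_right m n n' := by rw [TensorProduct.tmul_add, map_add]
  smul c m n := by rw [TensorProduct.smul_tmul]
  bal := balMk_rel r l

lemma balTensor_induction {C : BalTensor r l → Prop} (y : BalTensor r l) (h0 : C 0)
    (h1 : ∀ m n, C (balMk r l (m ⊗ₜ n))) (h2 : ∀ x y, C x → C y → C (x + y)) : C y := by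
  obtain ⟨y, rfl⟩ := Submodule.mkQ_surjective _ y
  induction y using TensorProduct.induction_on with
  | zero => rwa [map_zero]
  | add x y hx hy => rw [map_add]; exact h2 _ _ hx hy
  | tmul m n => exact h1 m n

section Triple

variable {r' : B → Module.End k N} {l' : B → Module.End k P} {f : M → N → P → Q}
  (h₁ : ∀ p, IsBal r l fun m n => f m n p) (h₂ : ∀ m, IsBal r' l' (f m))

/-- The additive map on `M ⊗_A N ⊗_B P` induced by a balanced map. -/
noncomputable def IsBal.lift₃ : BalTensor₃ r l r' l' →+ Q :=
  QuotientAddGroup.lift (balRel₃ r l r' l').toAddSubgroup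
    (TensorProduct.liftAddHom (AddMonoidHom.mk' (fun m => (h₂ m).liftK) (fun m m' => by
      ext y
      induction y using TensorProduct.induction_on with
      | zero => simp
      | add x y hx hy => simp only [map_add, hx, hy]
      | tmul n p => exact (h₁ p).add_left m m' n)) (fun c m y => by
      induction y using TensorProduct.induction_on with
      | zero => simp
      | add x y hx hy => simp only [map_add, smul_add, hx, hy]
      | tmul n p => exact (h₁ p).smul c m n)) (by
    intro x hx
    set F := TensorProduct.liftAddHom (R := k) (M := M) (N := N ⊗[k] P) (P := Q) _ _ with hF
    have hFt : ∀ m n p, F (m ⊗ₜ (n ⊗ₜ p)) = f m n p := fun m n p => rfl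
    clear_value F
    suffices h : ∀ c : k, F (c • x) = 0 by simpa using h 1
    change x ∈ balRel₃ r l r' l' at hx
    induction hx using Submodule.span_induction with
    | zero => simp
    | add x y _ _ hx hy => intro c; rw [smul_add, map_add, hx, hy, add_zero]
    | smul d x _ hx => intro c; rw [smul_smul]; exact hx _
    | mem x hx =>
      intro c
      obtain ⟨a, m, n, p, rfl⟩ | ⟨a, m, n, p, rfl⟩ := hx
      · rw [smul_sub, map_sub, TensorProduct.smul_tmul', TensorProduct.smul_tmul', hFt, hFt,
          ← map_smul]
        exact sub_eq_zero.2 ((h₁ p).bal a _ n)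
      · rw [smul_sub, map_sub, TensorProduct.smul_tmul', TensorProduct.smul_tmul', hFt, hFt,
          (h₂ _).bal, sub_self])

lemma IsBal.lift₃_assocL (z : BalTensor r l) (p : P) :
    IsBal.lift₃ h₁ h₂ (balAssocL r l r' l' (z ⊗ₜ p)) = balSum z fun m n => f m n p := by
  rw [(h₁ p).balSum_eq]
  obtain ⟨n, m, m', rfl⟩ := exists_balRep z
  simp only [map_sum, TensorProduct.sum_tmul]
  rfl

lemma IsBal.lift₃_assocR (m : M) (z : BalTensor r' l') :
    IsBal.lift₃ h₁ h₂ (balAssocR r l r' l' (m ⊗ₜ z)) = balSum z (f m) := by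
  rw [(h₂ m).balSum_eq]
  obtain ⟨n, m, m', rfl⟩ := exists_balRep z
  simp only [map_sum, TensorProduct.tmul_sum]
  rfl

end Triple

/-- A coassociativity relation, in Sweedler notation. -/
lemma balSum_assoc {A' B' H : Type*} [AddCommGroup H] [Module k H]
    {r : A → Module.End k M} {l : A → Module.End k N}
    {r' : B → Module.End k N} {l' : B → Module.End k P} {ρ : B' → Module.End k H}
    {lam : B' → Module.End k P} {ρ' : A' → Module.End k M} {lam' : A' → Module.End k H}
    {Δ₁ : H →ₗ[k] BalTensor r l} {Δ₂ : H →ₗ[k] BalTensor r' l'} {z : BalTensor ρ lam}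
    {z' : BalTensor ρ' lam'}
    (h : ∀ x y, balMk _ _ x = z → balMk _ _ y = z' →
      balAssocL r l r' l' (LinearMap.rTensor P Δ₁ x) =
        balAssocR r l r' l' (LinearMap.lTensor M Δ₂ y))
    {f : M → N → P → Q}
    (h₁ : ∀ p, IsBal r l fun m n => f m n p) (h₂ : ∀ m, IsBal r' l' (f m)) :
    (balSum z fun u p => balSum (Δ₁ u) fun m n => f m n p) =
      balSum z' fun m u => balSum (Δ₂ u) (f m) := by
  have h3 := congrArg (IsBal.lift₃ h₁ h₂) (h _ _ (balRep_spec z) (balRep_spec z'))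
  simp only [map_sum, LinearMap.rTensor_tmul, LinearMap.lTensor_tmul, IsBal.lift₃_assocL,
    IsBal.lift₃_assocR] at h3
  exact h3

end BalancedSum

namespace LeftBialgebroid

variable {k A U Q : Type*} [CommRing k] [Ring A] [Algebra k A] [Ring U] [Algebra k U]
  [AddCommGroup Q] (𝓤 : LeftBialgebroid k A U)

/-- `f` is biadditive and factors through `U_◁ ⊗_A ▷U`. -/
abbrev Bal (f : U → U → Q) : Prop := IsBal (mulL k fun a => 𝓤.t (op a)) (mulL k 𝓤.s) f

variable {𝓤}

lemma Bal.mk' {f : U → U → Q} (h1 : ∀ m m' n, f (m + m') n = f m n + f m' n)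
    (h2 : ∀ m n n', f m (n + n') = f m n + f m n')
    (h3 : ∀ a m n, f (𝓤.t (op a) * m) n = f m (𝓤.s a * n)) : 𝓤.Bal f where
  add_left := h1
  add_right := h2
  smul c m n := by
    have h := h3 (algebraMap k A c) m n
    rwa [← MulOpposite.algebraMap_apply, AlgHom.commutes, AlgHom.commutes, ← Algebra.smul_def,
      ← Algebra.smul_def] at h
  bal := h3

lemma balSum_comul_mul {f : U → U → Q} (hf : 𝓤.Bal f) (u v : U) :
    balSum (𝓤.Δ (u * v)) f =
      balSum (𝓤.Δ u) fun a b => balSum (𝓤.Δ v) fun c d => f (a * c) (b * d) := by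
  rw [𝓤.comul_mul u v _ _ (balRep_spec _) (balRep_spec _), hf.balSum_eq, Finset.sum_mul_sum]
  simp only [map_sum, Algebra.TensorProduct.tmul_mul_tmul]
  rfl

lemma balSum_comul_t_mul {f : U → U → Q} (hf : 𝓤.Bal f) (a : A) (u : U) :
    balSum (𝓤.Δ (𝓤.t (op a) * u)) f = balSum (𝓤.Δ u) fun c d => f c (𝓤.t (op a) * d) := by
  rw [𝓤.comul_t_mul a (balRep_spec _), hf.balSum_eq, Finset.mul_sum]
  simp only [map_sum, Algebra.TensorProduct.tmul_mul_tmul, one_mul]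
  rfl

lemma balSum_comul_mul_s {f : U → U → Q} (hf : 𝓤.Bal f) (a : A) (u : U) :
    balSum (𝓤.Δ (u * 𝓤.s a)) f = balSum (𝓤.Δ u) fun c d => f (c * 𝓤.s a) d := by
  rw [𝓤.comul_mul_s a (balRep_spec _), hf.balSum_eq, Finset.sum_mul]
  simp only [map_sum, Algebra.TensorProduct.tmul_mul_tmul, mul_one]
  rfl

lemma balSum_comul_mul_t {f : U → U → Q} (hf : 𝓤.Bal f) (a : A) (u : U) :
    balSum (𝓤.Δ (u * 𝓤.t (op a))) f = balSum (𝓤.Δ u) fun c d => f c (d * 𝓤.t (op a)) := by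
  rw [𝓤.comul_mul_t a (balRep_spec _), hf.balSum_eq, Finset.sum_mul]
  simp only [map_sum, Algebra.TensorProduct.tmul_mul_tmul, mul_one]
  rfl

lemma balSum_takeuchi {f : U → U → Q} (hf : 𝓤.Bal f) (a : A) (u : U) :
    (balSum (𝓤.Δ u) fun c d => f (c * 𝓤.t (op a)) d) =
      balSum (𝓤.Δ u) fun c d => f c (d * 𝓤.s a) := by
  have h := congrArg hf.lift (𝓤.takeuchi a u _ (balRep_spec _))
  simp only [Finset.sum_mul, map_sum, Algebra.TensorProduct.tmul_mul_tmul, mul_one] at h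
  exact h

variable (𝓤) in
lemma balSum_counit_left (u : U) : (balSum (𝓤.Δ u) fun c d => 𝓤.s (𝓤.ε c) * d) = u := by
  have h := 𝓤.counit_left u _ (balRep_spec _)
  simp only [map_sum] at h
  exact h

variable (𝓤) in
lemma balSum_counit_right (u : U) :
    (balSum (𝓤.Δ u) fun c d => 𝓤.t (op (𝓤.ε d)) * c) = u := by
  have h := 𝓤.counit_right u _ (balRep_spec _)
  simp only [map_sum] at h
  exact h

end LeftBialgebroid

namespace RightBialgebroid

variable {k B H Q : Type*} [CommRing k] [Ring B] [Algebra k B] [Ring H] [Algebra k H]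
  [AddCommGroup Q] (𝓗 : RightBialgebroid k B H)

/-- `f` is biadditive and factors through `H_◀ ⊗_B ▶H`. -/
abbrev Bal (f : H → H → Q) : Prop := IsBal (mulR k 𝓗.s) (mulR k fun b => 𝓗.t (op b)) f

variable {𝓗}

lemma Bal.mk' {f : H → H → Q} (h1 : ∀ m m' n, f (m + m') n = f m n + f m' n)
    (h2 : ∀ m n n', f m (n + n') = f m n + f m n')
    (h3 : ∀ b m n, f (m * 𝓗.s b) n = f m (n * 𝓗.t (op b))) : 𝓗.Bal f where
  add_left := h1
  add_right := h2
  smul c m n := by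
    have h := h3 (algebraMap k B c) m n
    rwa [← MulOpposite.algebraMap_apply, AlgHom.commutes, AlgHom.commutes, ← Algebra.commutes,
      ← Algebra.commutes, ← Algebra.smul_def, ← Algebra.smul_def] at h
  bal := h3

lemma balSum_comul_mul {f : H → H → Q} (hf : 𝓗.Bal f) (u v : H) :
    balSum (𝓗.Δ (u * v)) f =
      balSum (𝓗.Δ u) fun a b => balSum (𝓗.Δ v) fun c d => f (a * c) (b * d) := by
  rw [𝓗.comul_mul u v _ _ (balRep_spec _) (balRep_spec _), hf.balSum_eq, Finset.sum_mul_sum]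
  simp only [map_sum, Algebra.TensorProduct.tmul_mul_tmul]
  rfl

lemma balSum_comul_one {f : H → H → Q} (hf : 𝓗.Bal f) : balSum (𝓗.Δ 1) f = f 1 1 := by
  rw [𝓗.comul_one, hf.balSum_tmul]

variable (𝓗) in
lemma comul_s (b : B) : 𝓗.Δ (𝓗.s b) = balMk _ _ (1 ⊗ₜ[k] 𝓗.s b) := by
  simpa using 𝓗.comul_bimod 1 b 1 _ 𝓗.comul_one.symm

variable (𝓗) in
lemma comul_t (b : B) : 𝓗.Δ (𝓗.t (op b)) = balMk _ _ (𝓗.t (op b) ⊗ₜ[k] 1) := by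
  simpa using 𝓗.comul_bimod b 1 1 _ 𝓗.comul_one.symm

lemma Bal.comp_mul {f : H → H → Q} (hf : 𝓗.Bal f) (x y : H) :
    𝓗.Bal fun p q => f (x * p) (y * q) :=
  .mk' (fun m m' n => by rw [mul_add, hf.add_left]) (fun m n n' => by rw [mul_add, hf.add_right])
    fun b m n => by
      rw [← mul_assoc, ← mul_assoc]
      exact hf.bal b _ _

lemma balSum_comul_mul_t {f : H → H → Q} (hf : 𝓗.Bal f) (b : B) (h : H) :
    balSum (𝓗.Δ (h * 𝓗.t (op b))) f = balSum (𝓗.Δ h) fun c d => f (c * 𝓗.t (op b)) d := by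
  rw [balSum_comul_mul hf, comul_t]
  refine balSum_congr fun c d => ?_
  rw [(hf.comp_mul c d).balSum_tmul, mul_one]

lemma balSum_comul_s_mul {f : H → H → Q} (hf : 𝓗.Bal f) (b : B) (h : H) :
    balSum (𝓗.Δ (𝓗.s b * h)) f = balSum (𝓗.Δ h) fun c d => f c (𝓗.s b * d) := by
  rw [𝓗.comul_mul _ _ _ _ (𝓗.comul_s b).symm (balRep_spec _), hf.balSum_eq, Finset.mul_sum]
  simp only [map_sum, Algebra.TensorProduct.tmul_mul_tmul, one_mul]
  rfl

lemma balSum_takeuchi {f : H → H → Q} (hf : 𝓗.Bal f) (b : B) (h : H) :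
    (balSum (𝓗.Δ h) fun c d => f (𝓗.s b * c) d) =
      balSum (𝓗.Δ h) fun c d => f c (𝓗.t (op b) * d) := by
  have h := congrArg hf.lift (𝓗.takeuchi b h _ (balRep_spec _))
  simp only [Finset.mul_sum, map_sum, Algebra.TensorProduct.tmul_mul_tmul, one_mul] at h
  exact h

variable (𝓗) in
lemma balSum_counit_left (h : H) :
    (balSum (𝓗.Δ h) fun c d => d * 𝓗.t (op (𝓗.counit c))) = h := by
  have h := 𝓗.counit_left h _ (balRep_spec _)
  simp only [map_sum] at h
  exact h

variable (𝓗) in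
lemma balSum_counit_right (h : H) : (balSum (𝓗.Δ h) fun c d => c * 𝓗.s (𝓗.counit d)) = h := by
  have h := 𝓗.counit_right h _ (balRep_spec _)
  simp only [map_sum] at h
  exact h

/-- The coproduct of the opposite coopposite, in Sweedler notation. -/
lemma balSum_opΔ {f : Hᵐᵒᵖ → Hᵐᵒᵖ → Q} (hf : 𝓗.opCoop.Bal f) (h : H) :
    balSum (𝓗.opCoop.Δ (op h)) f = balSum (𝓗.Δ h) fun c d => f (op d) (op c) := by
  refine (hf.balSum_eq _).trans ?_
  have h1 := congrArg hf.lift (𝓗.opΔ_of_rep (u := op h) (balRep_spec _))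
  refine h1.trans ?_
  simp only [map_sum, opSwap_tmul]
  exact map_sum hf.lift _ _

end RightBialgebroid

namespace HopfAlgebroid

variable {k A B H Q : Type*} [CommRing k] [Ring A] [Algebra k A] [Ring B] [Algebra k B] [Ring H]
  [Algebra k H] [AddCommGroup Q] (𝓗 : HopfAlgebroid k A B H)

lemma coassoc_lr_balSum {f : H → H → H → Q} (h₁ : ∀ p, 𝓗.left.Bal fun m n => f m n p)
    (h₂ : ∀ m, 𝓗.right.Bal (f m)) (h : H) :
    (balSum (𝓗.right.Δ h) fun a b => balSum (𝓗.left.Δ a) fun c d => f c d b) =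
      balSum (𝓗.left.Δ h) fun c d => balSum (𝓗.right.Δ d) fun p q => f c p q :=
  balSum_assoc (𝓗.coassoc_lr h) h₁ h₂

lemma coassoc_rl_balSum {f : H → H → H → Q} (h₁ : ∀ p, 𝓗.right.Bal fun m n => f m n p)
    (h₂ : ∀ m, 𝓗.left.Bal (f m)) (h : H) :
    (balSum (𝓗.left.Δ h) fun c d => balSum (𝓗.right.Δ c) fun p q => f p q d) =
      balSum (𝓗.right.Δ h) fun a b => balSum (𝓗.left.Δ b) fun c d => f a c d :=
  balSum_assoc (𝓗.coassoc_rl h) h₁ h₂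

lemma coassoc_r_balSum {f : H → H → H → Q} (h₁ : ∀ p, 𝓗.right.Bal fun m n => f m n p)
    (h₂ : ∀ m, 𝓗.right.Bal (f m)) (h : H) :
    (balSum (𝓗.right.Δ h) fun c d => balSum (𝓗.right.Δ c) fun p q => f p q d) =
      balSum (𝓗.right.Δ h) fun a b => balSum (𝓗.right.Δ b) fun c d => f a c d :=
  balSum_assoc (𝓗.right.coassoc h) h₁ h₂

lemma balSum_antipode_left (h : H) :
    (balSum (𝓗.left.Δ h) fun c d => 𝓗.S c * d) = 𝓗.right.s (𝓗.right.counit h) := by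
  have h := 𝓗.antipode_left h _ (balRep_spec _)
  simp only [map_sum] at h
  exact h

lemma balSum_antipode_right (h : H) :
    (balSum (𝓗.right.Δ h) fun c d => c * 𝓗.S d) = 𝓗.left.s (𝓗.left.ε h) := by
  have h := 𝓗.antipode_right h _ (balRep_spec _)
  simp only [map_sum] at h
  exact h

lemma antipode_t_mul (a : A) (h : H) : 𝓗.S (𝓗.left.t (op a) * h) = 𝓗.S h * 𝓗.left.s a := by
  simpa using 𝓗.antipode_bimod a 1 h

lemma antipode_mul_t (b : B) (h : H) : 𝓗.S (h * 𝓗.right.t (op b)) = 𝓗.right.s b * 𝓗.S h := by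
  simpa using 𝓗.antipode_bimod 1 b h

lemma antipode_one : 𝓗.S 1 = 1 := by
  have h := 𝓗.antipode_left 1 _ 𝓗.left.comul_one.symm
  simpa [𝓗.right.counit_one] using h

lemma exists_right_t (a : A) : ∃ b, 𝓗.left.s a = 𝓗.right.t (op b) := ⟨_, (𝓗.t_counit_s' a).symm⟩

lemma exists_right_s (a : A) : ∃ b, 𝓗.left.t (op a) = 𝓗.right.s b := ⟨_, (𝓗.s_counit_t' a).symm⟩

lemma exists_left_s (b : B) : ∃ a, 𝓗.right.t (op b) = 𝓗.left.s a := ⟨_, (𝓗.s_counit_t b).symm⟩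

lemma exists_left_t (b : B) : ∃ a, 𝓗.right.s b = 𝓗.left.t (op a) := ⟨_, (𝓗.t_counit_s b).symm⟩

end HopfAlgebroid

namespace HopfAlgebroid

variable {k A B H Q : Type*} [CommRing k] [Ring A] [Algebra k A] [Ring B] [Algebra k B] [Ring H]
  [Algebra k H] [AddCommGroup Q] (𝓗 : HopfAlgebroid k A B H)

lemma balSum_antipode_mul_s_counit (h : H) :
    (balSum (𝓗.left.Δ h) fun c d => 𝓗.S c * 𝓗.left.s (𝓗.left.ε d)) = 𝓗.S h := by
  conv_rhs => rw [← 𝓗.left.balSum_counit_right h, map_balSum]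
  exact balSum_congr fun c d => (𝓗.antipode_t_mul _ _).symm

/-- A map `J` with `J(t(a) h) = J(h) s(a)` can be recovered from `h ↦ J(h₍₁₎) h₍₂₎`. -/
lemma eq_balSum_balSum_mul_antipode {J : H → H} (hJ : ∀ u v, J (u + v) = J u + J v)
    (hJt : ∀ a u, J (𝓗.left.t (op a) * u) = J u * 𝓗.left.s a) (h : H) :
    J h = balSum (𝓗.right.Δ h) fun a b =>
      (balSum (𝓗.left.Δ a) fun c d => J c * d) * 𝓗.S b := by
  simp only [balSum_mul]
  rw [𝓗.coassoc_lr_balSum (f := fun c d b => J c * d * 𝓗.S b)]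
  · have hJ' : ∀ z (f : H → H → H), J (balSum (𝓗.left.Δ z) f) =
        balSum (𝓗.left.Δ z) fun m n => J (f m n) := fun z f =>
      map_balSum (AddMonoidHom.mk' J hJ) _ _
    conv_lhs => rw [← 𝓗.left.balSum_counit_right h, hJ']
    refine balSum_congr fun c d => ?_
    simp only [mul_assoc]
    rw [hJt, ← mul_balSum, balSum_antipode_right]
  · exact fun p => .mk' (by intros; simp [hJ, add_mul]) (by intros; simp [mul_add, add_mul])
      (by intro a m n; rw [hJt, mul_assoc (J m)])
  · exact fun m => .mk' (by intros; simp [mul_add, add_mul]) (by intros; simp [mul_add])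
      (by intro b p q; simp only [antipode_mul_t, mul_assoc])

lemma antipode_convolution_cancel {J J' : H → H} (hJ : ∀ u v, J (u + v) = J u + J v)
    (hJt : ∀ a u, J (𝓗.left.t (op a) * u) = J u * 𝓗.left.s a)
    (hJ' : ∀ u v, J' (u + v) = J' u + J' v)
    (hJt' : ∀ a u, J' (𝓗.left.t (op a) * u) = J' u * 𝓗.left.s a)
    (h : ∀ u, (balSum (𝓗.left.Δ u) fun c d => J c * d) =
      balSum (𝓗.left.Δ u) fun c d => J' c * d) (u : H) : J u = J' u := by
  rw [𝓗.eq_balSum_balSum_mul_antipode hJ hJt, 𝓗.eq_balSum_balSum_mul_antipode hJ' hJt']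
  simp only [h]

lemma bal_antipode_mul : 𝓗.left.Bal fun c d => 𝓗.S c * d :=
  .mk' (by intros; simp [add_mul]) (by intros; simp [mul_add])
    (by intro a m n; rw [antipode_t_mul, mul_assoc])

/-- The antipode is anti-multiplicative. -/
lemma antipode_mul (g h : H) : 𝓗.S (g * h) = 𝓗.S h * 𝓗.S g := by
  refine 𝓗.antipode_convolution_cancel (J := fun g => 𝓗.S (g * h))
    (J' := fun g => 𝓗.S h * 𝓗.S g) (by intros; simp [add_mul])
    (by intros; simp only [mul_assoc, antipode_t_mul]) (by intros; simp [mul_add])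
    (by intros; simp only [mul_assoc, antipode_t_mul]) (fun g => ?_) g
  simp only [mul_assoc]
  rw [← mul_balSum, balSum_antipode_left]
  refine 𝓗.antipode_convolution_cancel (J := fun h => balSum (𝓗.left.Δ g) fun c d =>
    𝓗.S (c * h) * d) (J' := fun h => 𝓗.S h * 𝓗.right.s (𝓗.right.counit g))
    (by intros; simp [mul_add, add_mul, balSum_fun_add]) (fun a h => ?_)
    (by intros; simp [add_mul]) (fun a h => ?_) (fun h => ?_) h
  · simp only [balSum_mul, ← mul_assoc]
    rw [𝓗.left.balSum_takeuchi (f := fun c d => 𝓗.S (c * h) * d)]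
    · simp only [mul_assoc]
    · exact .mk' (by intros; simp [add_mul]) (by intros; simp [mul_add])
        (by intro a m n; simp only [antipode_t_mul, mul_assoc])
  · obtain ⟨c, hc⟩ := 𝓗.exists_left_t (𝓗.right.counit g)
    rw [antipode_t_mul, hc, mul_assoc, mul_assoc, 𝓗.left.s_mul_t]
  · simp only [balSum_mul]
    rw [balSum_comm]
    simp only [mul_assoc]
    rw [← 𝓗.left.balSum_comul_mul 𝓗.bal_antipode_mul, balSum_antipode_left,
      𝓗.right.counit_mul_s, ← balSum_antipode_left]
    obtain ⟨c, hc⟩ := 𝓗.exists_left_t (𝓗.right.counit g)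
    rw [hc, 𝓗.left.balSum_comul_t_mul 𝓗.bal_antipode_mul]

lemma antipode_t (a : A) : 𝓗.S (𝓗.left.t (op a)) = 𝓗.left.s a := by
  simpa [antipode_one] using 𝓗.antipode_t_mul a 1

lemma antipode_right_t (b : B) : 𝓗.S (𝓗.right.t (op b)) = 𝓗.right.s b := by
  simpa [antipode_one] using 𝓗.antipode_mul_t b 1

/-- `∂ S = ∂ s ε`. -/
lemma right_counit_antipode (h : H) :
    𝓗.right.counit (𝓗.S h) = 𝓗.right.counit (𝓗.left.s (𝓗.left.ε h)) := by
  rw [← balSum_antipode_right, map_balSum]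
  conv_lhs => rw [← 𝓗.right.balSum_counit_left h, map_balSum, map_balSum]
  refine balSum_congr fun c d => ?_
  rw [antipode_mul_t, 𝓗.right.counit_mul_s c]

/-- `ε S = ε s ∂`. -/
lemma left_counit_antipode (h : H) :
    𝓗.left.ε (𝓗.S h) = 𝓗.left.ε (𝓗.right.s (𝓗.right.counit h)) := by
  rw [← balSum_antipode_left, map_balSum]
  conv_lhs => rw [← 𝓗.left.balSum_counit_right h, map_balSum, map_balSum]
  refine balSum_congr fun c d => ?_
  rw [antipode_t_mul, 𝓗.left.counit_mul_s (𝓗.S c) d]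

end HopfAlgebroid

namespace RightBialgebroid

variable {k B H : Type*} [CommRing k] [Ring B] [Algebra k B] [Ring H] [Algebra k H]
  (𝓗 : RightBialgebroid k B H)

/-- `H_◀ ⊗_B ▶H`. -/
abbrev Sq : Type _ := BalTensor (mulR k 𝓗.s) (mulR k fun b => 𝓗.t (op b))

/-- The map `m ⊗ n ↦ p m ⊗ q n` on `H_◀ ⊗_B ▶H`. -/
def sqMulLeft (p q : H) : 𝓗.Sq →ₗ[k] 𝓗.Sq :=
  Submodule.mapQ _ _ (LinearMap.mulLeft k (p ⊗ₜ[k] q)) (by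
    rw [balRel, Submodule.span_le]
    rintro _ ⟨b, m, n, rfl⟩
    refine Submodule.subset_span ⟨b, p * m, q * n, ?_⟩
    simp [mul_sub, mul_assoc])

lemma sqMulLeft_tmul (p q m n : H) :
    𝓗.sqMulLeft p q (balMk _ _ (m ⊗ₜ n)) = balMk _ _ ((p * m) ⊗ₜ (q * n)) :=
  congrArg (balMk _ _) (Algebra.TensorProduct.tmul_mul_tmul p m q n)

lemma sqMulLeft_sqMulLeft (p q p' q' : H) (y : 𝓗.Sq) :
    𝓗.sqMulLeft p q (𝓗.sqMulLeft p' q' y) = 𝓗.sqMulLeft (p * p') (q * q') y := by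
  induction y using balTensor_induction with
  | h0 => simp only [map_zero]
  | h2 x y hx hy => simp only [map_add, hx, hy]
  | h1 m n => simp only [sqMulLeft_tmul, mul_assoc]

lemma sqMulLeft_add_left (p p' q : H) (y : 𝓗.Sq) :
    𝓗.sqMulLeft (p + p') q y = 𝓗.sqMulLeft p q y + 𝓗.sqMulLeft p' q y := by
  induction y using balTensor_induction with
  | h0 => simp only [map_zero, add_zero]
  | h2 x y hx hy => simp only [map_add, hx, hy]; abel
  | h1 m n => simp only [sqMulLeft_tmul, add_mul, TensorProduct.add_tmul, map_add]

lemma sqMulLeft_add_right (p q q' : H) (y : 𝓗.Sq) :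
    𝓗.sqMulLeft p (q + q') y = 𝓗.sqMulLeft p q y + 𝓗.sqMulLeft p q' y := by
  induction y using balTensor_induction with
  | h0 => simp only [map_zero, add_zero]
  | h2 x y hx hy => simp only [map_add, hx, hy]; abel
  | h1 m n => simp only [sqMulLeft_tmul, add_mul, TensorProduct.tmul_add, map_add]

/-- The Takeuchi-Sweedler product, inside `H_◀ ⊗_B ▶H`. -/
def IsTakeuchi (y : 𝓗.Sq) : Prop :=
  ∀ b, 𝓗.sqMulLeft (𝓗.s b) 1 y = 𝓗.sqMulLeft 1 (𝓗.t (op b)) y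

/-- The product `Δ(g) y`. -/
noncomputable def comulMul (g : H) (y : 𝓗.Sq) : 𝓗.Sq :=
  balSum (𝓗.Δ g) fun p q => 𝓗.sqMulLeft p q y

variable {𝓗}

lemma IsTakeuchi.bal {y : 𝓗.Sq} (hy : 𝓗.IsTakeuchi y) :
    𝓗.Bal fun p q => 𝓗.sqMulLeft p q y :=
  .mk' (fun _ _ _ => 𝓗.sqMulLeft_add_left _ _ _ _) (fun _ _ _ => 𝓗.sqMulLeft_add_right _ _ _ _)
    fun b m n => by
      have h := congrArg (𝓗.sqMulLeft m n) (hy b)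
      simpa only [sqMulLeft_sqMulLeft, mul_one] using h

lemma IsTakeuchi.comulMul_mul {y : 𝓗.Sq} (hy : 𝓗.IsTakeuchi y) (g h : H) :
    𝓗.comulMul (g * h) y = 𝓗.comulMul g (𝓗.comulMul h y) := by
  rw [comulMul, balSum_comul_mul hy.bal]
  refine balSum_congr fun a b => ?_
  rw [comulMul, map_balSum]
  exact balSum_congr fun c d => (𝓗.sqMulLeft_sqMulLeft _ _ _ _ _).symm

lemma IsTakeuchi.comulMul_s {y : 𝓗.Sq} (hy : 𝓗.IsTakeuchi y) (b : B) :
    𝓗.comulMul (𝓗.s b) y = 𝓗.sqMulLeft 1 (𝓗.s b) y := by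
  rw [comulMul, comul_s, hy.bal.balSum_tmul]

lemma IsTakeuchi.comulMul_mul_s {y : 𝓗.Sq} (hy : 𝓗.IsTakeuchi y) (g : H) (b : B) :
    𝓗.comulMul (g * 𝓗.s b) y = 𝓗.comulMul g (𝓗.sqMulLeft 1 (𝓗.s b) y) := by
  rw [hy.comulMul_mul, hy.comulMul_s]

lemma IsTakeuchi.comulMul_add_left {y : 𝓗.Sq} (hy : 𝓗.IsTakeuchi y) (g h : H) :
    𝓗.comulMul (g + h) y = 𝓗.comulMul g y + 𝓗.comulMul h y := by
  rw [comulMul, map_add, hy.bal.balSum_add]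
  rfl

lemma comulMul_add_right (g : H) (y y' : 𝓗.Sq) :
    𝓗.comulMul g (y + y') = 𝓗.comulMul g y + 𝓗.comulMul g y' := by
  simp only [comulMul, map_add, balSum_fun_add]

lemma comul_mul_eq (g h : H) : 𝓗.Δ (g * h) = 𝓗.comulMul g (𝓗.Δ h) := by
  rw [← balSum_balMk (𝓗.Δ (g * h)), balSum_comul_mul isBal_balMk]
  refine balSum_congr fun a b => ?_
  conv_rhs => rw [← balSum_balMk (𝓗.Δ h), map_balSum]
  exact balSum_congr fun c d => (𝓗.sqMulLeft_tmul _ _ _ _).symm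

end RightBialgebroid

namespace HopfAlgebroid

variable {k A B H Q : Type*} [CommRing k] [Ring A] [Algebra k A] [Ring B] [Algebra k B] [Ring H]
  [Algebra k H] [AddCommGroup Q] (𝓗 : HopfAlgebroid k A B H)

lemma antipode_right_t_mul (b : B) (h : H) :
    𝓗.S (𝓗.right.t (op b) * h) = 𝓗.S h * 𝓗.right.s b := by
  rw [antipode_mul, antipode_right_t]

lemma antipode_mul_left_t (a : A) (h : H) :
    𝓗.S (h * 𝓗.left.t (op a)) = 𝓗.left.s a * 𝓗.S h := by
  rw [antipode_mul, antipode_t]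

lemma bal_antipode_swap (x y : H) : 𝓗.left.Bal fun c d => balMk (mulR k 𝓗.right.s)
    (mulR k fun b => 𝓗.right.t (op b)) ((x * 𝓗.S d) ⊗ₜ[k] (y * 𝓗.S c)) :=
  .mk' (by intros; simp only [map_add, mul_add, TensorProduct.tmul_add])
    (by intros; simp only [map_add, mul_add, TensorProduct.add_tmul]) (by
      intro a c d
      obtain ⟨b, hb⟩ := 𝓗.exists_right_t a
      rw [antipode_t_mul, hb, antipode_right_t_mul, ← mul_assoc, ← mul_assoc]
      exact (balMk_rel (mulR k 𝓗.right.s) (mulR k fun b => 𝓗.right.t (op b)) b _ _).symm)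

/-- `S(h₍₂₎) ⊗ S(h₍₁₎)`. -/
noncomputable def antipodeSwap (h : H) : 𝓗.right.Sq :=
  balSum (𝓗.left.Δ h) fun c d => balMk _ _ (𝓗.S d ⊗ₜ[k] 𝓗.S c)

lemma sqMulLeft_antipodeSwap (p q h : H) : 𝓗.right.sqMulLeft p q (𝓗.antipodeSwap h) =
    balSum (𝓗.left.Δ h) fun c d => balMk _ _ ((p * 𝓗.S d) ⊗ₜ[k] (q * 𝓗.S c)) := by
  rw [antipodeSwap, map_balSum]
  exact balSum_congr fun c d => 𝓗.right.sqMulLeft_tmul _ _ _ _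

lemma bal_antipode_swap' : 𝓗.left.Bal fun c d => balMk (mulR k 𝓗.right.s)
    (mulR k fun b => 𝓗.right.t (op b)) (𝓗.S d ⊗ₜ[k] 𝓗.S c) := by
  simpa only [one_mul] using 𝓗.bal_antipode_swap 1 1

lemma antipodeSwap_add (g h : H) :
    𝓗.antipodeSwap (g + h) = 𝓗.antipodeSwap g + 𝓗.antipodeSwap h := by
  rw [antipodeSwap, map_add, 𝓗.bal_antipode_swap'.balSum_add]
  rfl

lemma antipodeSwap_mul_t (b : B) (h : H) : 𝓗.antipodeSwap (h * 𝓗.right.t (op b)) =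
    𝓗.right.sqMulLeft 1 (𝓗.right.s b) (𝓗.antipodeSwap h) := by
  obtain ⟨a, ha⟩ := 𝓗.exists_left_s b
  rw [sqMulLeft_antipodeSwap, antipodeSwap, ha, 𝓗.left.balSum_comul_mul_s 𝓗.bal_antipode_swap']
  simp only [← ha, antipode_mul_t, one_mul]

lemma isTakeuchi_antipodeSwap (h : H) : 𝓗.right.IsTakeuchi (𝓗.antipodeSwap h) := by
  intro b
  obtain ⟨a, ha⟩ := 𝓗.exists_left_s b
  have h1 := 𝓗.left.balSum_takeuchi 𝓗.bal_antipode_swap' a h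
  simp only [← ha, antipode_mul_t, antipode_mul_left_t] at h1
  rw [sqMulLeft_antipodeSwap, sqMulLeft_antipodeSwap]
  simp only [one_mul]
  exact h1.symm

lemma balSum_comulMul_antipodeSwap (h : H) :
    (balSum (𝓗.right.Δ h) fun a b => 𝓗.right.comulMul a (𝓗.antipodeSwap b)) =
      balMk _ _ (𝓗.left.s (𝓗.left.ε h) ⊗ₜ[k] 1) := by
  simp only [RightBialgebroid.comulMul]
  rw [𝓗.coassoc_r_balSum (f := fun p q b => 𝓗.right.sqMulLeft p q (𝓗.antipodeSwap b))]
  · rw [← balSum_antipode_right]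
    have h1 : balMk (mulR k 𝓗.right.s) (mulR k fun b => 𝓗.right.t (op b))
        ((balSum (𝓗.right.Δ h) fun c d => c * 𝓗.S d) ⊗ₜ[k] 1) =
        balSum (𝓗.right.Δ h) fun c d => balMk (mulR k 𝓗.right.s)
          (mulR k fun b => 𝓗.right.t (op b)) ((c * 𝓗.S d) ⊗ₜ[k] 1) :=
      map_balSum ((balMk (mulR k 𝓗.right.s) (mulR k fun b => 𝓗.right.t (op b))) ∘ₗ
        (TensorProduct.mk k H H).flip 1) _ _
    rw [h1]
    refine balSum_congr fun a b => ?_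
    simp only [sqMulLeft_antipodeSwap]
    rw [← 𝓗.coassoc_rl_balSum (f := fun p c d => balMk (mulR k 𝓗.right.s)
      (mulR k fun b => 𝓗.right.t (op b)) ((a * 𝓗.S d) ⊗ₜ[k] (p * 𝓗.S c)))]
    · have h2 : ∀ c d, (balSum (𝓗.right.Δ c) fun p q => balMk (mulR k 𝓗.right.s)
          (mulR k fun b => 𝓗.right.t (op b)) ((a * 𝓗.S d) ⊗ₜ[k] (p * 𝓗.S q))) =
          balMk _ _ ((a * 𝓗.S (𝓗.left.s (𝓗.left.ε c) * d)) ⊗ₜ[k] 1) := fun c d => by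
        refine (map_balSum ((balMk (mulR k 𝓗.right.s) (mulR k fun b => 𝓗.right.t (op b))) ∘ₗ
          TensorProduct.mk k H H (a * 𝓗.S d)) _ _).symm.trans ?_
        rw [balSum_antipode_right]
        obtain ⟨b, hb⟩ := 𝓗.exists_right_t (𝓗.left.ε c)
        rw [hb, antipode_right_t_mul, ← mul_assoc]
        refine Eq.trans ?_ (balMk_rel (mulR k 𝓗.right.s) (mulR k fun b => 𝓗.right.t (op b)) b
          (a * 𝓗.S d) 1).symm
        simp
      simp only [h2]
      conv_rhs => rw [← 𝓗.left.balSum_counit_left b]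
      exact (map_balSum ((balMk (mulR k 𝓗.right.s) (mulR k fun b => 𝓗.right.t (op b))) ∘ₗ
        (TensorProduct.mk k H H).flip 1 ∘ₗ LinearMap.mulLeft k a ∘ₗ 𝓗.S) _ _).symm
    · exact fun d => .mk' (by intros; simp only [map_add, add_mul, TensorProduct.tmul_add])
        (by intros; simp only [map_add, mul_add, TensorProduct.tmul_add])
        (by intros; simp only [antipode_mul_t, mul_assoc])
    · exact fun p => 𝓗.bal_antipode_swap a p
  · exact fun b => (𝓗.isTakeuchi_antipodeSwap b).bal
  · exact fun p => .mk' (by intros; simp only [RightBialgebroid.sqMulLeft_add_right])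
      (by intros; simp only [antipodeSwap_add, map_add]) (by
        intro b m n
        simp only [antipodeSwap_mul_t, RightBialgebroid.sqMulLeft_sqMulLeft, mul_one])

/-- The antipode is anti-comultiplicative: `Δ_r(S(h)) = S(h₍₂₎) ⊗ S(h₍₁₎)`. -/
lemma right_comul_antipode (h : H) : 𝓗.right.Δ (𝓗.S h) = 𝓗.antipodeSwap h := by
  conv_lhs => rw [← balSum_antipode_mul_s_counit, map_balSum]
  have h1 : ∀ c d, 𝓗.right.Δ (𝓗.S c * 𝓗.left.s (𝓗.left.ε d)) =
      balSum (𝓗.right.Δ d) fun p q => 𝓗.right.comulMul (𝓗.S c * p) (𝓗.antipodeSwap q) :=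
    fun c d => by
      obtain ⟨b, hb⟩ := 𝓗.exists_right_t (𝓗.left.ε d)
      rw [RightBialgebroid.comul_mul_eq, hb, 𝓗.right.comul_t, ← hb,
        ← balSum_comulMul_antipodeSwap]
      simp only [(𝓗.isTakeuchi_antipodeSwap _).comulMul_mul]
      exact map_balSum (AddMonoidHom.mk' (𝓗.right.comulMul (𝓗.S c))
        (RightBialgebroid.comulMul_add_right _)) _ _
  simp only [h1]
  rw [← 𝓗.coassoc_lr_balSum (f := fun c p q =>
    𝓗.right.comulMul (𝓗.S c * p) (𝓗.antipodeSwap q))]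
  · have h2 : ∀ a b, (balSum (𝓗.left.Δ a) fun c d =>
        𝓗.right.comulMul (𝓗.S c * d) (𝓗.antipodeSwap b)) =
        𝓗.antipodeSwap (b * 𝓗.right.t (op (𝓗.right.counit a))) := fun a b => by
      refine (map_balSum (AddMonoidHom.mk' (fun x => 𝓗.right.comulMul x (𝓗.antipodeSwap b))
        (𝓗.isTakeuchi_antipodeSwap b).comulMul_add_left) _ _).symm.trans ?_
      rw [balSum_antipode_left, antipodeSwap_mul_t]
      exact (𝓗.isTakeuchi_antipodeSwap b).comulMul_s _
    simp only [h2]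
    conv_rhs => rw [← 𝓗.right.balSum_counit_left h]
    exact (map_balSum (AddMonoidHom.mk' 𝓗.antipodeSwap 𝓗.antipodeSwap_add) _ _).symm
  · exact fun q => .mk' (by
        intros
        simp only [map_add, add_mul, (𝓗.isTakeuchi_antipodeSwap q).comulMul_add_left])
      (by intros; simp only [mul_add, (𝓗.isTakeuchi_antipodeSwap q).comulMul_add_left])
      (by intros; simp only [antipode_t_mul, mul_assoc])
  · exact fun c => .mk' (by
        intros
        simp only [mul_add, (𝓗.isTakeuchi_antipodeSwap _).comulMul_add_left])
      (by intros; simp only [antipodeSwap_add, RightBialgebroid.comulMul_add_right]) (by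
        intro b p q
        rw [antipodeSwap_mul_t, ← mul_assoc, (𝓗.isTakeuchi_antipodeSwap q).comulMul_mul_s])

lemma balSum_right_comul_antipode {f : H → H → Q} (hf : 𝓗.right.Bal f) (h : H) :
    balSum (𝓗.right.Δ (𝓗.S h)) f = balSum (𝓗.left.Δ h) fun c d => f (𝓗.S d) (𝓗.S c) := by
  rw [right_comul_antipode, hf.balSum_eq, antipodeSwap, map_balSum]
  rfl

/-- The antipode is a morphism `H^ℓ → (H^r)^op_coop`. -/
lemma isHom_antipodeOp : 𝓗.left.IsHom 𝓗.right.opCoop 𝓗.antipodeOp 𝓗.nu where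
  map_one := congrArg op 𝓗.antipode_one
  map_mul u v := congrArg op (𝓗.antipode_mul u v)
  map_s a := by
    refine congrArg op ?_
    change 𝓗.S (𝓗.left.s a) = 𝓗.right.s (𝓗.right.counit (𝓗.left.s a))
    rw [← antipode_right_t, 𝓗.t_counit_s']
  map_t a := congrArg op ((𝓗.antipode_t a).trans (𝓗.t_counit_s' a).symm)
  map_counit u := congrArg op (𝓗.right_counit_antipode u)
  map_comul u x hx := by
    obtain ⟨n, m, m', rfl⟩ := TensorProduct.exists_sum_tmul_eq x
    have h1 : 𝓗.right.opCoop.Δ (𝓗.antipodeOp u) =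
        𝓗.right.opFlip (𝓗.right.Δ (𝓗.S u)) := rfl
    rw [h1, right_comul_antipode, antipodeSwap, 𝓗.bal_antipode_swap'.balSum_rep hx]
    simp only [map_sum]
    rfl

end HopfAlgebroid

namespace LeftBialgebroid

variable {k A U A' U' : Type*} [CommRing k] [Ring A] [Algebra k A] [Ring U] [Algebra k U]
  [Ring A'] [Algebra k A'] [Ring U'] [Algebra k U'] {𝓤 : LeftBialgebroid k A U}
  {𝓥 : LeftBialgebroid k A' U'} {F : U →ₗ[k] U'}

variable (𝓤) in
lemma sqMulRight_tmul (v c d : U) :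
    𝓤.sqMulRight v (balMk _ _ (c ⊗ₜ d)) = balMk _ _ (c ⊗ₜ (d * v)) := rfl

variable (𝓤) in
lemma sqMulRight_comul (u v : U) : 𝓤.sqMulRight v (𝓤.Δ u) =
    balSum (𝓤.Δ u) fun c d => balMk _ _ (c ⊗ₜ (d * v)) := by
  conv_lhs => rw [← balSum_balMk (𝓤.Δ u), map_balSum]
  exact balSum_congr fun c d => 𝓤.sqMulRight_tmul _ _ _

lemma hopfGalois_bijective_of_inverse (g : 𝓤.Sq →+ 𝓤.GaloisSq)
    (h1 : ∀ u v, g (𝓤.hopfGalois (balMk _ _ (u ⊗ₜ v))) = balMk _ _ (u ⊗ₜ v))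
    (h2 : ∀ u v, 𝓤.hopfGalois (g (balMk _ _ (u ⊗ₜ v))) = balMk _ _ (u ⊗ₜ v)) :
    𝓤.IsLeftHopf := by
  refine Function.bijective_iff_has_inverse.2 ⟨g, fun y => ?_, fun y => ?_⟩
  · induction y using balTensor_induction with
    | h0 => simp only [map_zero]
    | h1 m n => exact h1 m n
    | h2 x y hx hy => simp only [map_add, hx, hy]
  · induction y using balTensor_induction with
    | h0 => simp only [map_zero]
    | h1 m n => exact h2 m n
    | h2 x y hx hy => simp only [map_add, hx, hy]

lemma rightDual_comul_iff (h : 𝓤.RightFGProjective) (φ : 𝓤.RDual) {n : ℕ}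
    (φ₁ φ₂ : Fin n → 𝓤.RDual) :
    balMk _ _ (∑ i, φ₁ i ⊗ₜ[k] φ₂ i) = (𝓤.rightDual h).Δ φ ↔
      ∀ u v, ∑ i, (φ₁ i).val (u * 𝓤.t (op ((φ₂ i).val v))) = φ.val (u * v) := by
  change balMk (mulR k 𝓤.rS) (mulR k fun a => 𝓤.rT (op a)) _ = 𝓤.rΔ h φ ↔ _
  refine ⟨fun hx u v => ?_, fun hx => 𝓤.rSq_ext h fun u v => ?_⟩
  · rw [← rPair_sum, hx, rPair_rΔ]
  · rw [rPair_rΔ, rPair_sum, hx]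

lemma leftDual_comul_iff (h : 𝓤.LeftFGProjective) (φ : 𝓤.LDual) {n : ℕ}
    (φ₁ φ₂ : Fin n → 𝓤.LDual) :
    balMk _ _ (∑ i, φ₁ i ⊗ₜ[k] φ₂ i) = (𝓤.leftDual h).Δ φ ↔
      ∀ u v, ∑ i, (φ₂ i).val (u * 𝓤.s ((φ₁ i).val v)) = φ.val (u * v) := by
  change balMk (mulR k 𝓤.lS) (mulR k fun a => 𝓤.lT (op a)) _ = 𝓤.lΔ h φ ↔ _
  refine ⟨fun hx u v => ?_, fun hx => 𝓤.lSq_ext h fun u v => ?_⟩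
  · rw [← lPair_sum, hx, lPair_lΔ]
  · rw [lPair_lΔ, lPair_sum, hx]

namespace IsHom

section

variable {f : A →ₐ[k] A'} (hF : 𝓤.IsHom 𝓥 F f)

include hF

lemma bal_map : 𝓤.Bal fun c d => balMk (mulL k fun a => 𝓥.t (op a)) (mulL k 𝓥.s)
    (F c ⊗ₜ[k] F d) :=
  .mk' (by intros; simp only [map_add, TensorProduct.add_tmul])
    (by intros; simp only [map_add, TensorProduct.tmul_add]) (by
      intro a m n
      rw [hF.map_mul, hF.map_mul, hF.map_s, hF.map_t]
      exact balMk_rel (mulL k fun a => 𝓥.t (op a)) (mulL k 𝓥.s) (f a) _ _)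

lemma comul_eq_balSum (u : U) :
    𝓥.Δ (F u) = balSum (𝓤.Δ u) fun c d => balMk _ _ (F c ⊗ₜ[k] F d) := by
  rw [hF.map_comul u _ (balRep_spec _), map_sum, map_sum]
  rfl

/-- A morphism preserves the translation maps. -/
lemma translation (hU : 𝓤.IsLeftHopf) (hV : 𝓥.IsLeftHopf) (u : U) :
    hV.translation (F u) = balSum (hU.translation u) fun c d => balMk _ _ (F c ⊗ₜ[k] F d) := by
  apply hV.1
  have h1 : hF.bal_map.lift (𝓤.hopfGalois (hU.translation u)) =
      balMk _ _ (F u ⊗ₜ[k] 1) := by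
    rw [hU.hopfGalois_translation, IsBal.lift_tmul, hF.map_one]
  rw [hV.hopfGalois_translation, ← h1, map_balSum]
  conv_lhs => rw [← balSum_balMk (hU.translation u), map_balSum, map_balSum]
  refine balSum_congr fun c d => ?_
  rw [hopfGalois_tmul, hopfGalois_tmul, sqMulRight_comul, map_balSum, hF.comul_eq_balSum,
    map_balSum]
  refine balSum_congr fun p q => ?_
  rw [sqMulRight_tmul, IsBal.lift_tmul, hF.map_mul]

end

variable {f : A ≃ₐ[k] A'} (hF : 𝓤.IsHom 𝓥 F (f : A →ₐ[k] A'))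

lemma transposeR_val (φ : 𝓥.RDual) (u : U) :
    (hF.transposeR φ).val u = f.symm (φ.val (F u)) := rfl

lemma transposeL_val (φ : 𝓥.LDual) (u : U) :
    (hF.transposeL φ).val u = f.symm (φ.val (F u)) := rfl

/-- The maps `S^*` commute with the transposes of a morphism. -/
lemma transposeL_comp_dualS (hU : 𝓤.IsLeftHopf) (hV : 𝓥.IsLeftHopf) :
    hF.transposeL ∘ₗ hV.dualS = hU.dualS ∘ₗ hF.transposeR := by
  refine LinearMap.ext fun φ => LDual.ext fun u => ?_
  change f.symm (𝓥.evalS φ (hV.translation (F u))) =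
    𝓤.evalS (hF.transposeR φ) (hU.translation u)
  rw [hF.translation hU hV, map_balSum, map_balSum]
  conv_rhs => rw [← balSum_balMk (hU.translation u), map_balSum]
  refine balSum_congr fun c d => ?_
  rw [evalS_tmul, evalS_tmul, transposeR_val, AlgEquiv.symm_apply_eq]
  have h := hF.map_counit (c * 𝓤.t (op (f.symm (φ.val (F d)))))
  rw [hF.map_mul, hF.map_t] at h
  simpa using h

lemma transposeR_mul (φ ψ : 𝓥.RDual) :
    hF.transposeR (φ * ψ) = hF.transposeR φ * hF.transposeR ψ := by
  refine RDual.ext fun u => ?_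
  rw [transposeR_val, rMul_val, rMul_val, hF.comul_eq_balSum, map_balSum, map_balSum]
  conv_rhs => rw [← balSum_balMk (𝓤.Δ u), map_balSum]
  refine balSum_congr fun c d => ?_
  rw [rConv_tmul, rConv_tmul, transposeR_val, transposeR_val, hF.map_mul, hF.map_s]
  simp

lemma transposeL_mul (φ ψ : 𝓥.LDual) :
    hF.transposeL (φ * ψ) = hF.transposeL φ * hF.transposeL ψ := by
  refine LDual.ext fun u => ?_
  rw [transposeL_val, lMul_val, lMul_val, hF.comul_eq_balSum, map_balSum, map_balSum]
  conv_rhs => rw [← balSum_balMk (𝓤.Δ u), map_balSum]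
  refine balSum_congr fun c d => ?_
  rw [lConv_tmul, lConv_tmul, transposeL_val, transposeL_val, hF.map_mul, hF.map_t]
  simp

/-- The transpose `V^* → U^*` is a morphism of right bialgebroids. -/
lemma isHom_transposeR (hU : 𝓤.RightFGProjective) (hV : 𝓥.RightFGProjective) :
    (𝓥.rightDual hV).IsHom (𝓤.rightDual hU) hF.transposeR (f.symm : A' →ₐ[k] A) where
  map_one := RDual.ext fun u => (f.symm_apply_eq).2 (hF.map_counit u)
  map_mul := hF.transposeR_mul
  map_s a := RDual.ext fun u => (f.symm_apply_eq).2 (by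
    change 𝓥.ε (F u * 𝓥.s a) = f (𝓤.ε (u * 𝓤.s (f.symm a)))
    have h := hF.map_counit (u * 𝓤.s (f.symm a))
    rw [hF.map_mul, hF.map_s] at h
    simpa using h)
  map_t a := RDual.ext fun u => (f.symm_apply_eq).2 (by
    change a * 𝓥.ε (F u) = f (f.symm a * 𝓤.ε u)
    rw [hF.map_counit]
    simp)
  map_counit φ := by
    change f.symm (φ.val (F 1)) = f.symm (φ.val 1)
    rw [hF.map_one]
  map_comul φ x hx := by
    obtain ⟨n, φ₁, φ₂, rfl⟩ := TensorProduct.exists_sum_tmul_eq x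
    rw [map_sum]
    refine ((𝓤.rightDual_comul_iff hU _ _ _).2 fun u v => ?_).symm
    rw [transposeR_val, hF.map_mul, ← (𝓥.rightDual_comul_iff hV _ _ _).1 hx, map_sum]
    refine Finset.sum_congr rfl fun i _ => ?_
    rw [transposeR_val, transposeR_val, hF.map_mul, hF.map_t]
    simp

/-- The transpose `V_* → U_*` is a morphism of right bialgebroids. -/
lemma isHom_transposeL (hU : 𝓤.LeftFGProjective) (hV : 𝓥.LeftFGProjective) :
    (𝓥.leftDual hV).IsHom (𝓤.leftDual hU) hF.transposeL (f.symm : A' →ₐ[k] A) where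
  map_one := LDual.ext fun u => (f.symm_apply_eq).2 (hF.map_counit u)
  map_mul := hF.transposeL_mul
  map_s a := LDual.ext fun u => (f.symm_apply_eq).2 (by
    change 𝓥.ε (F u) * a = f (𝓤.ε u * f.symm a)
    rw [hF.map_counit]
    simp)
  map_t a := LDual.ext fun u => (f.symm_apply_eq).2 (by
    change 𝓥.ε (F u * 𝓥.t (op a)) = f (𝓤.ε (u * 𝓤.t (op (f.symm a))))
    have h := hF.map_counit (u * 𝓤.t (op (f.symm a)))
    rw [hF.map_mul, hF.map_t] at h
    simpa using h)
  map_counit φ := by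
    change f.symm (φ.val (F 1)) = f.symm (φ.val 1)
    rw [hF.map_one]
  map_comul φ x hx := by
    obtain ⟨n, φ₁, φ₂, rfl⟩ := TensorProduct.exists_sum_tmul_eq x
    rw [map_sum]
    refine ((𝓤.leftDual_comul_iff hU _ _ _).2 fun u v => ?_).symm
    rw [transposeL_val, hF.map_mul, ← (𝓥.leftDual_comul_iff hV _ _ _).1 hx, map_sum]
    refine Finset.sum_congr rfl fun i _ => ?_
    rw [transposeL_val, transposeL_val, hF.map_mul, hF.map_s]
    simp

lemma transposeL_bijective (h : Function.Bijective F) : Function.Bijective hF.transposeL := by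
  let G : U ≃ₗ[k] U' := LinearEquiv.ofBijective F h
  have hG : ∀ u, F (G.symm u) = u := G.apply_symm_apply
  refine ⟨fun φ ψ hφ => LDual.ext fun u => ?_, fun φ => ⟨⟨f.toLinearMap ∘ₗ φ.val ∘ₗ
    G.symm.toLinearMap, fun a u => ?_⟩, LDual.ext fun u => ?_⟩⟩
  · obtain ⟨u, rfl⟩ := h.2 u
    exact f.symm.injective (congrArg (fun χ => LDual.val χ u) hφ)
  · have h1 : G.symm (𝓥.s a * u) = 𝓤.s (f.symm a) * G.symm u := by
      apply h.1
      rw [hG, hF.map_mul, hF.map_s, hG]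
      simp
    change f (φ.val (G.symm _)) = a * f (φ.val (G.symm u))
    rw [h1, φ.val_s]
    simp
  · change f.symm (f (φ.val (G.symm (F u)))) = φ.val u
    rw [f.symm_apply_apply]
    exact congrArg φ.val (G.symm_apply_apply u)

end IsHom

end LeftBialgebroid

/-- Finite projectivity is transported along a semilinear bijection. -/
lemma IsFGProjective.of_equiv {R R' U U' : Type*} [Ring R] [Ring R'] [Ring U] [Ring U']
    {i : R →+* U} {i' : R' →+* U'} (h : IsFGProjective i) (e : R ≃+* R') (F : U ≃+ U')
    (hF : ∀ r u, F (i r * u) = i' (e r) * F u) : IsFGProjective i' := by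
  let _ : Module R U := Module.compHom U i
  let _ : Module R' U' := Module.compHom U' i'
  obtain ⟨h1, h2⟩ : Module.Finite R U ∧ Module.Projective R U := h
  let _ : RingHomInvPair (e : R →+* R') (e.symm : R' →+* R) := RingHomInvPair.of_ringEquiv e
  let _ : RingHomInvPair (e.symm : R' →+* R) (e : R →+* R') :=
    RingHomInvPair.of_ringEquiv e.symm
  let G : U ≃ₛₗ[(e : R →+* R')] U' := { F with map_smul' := hF }
  exact ⟨Module.Finite.of_surjective G.toLinearMap G.surjective, Module.Projective.of_equiv G⟩

namespace RightBialgebroid.IsHom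

variable {k B H B' H' B'' H'' : Type*} [CommRing k] [Ring B] [Algebra k B] [Ring H]
  [Algebra k H] [Ring B'] [Algebra k B'] [Ring H'] [Algebra k H'] [Ring B''] [Algebra k B'']
  [Ring H''] [Algebra k H''] {𝓗 : RightBialgebroid k B H} {𝓚 : RightBialgebroid k B' H'}
  {𝓛 : RightBialgebroid k B'' H''} {F : H →ₗ[k] H'} {f : B →ₐ[k] B'}

lemma comp {G : H' →ₗ[k] H''} {g : B' →ₐ[k] B''} (hG : 𝓚.IsHom 𝓛 G g) (hF : 𝓗.IsHom 𝓚 F f) :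
    𝓗.IsHom 𝓛 (G ∘ₗ F) (g.comp f) where
  map_one := by simp [hF.map_one, hG.map_one]
  map_mul := by simp [hF.map_mul, hG.map_mul]
  map_s := by simp [hF.map_s, hG.map_s]
  map_t := by simp [hF.map_t, hG.map_t]
  map_counit := by simp [hF.map_counit, hG.map_counit]
  map_comul h x hx := by
    rw [TensorProduct.map_comp]
    exact hG.map_comul _ _ (hF.map_comul h x hx).symm

lemma symm {F : H ≃ₗ[k] H'} {f : B ≃ₐ[k] B'} (hF : 𝓗.IsHom 𝓚 F.toLinearMap (f : B →ₐ[k] B')) :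
    𝓚.IsHom 𝓗 F.symm.toLinearMap (f.symm : B' →ₐ[k] B) where
  map_one := F.symm_apply_eq.2 hF.map_one.symm
  map_mul u v := F.symm_apply_eq.2 (by
    refine Eq.trans ?_ (hF.map_mul _ _).symm
    simp)
  map_s a := F.symm_apply_eq.2 (by
    refine Eq.trans ?_ (hF.map_s _).symm
    simp)
  map_t a := F.symm_apply_eq.2 (by
    refine Eq.trans ?_ (hF.map_t _).symm
    simp)
  map_counit h := (f.symm_apply_eq.2 (by
    refine Eq.trans ?_ (hF.map_counit _)
    simp)).symm
  map_comul h x hx := by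
    have hbal : 𝓚.Bal fun c d => balMk (mulR k 𝓗.s) (mulR k fun b => 𝓗.t (op b))
        (F.symm c ⊗ₜ[k] F.symm d) :=
      .mk' (by intros; simp only [map_add, TensorProduct.add_tmul])
        (by intros; simp only [map_add, TensorProduct.tmul_add]) (by
          intro b m n
          have h1 : F.symm (m * 𝓚.s b) = F.symm m * 𝓗.s (f.symm b) := F.symm_apply_eq.2 (by
            refine Eq.trans ?_ (hF.map_mul _ _).symm
            rw [hF.map_s]
            simp)
          have h2 : F.symm (n * 𝓚.t (op b)) = F.symm n * 𝓗.t (op (f.symm b)) :=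
            F.symm_apply_eq.2 (by
              refine Eq.trans ?_ (hF.map_mul _ _).symm
              rw [hF.map_t]
              simp)
          rw [h1, h2]
          exact balMk_rel (mulR k 𝓗.s) (mulR k fun b => 𝓗.t (op b)) _ _ _)
    obtain ⟨n, m, m', hm⟩ := exists_balRep (𝓗.Δ (F.symm h))
    have h1 := hF.map_comul _ _ hm
    rw [LinearEquiv.coe_coe, F.apply_symm_apply, ← hx] at h1
    obtain ⟨n', p, p', rfl⟩ := TensorProduct.exists_sum_tmul_eq x
    have h2 := congrArg hbal.lift h1
    simp only [map_sum, TensorProduct.map_tmul] at h2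
    simp only [map_sum, TensorProduct.map_tmul]
    refine Eq.trans ?_ h2.symm
    rw [LinearEquiv.coe_coe, ← hm, map_sum]
    refine Finset.sum_congr rfl fun i _ => ?_
    refine Eq.trans ?_ (hbal.lift_tmul _ _).symm
    simp

end RightBialgebroid.IsHom

namespace HopfAlgebroid

variable {k A B H Q : Type*} [CommRing k] [Ring A] [Algebra k A] [Ring B] [Algebra k B] [Ring H]
  [Algebra k H] [AddCommGroup Q] (𝓗 : HopfAlgebroid k A B H)

lemma bal_galoisInv_aux (v : H) : 𝓗.right.Bal fun p q =>
    balMk (mulR k fun a => 𝓗.left.t (op a)) (mulL k fun a => 𝓗.left.t (op a))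
      (p ⊗ₜ[k] (𝓗.S q * v)) :=
  .mk' (by intros; simp only [TensorProduct.add_tmul, map_add])
    (by intros; simp only [add_mul, TensorProduct.tmul_add, map_add]) (by
      intro b p q
      obtain ⟨a, ha⟩ := 𝓗.exists_left_t b
      rw [antipode_mul_t, ha, mul_assoc]
      exact balMk_rel (mulR k fun a => 𝓗.left.t (op a)) (mulL k fun a => 𝓗.left.t (op a)) a p _)

lemma bal_galoisInv : 𝓗.left.Bal fun u v => balSum (𝓗.right.Δ u) fun p q =>
    balMk (mulR k fun a => 𝓗.left.t (op a)) (mulL k fun a => 𝓗.left.t (op a))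
      (p ⊗ₜ[k] (𝓗.S q * v)) :=
  .mk' (by intro u u' v; rw [map_add, (𝓗.bal_galoisInv_aux v).balSum_add])
    (by intros; simp only [mul_add, TensorProduct.tmul_add, map_add, balSum_fun_add]) (by
      intro a u v
      obtain ⟨b, hb⟩ := 𝓗.exists_right_s a
      rw [hb, 𝓗.right.balSum_comul_s_mul (𝓗.bal_galoisInv_aux v)]
      simp only [← hb, antipode_t_mul, mul_assoc])

lemma hopfGalois_balSum (u v : H) : 𝓗.left.hopfGalois (balSum (𝓗.right.Δ u) fun p q =>
    balMk _ _ (p ⊗ₜ[k] (𝓗.S q * v))) = balMk _ _ (u ⊗ₜ v) := by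
  rw [map_balSum]
  simp only [LeftBialgebroid.hopfGalois_tmul, LeftBialgebroid.sqMulRight_comul, ← mul_assoc]
  rw [𝓗.coassoc_lr_balSum (f := fun c d q =>
    balMk (mulL k fun a => 𝓗.left.t (op a)) (mulL k 𝓗.left.s) (c ⊗ₜ[k] (d * 𝓗.S q * v)))]
  · have h2 : ∀ c d, (balSum (𝓗.right.Δ d) fun p q => balMk (mulL k fun a => 𝓗.left.t (op a))
        (mulL k 𝓗.left.s) (c ⊗ₜ[k] (p * 𝓗.S q * v))) =
        balMk _ _ ((𝓗.left.t (op (𝓗.left.ε d)) * c) ⊗ₜ[k] v) := fun c d => by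
      refine (map_balSum (balMk (mulL k fun a => 𝓗.left.t (op a)) (mulL k 𝓗.left.s) ∘ₗ
        TensorProduct.mk k H H c ∘ₗ LinearMap.mulRight k v) _ _).symm.trans ?_
      rw [balSum_antipode_right]
      exact (balMk_rel (mulL k fun a => 𝓗.left.t (op a)) (mulL k 𝓗.left.s) _ _ _).symm
    simp only [h2]
    conv_rhs => rw [← 𝓗.left.balSum_counit_right u]
    exact (map_balSum (balMk (mulL k fun a => 𝓗.left.t (op a)) (mulL k 𝓗.left.s) ∘ₗ
      (TensorProduct.mk k H H).flip v) _ _).symm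
  · exact fun q => .mk' (by intros; simp only [TensorProduct.add_tmul, map_add])
      (by intros; simp only [add_mul, TensorProduct.tmul_add, map_add]) (by
        intro a c d
        simp only [mul_assoc]
        exact balMk_rel (mulL k fun a => 𝓗.left.t (op a)) (mulL k 𝓗.left.s) a c _)
  · exact fun c => .mk' (by intros; simp only [add_mul, TensorProduct.tmul_add, map_add])
      (by intros; simp only [map_add, mul_add, add_mul, TensorProduct.tmul_add])
      (by intro b p q; simp only [antipode_mul_t, mul_assoc])

/-- `H^ℓ` is a left Hopf algebroid, with `α_ℓ⁻¹(u ⊗ v) = u⁽¹⁾ ⊗ S(u⁽²⁾) v`. -/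
lemma left_isLeftHopf : 𝓗.left.IsLeftHopf := by
  refine LeftBialgebroid.hopfGalois_bijective_of_inverse 𝓗.bal_galoisInv.lift (fun u v => ?_)
    fun u v => ?_
  · rw [LeftBialgebroid.hopfGalois_tmul, LeftBialgebroid.sqMulRight_comul, map_balSum]
    simp only [IsBal.lift_tmul, ← mul_assoc]
    rw [𝓗.coassoc_rl_balSum (f := fun p q d =>
      balMk (mulR k fun a => 𝓗.left.t (op a)) (mulL k fun a => 𝓗.left.t (op a))
        (p ⊗ₜ[k] (𝓗.S q * d * v)))]
    · have h2 : ∀ a b, (balSum (𝓗.left.Δ b) fun c d =>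
          balMk (mulR k fun a => 𝓗.left.t (op a)) (mulL k fun a => 𝓗.left.t (op a))
            (a ⊗ₜ[k] (𝓗.S c * d * v))) =
          balMk _ _ ((a * 𝓗.right.s (𝓗.right.counit b)) ⊗ₜ[k] v) := fun a b => by
        refine (map_balSum (balMk (mulR k fun a => 𝓗.left.t (op a))
          (mulL k fun a => 𝓗.left.t (op a)) ∘ₗ
          TensorProduct.mk k H H a ∘ₗ LinearMap.mulRight k v) _ _).symm.trans ?_
        rw [balSum_antipode_left]
        obtain ⟨c, hc⟩ := 𝓗.exists_left_t (𝓗.right.counit b)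
        rw [hc]
        exact (balMk_rel (mulR k fun a => 𝓗.left.t (op a)) (mulL k fun a => 𝓗.left.t (op a))
          _ _ _).symm
      simp only [h2]
      conv_rhs => rw [← 𝓗.right.balSum_counit_right u]
      exact (map_balSum (balMk (mulR k fun a => 𝓗.left.t (op a))
        (mulL k fun a => 𝓗.left.t (op a)) ∘ₗ (TensorProduct.mk k H H).flip v) _ _).symm
    · intro d
      simpa only [mul_assoc] using 𝓗.bal_galoisInv_aux (d * v)
    · exact fun p => .mk' (by intros; simp only [map_add, add_mul, TensorProduct.tmul_add])
        (by intros; simp only [mul_add, add_mul, TensorProduct.tmul_add, map_add])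
        (by intros; simp only [antipode_t_mul, mul_assoc])
  · rw [IsBal.lift_tmul, hopfGalois_balSum]

lemma left_translation (h : 𝓗.left.IsLeftHopf) (u : H) : h.translation u =
    balSum (𝓗.right.Δ u) fun p q => balMk _ _ (p ⊗ₜ[k] 𝓗.S q) := by
  apply h.1
  rw [h.hopfGalois_translation, ← hopfGalois_balSum]
  simp only [mul_one]

lemma opCoop_balMk_rel (b : B) (u v : H) :
    balMk (mulL k fun a => 𝓗.right.opCoop.t (op a)) (mulL k 𝓗.right.opCoop.s)
      (op (u * 𝓗.right.t (op b)) ⊗ₜ[k] op v) =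
    balMk (mulL k fun a => 𝓗.right.opCoop.t (op a)) (mulL k 𝓗.right.opCoop.s)
      (op u ⊗ₜ[k] op (v * 𝓗.right.s b)) :=
  balMk_rel (mulL k fun a => 𝓗.right.opCoop.t (op a)) (mulL k 𝓗.right.opCoop.s) (op b) (op u)
    (op v)

lemma opCoop_balMk_galois_rel (b : B) (u v : H) :
    balMk (mulR k fun a => 𝓗.right.opCoop.t (op a)) (mulL k fun a => 𝓗.right.opCoop.t (op a))
      (op (𝓗.right.t (op b) * u) ⊗ₜ[k] op v) =
    balMk (mulR k fun a => 𝓗.right.opCoop.t (op a)) (mulL k fun a => 𝓗.right.opCoop.t (op a))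
      (op u ⊗ₜ[k] op (v * 𝓗.right.t (op b))) :=
  balMk_rel (mulR k fun a => 𝓗.right.opCoop.t (op a)) (mulL k fun a => 𝓗.right.opCoop.t (op a))
    (op b) (op u) (op v)

lemma bal_opCoop_galoisInv_aux (v : H) : 𝓗.left.Bal fun c d =>
    balMk (mulR k fun a => 𝓗.right.opCoop.t (op a)) (mulL k fun a => 𝓗.right.opCoop.t (op a))
      (op d ⊗ₜ[k] op (v * 𝓗.S c)) :=
  .mk' (by intros; simp only [map_add, mul_add, op_add, TensorProduct.tmul_add])
    (by intros; simp only [op_add, TensorProduct.add_tmul, map_add]) (by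
      intro a c d
      obtain ⟨b, hb⟩ := 𝓗.exists_right_t a
      rw [antipode_t_mul, hb, opCoop_balMk_galois_rel, mul_assoc])

lemma bal_opCoop_galoisInv : 𝓗.right.opCoop.Bal fun u v =>
    balSum (𝓗.left.Δ (unop u)) fun c d =>
      balMk (mulR k fun a => 𝓗.right.opCoop.t (op a)) (mulL k fun a => 𝓗.right.opCoop.t (op a))
        (op d ⊗ₜ[k] op (unop v * 𝓗.S c)) :=
  .mk' (by intro u u' v; rw [unop_add, map_add, (𝓗.bal_opCoop_galoisInv_aux _).balSum_add])
    (by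
      intros
      simp only [unop_add, add_mul, op_add, TensorProduct.tmul_add, map_add, balSum_fun_add]) (by
      intro b u v
      obtain ⟨a, ha⟩ := 𝓗.exists_left_s (unop b)
      have h1 : unop (𝓗.right.opCoop.t (op b) * u) = unop u * 𝓗.left.s a := by rw [← ha]; rfl
      have h2 : unop (𝓗.right.opCoop.s b * v) = unop v * 𝓗.right.s (unop b) := rfl
      rw [h1, h2, 𝓗.left.balSum_comul_mul_s (𝓗.bal_opCoop_galoisInv_aux _)]
      simp only [← ha, antipode_mul_t, mul_assoc])

lemma opCoop_hopfGalois_tmul (u v : H) : 𝓗.right.opCoop.hopfGalois (balMk _ _ (op u ⊗ₜ op v)) =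
    balSum (𝓗.right.Δ u) fun p q => balMk _ _ (op q ⊗ₜ op (v * p)) := by
  rw [LeftBialgebroid.hopfGalois_tmul, LeftBialgebroid.sqMulRight_comul,
    RightBialgebroid.balSum_opΔ]
  · rfl
  · exact .mk' (by intros; simp only [TensorProduct.add_tmul, map_add])
      (by intros; simp only [add_mul, TensorProduct.tmul_add, map_add]) (by
        intro a c d
        simp only [mul_assoc]
        exact balMk_rel (mulL k fun a => 𝓗.right.opCoop.t (op a)) (mulL k 𝓗.right.opCoop.s) a c _)

lemma opCoop_hopfGalois_balSum (u v : H) :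
    𝓗.right.opCoop.hopfGalois (balSum (𝓗.left.Δ u) fun c d =>
      balMk _ _ (op d ⊗ₜ[k] op (v * 𝓗.S c))) = balMk _ _ (op u ⊗ₜ op v) := by
  rw [map_balSum]
  simp only [opCoop_hopfGalois_tmul, mul_assoc]
  rw [← 𝓗.coassoc_lr_balSum (f := fun c p q =>
    balMk (mulL k fun a => 𝓗.right.opCoop.t (op a)) (mulL k 𝓗.right.opCoop.s)
      (op q ⊗ₜ[k] op (v * (𝓗.S c * p))))]
  · have h2 : ∀ a b, (balSum (𝓗.left.Δ a) fun c d =>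
        balMk (mulL k fun a => 𝓗.right.opCoop.t (op a)) (mulL k 𝓗.right.opCoop.s)
          (op b ⊗ₜ[k] op (v * (𝓗.S c * d)))) =
        balMk _ _ (op (b * 𝓗.right.t (op (𝓗.right.counit a))) ⊗ₜ[k] op v) := fun a b => by
      refine (map_balSum (balMk (mulL k fun a => 𝓗.right.opCoop.t (op a))
        (mulL k 𝓗.right.opCoop.s) ∘ₗ TensorProduct.mk k Hᵐᵒᵖ Hᵐᵒᵖ (op b) ∘ₗ
        (opLinearEquiv k).toLinearMap ∘ₗ LinearMap.mulLeft k v) _ _).symm.trans ?_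
      rw [balSum_antipode_left, opCoop_balMk_rel]
      rfl
    simp only [h2]
    conv_rhs => rw [← 𝓗.right.balSum_counit_left u]
    exact (map_balSum (balMk (mulL k fun a => 𝓗.right.opCoop.t (op a))
      (mulL k 𝓗.right.opCoop.s) ∘ₗ (TensorProduct.mk k Hᵐᵒᵖ Hᵐᵒᵖ).flip (op v) ∘ₗ
      (opLinearEquiv k).toLinearMap) _ _).symm
  · exact fun q => .mk'
      (by intros; simp only [map_add, add_mul, mul_add, op_add, TensorProduct.tmul_add])
      (by intros; simp only [mul_add, op_add, TensorProduct.tmul_add, map_add])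
      (by intros; simp only [antipode_t_mul, mul_assoc])
  · exact fun c => .mk' (by intros; simp only [mul_add, op_add, TensorProduct.tmul_add, map_add])
      (by intros; simp only [op_add, TensorProduct.add_tmul, map_add])
      (by intro b p q; rw [opCoop_balMk_rel]; simp only [mul_assoc])

/-- `(H^r)^op_coop` is a left Hopf algebroid. -/
lemma opCoop_isLeftHopf : 𝓗.right.opCoop.IsLeftHopf := by
  refine LeftBialgebroid.hopfGalois_bijective_of_inverse 𝓗.bal_opCoop_galoisInv.lift
    (fun u v => ?_) fun u v => ?_
  · obtain ⟨u, rfl⟩ := op_surjective u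
    obtain ⟨v, rfl⟩ := op_surjective v
    rw [opCoop_hopfGalois_tmul, map_balSum]
    simp only [IsBal.lift_tmul, unop_op, mul_assoc]
    rw [← 𝓗.coassoc_rl_balSum (f := fun p c d =>
      balMk (mulR k fun a => 𝓗.right.opCoop.t (op a)) (mulL k fun a => 𝓗.right.opCoop.t (op a))
        (op d ⊗ₜ[k] op (v * (p * 𝓗.S c))))]
    · have h2 : ∀ c d, (balSum (𝓗.right.Δ c) fun p q =>
          balMk (mulR k fun a => 𝓗.right.opCoop.t (op a))
            (mulL k fun a => 𝓗.right.opCoop.t (op a))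
            (op d ⊗ₜ[k] op (v * (p * 𝓗.S q)))) =
          balMk _ _ (op (𝓗.left.s (𝓗.left.ε c) * d) ⊗ₜ[k] op v) := fun c d => by
        refine (map_balSum (balMk (mulR k fun a => 𝓗.right.opCoop.t (op a))
          (mulL k fun a => 𝓗.right.opCoop.t (op a)) ∘ₗ TensorProduct.mk k Hᵐᵒᵖ Hᵐᵒᵖ (op d) ∘ₗ
          (opLinearEquiv k).toLinearMap ∘ₗ LinearMap.mulLeft k v) _ _).symm.trans ?_
        obtain ⟨b, hb⟩ := 𝓗.exists_right_t (𝓗.left.ε c)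
        rw [balSum_antipode_right, hb, opCoop_balMk_galois_rel]
        rfl
      simp only [h2]
      conv_rhs => rw [← 𝓗.left.balSum_counit_left u]
      exact (map_balSum (balMk (mulR k fun a => 𝓗.right.opCoop.t (op a))
        (mulL k fun a => 𝓗.right.opCoop.t (op a)) ∘ₗ
        (TensorProduct.mk k Hᵐᵒᵖ Hᵐᵒᵖ).flip (op v) ∘ₗ
        (opLinearEquiv k).toLinearMap) _ _).symm
    · exact fun d => .mk'
        (by intros; simp only [add_mul, mul_add, op_add, TensorProduct.tmul_add, map_add])
        (by intros; simp only [map_add, mul_add, op_add, TensorProduct.tmul_add])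
        (by intros; simp only [antipode_mul_t, mul_assoc])
    · intro p
      simpa only [mul_assoc] using 𝓗.bal_opCoop_galoisInv_aux (v * p)
  · rw [IsBal.lift_tmul]
    exact 𝓗.opCoop_hopfGalois_balSum (unop u) (unop v)

end HopfAlgebroid

namespace LeftBialgebroid

variable {k A U : Type*} [CommRing k] [Ring A] [Algebra k A] [Ring U] [Algebra k U]
  (𝓤 : LeftBialgebroid k A U)

lemma rContr_comul (φ : 𝓤.RDual) (u : U) :
    𝓤.rContr φ (𝓤.Δ u) = balSum (𝓤.Δ u) fun c d => 𝓤.s (φ.val c) * d := by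
  conv_lhs => rw [← balSum_balMk (𝓤.Δ u), map_balSum]
  exact balSum_congr fun c d => 𝓤.rContr_tmul _ _ _

lemma lContr_comul (φ : 𝓤.LDual) (u : U) :
    𝓤.lContr φ (𝓤.Δ u) = balSum (𝓤.Δ u) fun c d => 𝓤.t (op (φ.val d)) * c := by
  conv_lhs => rw [← balSum_balMk (𝓤.Δ u), map_balSum]
  exact balSum_congr fun c d => 𝓤.lContr_tmul _ _ _

end LeftBialgebroid

namespace HopfAlgebroid

variable {k A B H Q : Type*} [CommRing k] [Ring A] [Algebra k A] [Ring B] [Algebra k B] [Ring H]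
  [Algebra k H] [AddCommGroup Q] (𝓗 : HopfAlgebroid k A B H)

/-- The map `u ↦ u₊ t(φ(u₋)) = u⁽¹⁾ t(φ(S(u⁽²⁾)))`. -/
noncomputable def dualAct (φ : 𝓗.left.RDual) (u : H) : H :=
  balSum (𝓗.right.Δ u) fun p q => p * 𝓗.left.t (op (φ.val (𝓗.S q)))

lemma bal_dualAct (φ : 𝓗.left.RDual) :
    𝓗.right.Bal fun p q => p * 𝓗.left.t (op (φ.val (𝓗.S q))) :=
  .mk' (by intros; simp only [add_mul]) (by intros; simp only [map_add, op_add, mul_add]) (by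
    intro b p q
    obtain ⟨a, ha⟩ := 𝓗.exists_left_t b
    rw [antipode_mul_t, ha, φ.val_t, op_mul, map_mul, mul_assoc])

lemma dualS_val (h : 𝓗.left.IsLeftHopf) (φ : 𝓗.left.RDual) (u : H) :
    (h.dualS φ).val u = 𝓗.left.ε (𝓗.dualAct φ u) := by
  change 𝓗.left.evalS φ (h.translation u) = _
  rw [left_translation, map_balSum, dualAct, map_balSum]
  rfl

lemma lContr_dualS (h : 𝓗.left.IsLeftHopf) (φ : 𝓗.left.RDual) (u : H) :
    𝓗.left.lContr (h.dualS φ) (𝓗.left.Δ u) = 𝓗.dualAct φ u := by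
  rw [LeftBialgebroid.lContr_comul]
  simp only [dualS_val]
  have h1 : ∀ c d, 𝓗.left.t (op (𝓗.left.ε (𝓗.dualAct φ d))) * c = balSum (𝓗.right.Δ d)
      fun p q => 𝓗.left.t (op (𝓗.left.ε (p * 𝓗.left.t (op (φ.val (𝓗.S q)))))) * c :=
    fun c d => map_balSum (LinearMap.mulRight k c ∘ₗ 𝓗.left.t.toLinearMap ∘ₗ
      (opLinearEquiv k).toLinearMap ∘ₗ 𝓗.left.ε) _ _
  simp only [h1]
  have h2 : ∀ x : H, 𝓗.left.Bal fun c p => 𝓗.left.t (op (𝓗.left.ε (p * x))) * c := fun x =>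
    .mk' (by intros; simp only [mul_add])
      (by intros; simp only [add_mul, map_add, op_add]) (by
        intro a c p
        rw [mul_assoc, 𝓗.left.counit_s_mul, op_mul, map_mul 𝓗.left.t, mul_assoc])
  rw [← 𝓗.coassoc_lr_balSum (f := fun c p q =>
    𝓗.left.t (op (𝓗.left.ε (p * 𝓗.left.t (op (φ.val (𝓗.S q)))))) * c)]
  · refine balSum_congr fun p q => ?_
    conv_rhs => rw [← 𝓗.left.balSum_counit_right (p * _), 𝓗.left.balSum_comul_mul_t (by
      simpa only [mul_one] using h2 1)]
  · exact fun q => h2 _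
  · intro c
    have h3 := 𝓗.bal_dualAct φ
    exact .mk' (by intros; simp only [add_mul, map_add, op_add])
      (by intros; simp only [map_add, op_add, mul_add, add_mul]) (by
        intro b p q
        rw [show p * 𝓗.right.s b * _ = _ from h3.bal b p q]
        rfl)

lemma dualAct_eq_balSum (h : 𝓗.left.IsLeftHopf) (φ : 𝓗.left.RDual) (u : H) :
    𝓗.dualAct φ u = balSum (𝓗.left.Δ u) fun c d => 𝓗.left.t (op ((h.dualS φ).val d)) * c := by
  rw [← lContr_dualS, LeftBialgebroid.lContr_comul]

/-- `Δ_r` commutes with `dualAct`. -/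
lemma balSum_right_comul_dualAct (h : 𝓗.left.IsLeftHopf) (φ : 𝓗.left.RDual) {f : H → H → Q}
    (hf : 𝓗.right.Bal f) (u : H) : balSum (𝓗.right.Δ (𝓗.dualAct φ u)) f =
      balSum (𝓗.right.Δ u) fun p q => f p (𝓗.dualAct φ q) := by
  have hadd : ∀ (m : H) (z) (g : H → H → H), f m (balSum (𝓗.left.Δ z) g) =
      balSum (𝓗.left.Δ z) fun c d => f m (g c d) := fun m z g =>
    map_balSum (AddMonoidHom.mk' (f m) (hf.add_right m)) _ _
  have hadd' : ∀ (z) (g : H → H → H), balSum (𝓗.right.Δ (balSum (𝓗.left.Δ z) g)) f =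
      balSum (𝓗.left.Δ z) fun c d => balSum (𝓗.right.Δ (g c d)) f := fun z g =>
    map_balSum (AddMonoidHom.mk' (fun x => balSum (𝓗.right.Δ x) f)
      fun x y => by rw [map_add, hf.balSum_add]) _ _
  simp only [𝓗.dualAct_eq_balSum h, hadd, hadd']
  rw [← 𝓗.coassoc_rl_balSum (f := fun p c d =>
    f p (𝓗.left.t (op ((h.dualS φ).val d)) * c))]
  · refine balSum_congr fun c d => ?_
    obtain ⟨b, hb⟩ := 𝓗.exists_right_s ((h.dualS φ).val d)
    rw [hb, 𝓗.right.balSum_comul_s_mul hf]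
  · exact fun d => .mk' (by intros; simp only [hf.add_left])
      (by intros; simp only [mul_add, hf.add_right]) (by
        intro b m n
        rw [← mul_assoc]
        exact hf.bal b _ _)
  · exact fun p => .mk' (by intros; simp only [mul_add, hf.add_right])
      (by intros; simp only [map_add, op_add, add_mul, hf.add_right]) (by
        intro a c d
        rw [LeftBialgebroid.LDual.val_s, op_mul, map_mul, mul_assoc])

lemma val_antipode (φ : 𝓗.left.RDual) (u : H) :
    φ.val (𝓗.S u) = 𝓗.left.ε (𝓗.S (𝓗.dualAct φ u)) := by
  rw [dualAct, map_balSum, map_balSum]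
  conv_lhs => rw [← 𝓗.right.balSum_counit_left u, map_balSum, map_balSum]
  refine balSum_congr fun p q => ?_
  rw [antipode_mul_left_t, 𝓗.left.counit_s_mul, left_counit_antipode, antipode_mul_t]
  obtain ⟨a, ha⟩ := 𝓗.exists_left_t (𝓗.right.counit p)
  rw [ha, φ.val_t, 𝓗.left.counit_t]

lemma antipode_dualAct (h : 𝓗.left.IsLeftHopf) (φ : 𝓗.left.RDual) (u : H) :
    𝓗.S (𝓗.dualAct φ u) = balSum (𝓗.left.Δ u) fun c d =>
      𝓗.S c * 𝓗.left.s ((h.dualS φ).val d) := by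
  rw [𝓗.dualAct_eq_balSum h, map_balSum]
  simp only [antipode_t_mul]

section Bijective

variable {T : H →ₗ[k] H} (hT : ∀ u, T (𝓗.S u) = u) (hT' : ∀ u, 𝓗.S (T u) = u)
include hT hT'

lemma antipodeInv_mul_s (x : H) (b : B) :
    T (x * 𝓗.right.s b) = 𝓗.right.t (op b) * T x := by
  rw [← hT (_ * T x), antipode_right_t_mul, hT']

lemma bal_dualActInv (ψ : 𝓗.left.LDual) (x : H) :
    𝓗.right.Bal fun p q => q * 𝓗.left.s (ψ.val (T p)) * x :=
  .mk' (by intros; simp only [map_add, mul_add, add_mul]) (by intros; simp only [add_mul]) (by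
    intro b p q
    obtain ⟨a, ha⟩ := 𝓗.exists_left_s b
    rw [𝓗.antipodeInv_mul_s hT hT', ha, ψ.val_s, map_mul]
    simp only [mul_assoc])

lemma antipode_dualAct_antipodeInv (h : 𝓗.left.IsLeftHopf) (φ : 𝓗.left.RDual) (w : H) :
    𝓗.S (𝓗.dualAct φ (T w)) =
      balSum (𝓗.right.Δ w) fun p q => q * 𝓗.left.s ((h.dualS φ).val (T p)) := by
  have hb := 𝓗.bal_dualActInv hT hT' (h.dualS φ) 1
  simp only [mul_one] at hb
  conv_rhs => rw [← hT' w, 𝓗.balSum_right_comul_antipode hb]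
  simp only [hT, 𝓗.antipode_dualAct h]

/-- `s(φ(w₁)) w₂ = S(dualAct φ (S⁻¹ w))`. -/
lemma rContr_comul_eq (h : 𝓗.left.IsLeftHopf) (φ : 𝓗.left.RDual) (w : H) :
    𝓗.left.rContr φ (𝓗.left.Δ w) = 𝓗.S (𝓗.dualAct φ (T w)) := by
  have hφ : ∀ w, φ.val w = 𝓗.left.ε (𝓗.S (𝓗.dualAct φ (T w))) := fun w => by
    rw [← val_antipode, hT']
  simp only [LeftBialgebroid.rContr_comul, hφ, 𝓗.antipode_dualAct_antipodeInv hT hT' h]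
  have h1 : ∀ c d, 𝓗.left.s (𝓗.left.ε (balSum (𝓗.right.Δ c) fun p q =>
      q * 𝓗.left.s ((h.dualS φ).val (T p)))) * d = balSum (𝓗.right.Δ c) fun p q =>
      𝓗.left.s (𝓗.left.ε (q * 𝓗.left.s ((h.dualS φ).val (T p)))) * d := fun c d =>
    map_balSum (LinearMap.mulRight k d ∘ₗ 𝓗.left.s.toLinearMap ∘ₗ 𝓗.left.ε) _ _
  simp only [h1]
  have h2 : ∀ x : H, 𝓗.left.Bal fun c d => 𝓗.left.s (𝓗.left.ε (c * x)) * d := fun x =>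
    .mk' (by intros; simp only [add_mul, map_add]) (by intros; simp only [mul_add]) (by
      intro a c d
      rw [mul_assoc, 𝓗.left.counit_t_mul, map_mul, mul_assoc])
  rw [𝓗.coassoc_rl_balSum (f := fun p c d =>
    𝓗.left.s (𝓗.left.ε (c * 𝓗.left.s ((h.dualS φ).val (T p)))) * d)]
  · refine balSum_congr fun p q => ?_
    conv_rhs => rw [← 𝓗.left.balSum_counit_left (q * _), 𝓗.left.balSum_comul_mul_s (by
      simpa only [mul_one] using h2 1)]
  · intro d
    have h3 := 𝓗.bal_dualActInv hT hT' (h.dualS φ) 1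
    simp only [mul_one] at h3
    exact .mk' (by intros; simp only [add_mul, mul_add, map_add])
      (by intros; simp only [map_add, add_mul]) (by
        intro b p q
        exact congrArg (fun x => 𝓗.left.s (𝓗.left.ε x) * d) (h3.bal b p q))
  · exact fun p => h2 _

/-- `S^*` is multiplicative if the antipode is bijective. -/
lemma dualS_mul (h : 𝓗.left.IsLeftHopf) (φ ψ : 𝓗.left.RDual) :
    h.dualS (φ * ψ) = h.dualS φ * h.dualS ψ := by
  refine LeftBialgebroid.LDual.ext fun u => ?_
  rw [LeftBialgebroid.lMul_val_contr, lContr_dualS, dualS_val, dualS_val]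
  congr 1
  conv_rhs => rw [dualAct, 𝓗.balSum_right_comul_dualAct h φ (𝓗.bal_dualAct ψ)]
  refine balSum_congr fun p q => ?_
  rw [LeftBialgebroid.rMul_val_contr, 𝓗.rContr_comul_eq hT hT' h, hT]

end Bijective

lemma dualAct_one (φ : 𝓗.left.RDual) : 𝓗.dualAct φ 1 = 𝓗.left.t (op (φ.val 1)) := by
  rw [dualAct, 𝓗.right.balSum_comul_one (𝓗.bal_dualAct φ), antipode_one, one_mul]

lemma dualAct_mul_s (φ : 𝓗.left.RDual) (u : H) (a : A) : 𝓗.dualAct φ (u * 𝓗.left.s a) =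
    balSum (𝓗.right.Δ u) fun p q => p * 𝓗.left.s a * 𝓗.left.t (op (φ.val (𝓗.S q))) := by
  obtain ⟨b, hb⟩ := 𝓗.exists_right_t a
  rw [hb, dualAct, 𝓗.right.balSum_comul_mul_t (𝓗.bal_dualAct φ)]

/-- The coproduct of `S^*(φ)`. -/
lemma dualS_val_mul (h : 𝓗.left.IsLeftHopf) (φ : 𝓗.left.RDual) {n : ℕ}
    (φ₁ φ₂ : Fin n → 𝓗.left.RDual)
    (hφ : ∀ u v, ∑ i, (φ₁ i).val (u * 𝓗.left.t (op ((φ₂ i).val v))) = φ.val (u * v)) (u v : H) :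
    ∑ i, (h.dualS (φ₂ i)).val (u * 𝓗.left.s ((h.dualS (φ₁ i)).val v)) =
      (h.dualS φ).val (u * v) := by
  simp only [dualS_val]
  rw [dualAct, 𝓗.right.balSum_comul_mul (𝓗.bal_dualAct φ), map_balSum]
  simp only [dualAct_mul_s, map_balSum]
  rw [sum_balSum]
  refine balSum_congr fun p q => ?_
  have h1 : ∀ i, 𝓗.left.ε (p * 𝓗.left.s (𝓗.left.ε (𝓗.dualAct (φ₁ i) v)) *
      𝓗.left.t (op ((φ₂ i).val (𝓗.S q)))) = balSum (𝓗.right.Δ v) fun c d =>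
      𝓗.left.ε (p * c * 𝓗.left.t (op ((φ₁ i).val
        (𝓗.S d * 𝓗.left.t (op ((φ₂ i).val (𝓗.S q))))))) := fun i => by
    rw [mul_assoc, 𝓗.left.s_mul_t, ← mul_assoc, ← 𝓗.left.counit_mul_s, dualAct, mul_balSum,
      map_balSum]
    obtain ⟨b, hb⟩ := 𝓗.exists_right_s ((φ₂ i).val (𝓗.S q))
    have hbal : 𝓗.right.Bal fun c d =>
        𝓗.left.ε (p * (c * 𝓗.left.t (op ((φ₁ i).val (𝓗.S d))))) :=
      .mk' (by intros; simp only [add_mul, mul_add, map_add])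
        (by intros; simp only [map_add, op_add, mul_add]) (by
          intro b c d
          exact congrArg (fun x => 𝓗.left.ε (p * x)) ((𝓗.bal_dualAct (φ₁ i)).bal b c d))
    have h2 := 𝓗.right.balSum_takeuchi hbal b v
    simp only [antipode_right_t_mul] at h2
    simp only [hb, mul_assoc] at h2 ⊢
    exact h2
  simp only [h1]
  rw [sum_balSum]
  refine balSum_congr fun c d => ?_
  rw [antipode_mul, ← hφ, ← map_sum]
  congr 1
  rw [← Finset.mul_sum, Finset.op_sum, map_sum]

/-- If the antipode is bijective, then `S^*` is a morphism of right bialgebroids. -/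
lemma isHom_dualS (hS : Function.Bijective 𝓗.S) (h : 𝓗.left.IsLeftHopf)
    (hL : 𝓗.left.LeftFGProjective) (hR : 𝓗.left.RightFGProjective) :
    (𝓗.left.rightDual hR).IsHom (𝓗.left.leftDual hL) h.dualS (AlgHom.id k A) where
  map_one := LeftBialgebroid.LDual.ext fun u => by
    rw [dualS_val, dualAct, map_balSum]
    change _ = 𝓗.left.ε u
    conv_rhs => rw [← 𝓗.left.counit_s (𝓗.left.ε u), ← balSum_antipode_right, map_balSum]
    exact balSum_congr fun p q => (𝓗.left.counit_mul_t _ _).symm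
  map_mul := by
    let G := LinearEquiv.ofBijective 𝓗.S hS
    exact 𝓗.dualS_mul (T := G.symm.toLinearMap) G.symm_apply_apply G.apply_symm_apply h
  map_s a := LeftBialgebroid.LDual.ext fun u => by
    rw [dualS_val, dualAct, map_balSum]
    change _ = 𝓗.left.ε u * a
    have h1 : 𝓗.left.ε u * a = 𝓗.left.ε (𝓗.left.s (𝓗.left.ε u) * 𝓗.left.s a) := by
      rw [𝓗.left.counit_s_mul, 𝓗.left.counit_s]
    rw [h1, ← balSum_antipode_right, balSum_mul, map_balSum]
    refine balSum_congr fun p q => ?_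
    change 𝓗.left.ε (p * 𝓗.left.t (op (𝓗.left.ε (𝓗.S q * 𝓗.left.s a)))) = _
    rw [← 𝓗.left.counit_mul_t, mul_assoc]
  map_t a := LeftBialgebroid.LDual.ext fun u => by
    rw [dualS_val, dualAct, map_balSum]
    change _ = 𝓗.left.ε (u * 𝓗.left.t (op a))
    conv_rhs => rw [← 𝓗.right.balSum_counit_right u, balSum_mul, map_balSum]
    refine balSum_congr fun p q => ?_
    change 𝓗.left.ε (p * 𝓗.left.t (op (a * 𝓗.left.ε (𝓗.S q)))) = _
    obtain ⟨c, hc⟩ := 𝓗.exists_left_t (𝓗.right.counit q)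
    rw [left_counit_antipode, hc, 𝓗.left.counit_t, op_mul, map_mul 𝓗.left.t, mul_assoc]
  map_counit φ := by
    change (h.dualS φ).val 1 = φ.val 1
    rw [dualS_val, dualAct_one, 𝓗.left.counit_t]
  map_comul φ x hx := by
    obtain ⟨n, φ₁, φ₂, rfl⟩ := TensorProduct.exists_sum_tmul_eq x
    rw [map_sum]
    exact ((𝓗.left.leftDual_comul_iff hL _ _ _).2 (𝓗.dualS_val_mul h φ φ₁ φ₂
      ((𝓗.left.rightDual_comul_iff hR _ _ _).1 hx))).symm

end HopfAlgebroid

theorem mainTheorem4 {k A B H : Type*} [CommRing k] [Ring A] [Algebra k A] [Ring B] [Algebra k B]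
    [Ring H] [Algebra k H] (𝓗 : HopfAlgebroid k A B H)
    (hL : 𝓗.left.LeftFGProjective) (hR : 𝓗.left.RightFGProjective) :
    ∃ (hS : 𝓗.left.IsHom 𝓗.right.opCoop 𝓗.antipodeOp 𝓗.nu)
      (hℓ : 𝓗.left.IsLeftHopf) (hr : 𝓗.right.opCoop.IsLeftHopf),
      hS.transposeL ∘ₗ hr.dualS = hℓ.dualS ∘ₗ hS.transposeR ∧
      (Function.Bijective 𝓗.S →
        ∃ (hL' : 𝓗.right.opCoop.LeftFGProjective) (hR' : 𝓗.right.opCoop.RightFGProjective),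
          (𝓗.right.opCoop.rightDual hR').IsHom (𝓗.left.rightDual hR) hS.transposeR
            (𝓗.nu.symm : Bᵐᵒᵖ →ₐ[k] A) ∧
          (𝓗.right.opCoop.leftDual hL').IsHom (𝓗.left.leftDual hL) hS.transposeL
            (𝓗.nu.symm : Bᵐᵒᵖ →ₐ[k] A) ∧
          (𝓗.right.opCoop.rightDual hR').IsHom (𝓗.right.opCoop.leftDual hL') hr.dualS
            (AlgHom.id k Bᵐᵒᵖ) ∧
          (𝓗.left.rightDual hR).IsHom (𝓗.left.leftDual hL) hℓ.dualS (AlgHom.id k A)) := by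
  have hS := 𝓗.isHom_antipodeOp
  have hℓ := 𝓗.left_isLeftHopf
  have hr := 𝓗.opCoop_isLeftHopf
  have hsq := hS.transposeL_comp_dualS hℓ hr
  refine ⟨hS, hℓ, hr, hsq, fun hbij => ?_⟩
  have hbij' : Function.Bijective 𝓗.antipodeOp := (opEquiv.bijective).comp hbij
  let F : H ≃+ Hᵐᵒᵖ := AddEquiv.ofBijective 𝓗.antipodeOp.toAddMonoidHom hbij'
  have hL' : 𝓗.right.opCoop.LeftFGProjective :=
    IsFGProjective.of_equiv hL 𝓗.nu.toRingEquiv F fun a u =>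
      (hS.map_mul _ _).trans (congrArg (· * _) (hS.map_s a))
  have hR' : 𝓗.right.opCoop.RightFGProjective :=
    IsFGProjective.of_equiv hR (RingEquiv.op 𝓗.nu.toRingEquiv) F fun a u =>
      (hS.map_mul _ _).trans (congrArg (· * _) (hS.map_t (unop a)))
  have h1 := hS.isHom_transposeR hR hR'
  have h2 := hS.isHom_transposeL hL hL'
  have h4 := 𝓗.isHom_dualS hbij hℓ hL hR
  refine ⟨hL', hR', h1, h2, ?_, h4⟩
  let G := LinearEquiv.ofBijective _ (hS.transposeL_bijective hbij')
  have h5 : (𝓗.right.opCoop.leftDual hL').IsHom (𝓗.left.leftDual hL) G.toLinearMap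
    (𝓗.nu.symm : Bᵐᵒᵖ →ₐ[k] A) := h2
  have h6 := h5.symm.comp (h4.comp h1)
  have e1 : G.symm.toLinearMap ∘ₗ hℓ.dualS ∘ₗ hS.transposeR = hr.dualS := by
    rw [← hsq]
    exact LinearMap.ext fun φ => G.symm_apply_apply _
  have e2 : ((𝓗.nu.symm.symm : A ≃ₐ[k] Bᵐᵒᵖ) : A →ₐ[k] Bᵐᵒᵖ).comp
      ((AlgHom.id k A).comp (𝓗.nu.symm : Bᵐᵒᵖ →ₐ[k] A)) = AlgHom.id k Bᵐᵒᵖ :=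
    AlgHom.ext fun b => 𝓗.nu.apply_symm_apply b
  rwa [e1, e2] at h6
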